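/- Conventions. A simplicial groupoid is a simplicial object $G=(G_n)_{n\ge 0}$ in groupoids whose simplicial set of objects is constant. $\bar{W}G$ denotes the codiagonal $\nabla BG$ of its bisimplicial nerve; explicitly, a $p$-simplex of $\bar WG$ is a string $x_0\xrightarrow{g_1}x_1\to\cdots\xrightarrow{g_p}x_p$ with $g_k$ a morphism of $G_{p-k}$. A simplicial group is regarded as a simplicial groupoid with one object. Fibrations and weak equivalences of simplicial sets are those of the Kan model structure. A morphism $f\colon G\to H$ of simplicial groupoids is an abelian extension if it is an isomorphism on objects, surjective on morphisms in each level, and the groups $A(x)_n=\ker(G_n(x,x)\to H_n(fx,fx))$ are abelian for all objects $x$ and all $n$. Then $A$ is a representation of $H$ in simplicial abelian groups, with $H$ acting through conjugation by lifts to $G$. For a simplicial abelian group $A$, $\bar WA$ is again a simplicial abelian group, with $(\bar WA)_p=A_{p-1}\times\cdots\times A_0$; for an $H$-representation $A$, $H_p$ acts on the factor $A_{p-k}$ of $(\bar WA)_p$ through $(\partial_0)^k\colon H_p\to H_{p-k}$, which makes $\bar WA$ an $H$-representation and defines the semidirect product $H\ltimes\bar WA$, with its projection to $H$ and its zero section $0\colon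 H\to H\ltimes\bar WA$. (1) To each abelian extension $f\colon G\to H$ of simplicial groupoids, with kernel $A$, one can associate, functorially with respect to commutative squares, a simplicial set $Y'$, a Kan fibration $p\colon Y'\to\bar W[H\ltimes\bar WA]$ and a map $i\colon \bar WG\to Y'$, such that the composite $w\colon Y'\to\bar W[H\ltimes\bar WA]\to\bar WH$ of $p$ with the projection is a weak equivalence, and $$\begin{array}{ccc}\bar WG&\xrightarrow{\ i\ }&Y'\\ {\scriptstyle \bar Wf}\downarrow&&\downarrow{\scriptstyle p}\\ \bar WH&\xrightarrow{\ \bar W0\ }&\bar W[H\ltimes\bar WA]\end{array}$$ is both a pullback square (so $Y'\times_{\bar W[H\ltimes\bar WA]}\bar WH\cong\bar WG$) and a homotopy pullback square. Thus $\bar WG$ is the homotopy pullback, along the zero section, of the classifying map $p\circ w^{-1}\colon\bar WH\to\bar W[H\ltimes\bar WA]$ in the homotopy category. (2) To each surjection $f\colon G\to H$ of simplicial groups with central kernel $A$ one can associate, functorially with respect to commutative squares, a simplicial set $Y'$, a weak equivalence $w\colon Y'\to\bar WH$, a Kan fibration $\phi\colon Y'\to\bar W^2A$ and a map $i\colon\bar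 WG\to Y'$ with $w\circ i=\bar Wf$, such that $i$ identifies $\bar WG$ with the fibre of $\phi$ over the base point $0$ of $\bar W^2A$, and this fibre is also the homotopy fibre of $\phi$ over $0$. -/

import Mathlib

open CategoryTheory Limits Opposite Simplicial

universe u

noncomputable section

/-! ## Homotopy theory of simplicial sets -/

section Homotopy

/-- Kan fibrations: right lifting property against all horn inclusions. -/
def IsKanFibration {X Y : SSet.{u}} (p : X ⟶ Y) : Prop :=
  SSet.modelCategoryQuillen.J.rlp p

/-- Weak equivalences of the Kan model structure: `f : X ⟶ Y` is a weak equivalence iff for every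
Kan complex `Z` composition with `f` induces a bijection `[Y, Z] → [X, Z]` on simplicial homotopy
classes of maps (simplicial homotopy is an equivalence relation on maps into a Kan complex). -/
def IsWeakEquivalence {X Y : SSet.{u}} (f : X ⟶ Y) : Prop :=
  ∀ Z : SSet.{u}, Z.KanComplex →
    (∀ g : X ⟶ Z, ∃ h : Y ⟶ Z, Nonempty (SSet.Homotopy (f ≫ h) g)) ∧
    (∀ h h' : Y ⟶ Z, Nonempty (SSet.Homotopy (f ≫ h) (f ≫ h')) → Nonempty (SSet.Homotopy h h'))

/-- The square
```
X --a--> Y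
|b       |p
v        v
Z --q--> B
```
is homotopy cartesian: it commutes, and after replacing `p` by a Kan fibration `r : E ⟶ B` (through
a weak equivalence `j : Y ⟶ E`) the induced map `X ⟶ E ×_B Z` is a weak equivalence. -/
def IsHomotopyPullback {X Y Z B : SSet.{u}} (a : X ⟶ Y) (b : X ⟶ Z) (p : Y ⟶ B) (q : Z ⟶ B) :
    Prop :=
  ∃ (_ : a ≫ p = b ≫ q) (E : SSet.{u}) (j : Y ⟶ E) (r : E ⟶ B) (hp : j ≫ r = p),
    IsWeakEquivalence j ∧ IsKanFibration r ∧
      IsWeakEquivalence (pullback.lift (f := r) (g := q) (a ≫ j) b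
        (by rw [Category.assoc, hp]; assumption))

end Homotopy

/-! ## Final segments of simplices -/

/-- The final segment `{k, …, p}` of `[p]`, as the object `[p - k]`. -/
def tail (p : SimplexCategory) (k : Fin (p.len + 1)) : SimplexCategory :=
  ⦋p.len - k.val⦌

/-- The inclusion `{k, …, p} ⊆ {j, …, p}` for `j ≤ k`, that is, `t ↦ t + (k - j)`.
It induces the iterated face operator `(∂₀)^(k-j)`. -/
def tailIncl (p : SimplexCategory) {j k : Fin (p.len + 1)} (h : j ≤ k) : tail p k ⟶ tail p j :=
  SimplexCategory.Hom.mk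
    { toFun := fun t => ⟨t.val + (k.val - j.val), by
        have h1 : j.val ≤ k.val := h
        have h2 := k.isLt
        have h3 : t.val < p.len - k.val + 1 := t.isLt
        change _ < p.len - j.val + 1
        omega⟩
      monotone' := fun s t hst => by
        have h1 : s.val ≤ t.val := hst
        change s.val + _ ≤ t.val + _
        omega }

/-- The inclusion `{k, …, p} ⊆ {0, …, p}`, inducing `(∂₀)^k`. -/
def lastIncl (p : SimplexCategory) (k : Fin (p.len + 1)) : tail p k ⟶ p :=
  SimplexCategory.Hom.mk
    { toFun := fun t => ⟨t.val + k.val, by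
        have h2 := k.isLt
        have h3 : t.val < p.len - k.val + 1 := t.isLt
        omega⟩
      monotone' := fun s t hst => by
        have h1 : s.val ≤ t.val := hst
        change s.val + _ ≤ t.val + _
        omega }

/-- The restriction `{j, …, q} → {θ j, …, p}` of a monotone map `θ : [q] → [p]`. -/
def tailMap {q p : SimplexCategory} (θ : q ⟶ p) (j : Fin (q.len + 1)) :
    tail q j ⟶ tail p (θ.toOrderHom j) :=
  SimplexCategory.Hom.mk
    { toFun := fun t => ⟨(θ.toOrderHom ⟨t.val + j.val, by
            have h2 := j.isLt
            have h3 : t.val < q.len - j.val + 1 := t.isLt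
            omega⟩).val - (θ.toOrderHom j).val, by
        change _ < p.len - _ + 1
        have h1 := (θ.toOrderHom ⟨t.val + j.val, by
            have h2 := j.isLt
            have h3 : t.val < q.len - j.val + 1 := t.isLt
            omega⟩).isLt
        have h2 := (θ.toOrderHom j).isLt
        omega⟩
      monotone' := fun s t hst => by
        apply Nat.sub_le_sub_right
        apply θ.toOrderHom.monotone
        have h1 : s.val ≤ t.val := hst
        change s.val + _ ≤ t.val + _
        omega }

theorem tailMap_id (p : SimplexCategory) (j : Fin (p.len + 1)) :
    tailMap (𝟙 p) j = 𝟙 (tail p j) := by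
  apply SimplexCategory.Hom.ext
  ext t
  change t.val + j.val - j.val = t.val
  omega

theorem tailMap_comp {r q p : SimplexCategory} (ψ : r ⟶ q) (θ : q ⟶ p) (j : Fin (r.len + 1)) :
    tailMap (ψ ≫ θ) j = tailMap ψ j ≫ tailMap θ (ψ.toOrderHom j) := by
  apply SimplexCategory.Hom.ext
  ext t
  have h2 := j.isLt
  have h3 : t.val < r.len - j.val + 1 := t.isLt
  have key : ψ.toOrderHom j ≤ ψ.toOrderHom ⟨t.val + j.val, by omega⟩ := by
    apply ψ.toOrderHom.monotone
    change j.val ≤ t.val + j.val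
    omega
  have key' : (ψ.toOrderHom j).val ≤ (ψ.toOrderHom ⟨t.val + j.val, by omega⟩).val := key
  change (θ.toOrderHom (ψ.toOrderHom ⟨t.val + j.val, _⟩)).val - _ =
    (θ.toOrderHom ⟨(ψ.toOrderHom ⟨t.val + j.val, _⟩).val - (ψ.toOrderHom j).val
      + (ψ.toOrderHom j).val, _⟩).val - _
  have e : (⟨(ψ.toOrderHom ⟨t.val + j.val, by omega⟩).val - (ψ.toOrderHom j).val
      + (ψ.toOrderHom j).val, by omega⟩ : Fin (q.len + 1)) =
      ψ.toOrderHom ⟨t.val + j.val, by omega⟩ := by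
    apply Fin.ext
    change _ - _ + _ = _
    omega
  rw [e]
  rfl

theorem tailMap_incl {q p : SimplexCategory} (θ : q ⟶ p) {j k : Fin (q.len + 1)} (h : j ≤ k) :
    tailMap θ k ≫ tailIncl p (θ.toOrderHom.monotone h) = tailIncl q h ≫ tailMap θ j := by
  apply SimplexCategory.Hom.ext
  ext t
  have h1 : j.val ≤ k.val := h
  have h2 := k.isLt
  have h3 : t.val < q.len - k.val + 1 := t.isLt
  have key : (θ.toOrderHom j).val ≤ (θ.toOrderHom k).val := θ.toOrderHom.monotone h
  have key' : (θ.toOrderHom k).val ≤ (θ.toOrderHom ⟨t.val + k.val, by omega⟩).val := by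
    apply θ.toOrderHom.monotone
    change k.val ≤ t.val + k.val
    omega
  change (θ.toOrderHom ⟨t.val + k.val, _⟩).val - (θ.toOrderHom k).val
      + ((θ.toOrderHom k).val - (θ.toOrderHom j).val) =
    (θ.toOrderHom ⟨t.val + (k.val - j.val) + j.val, _⟩).val - (θ.toOrderHom j).val
  have e : (⟨t.val + (k.val - j.val) + j.val, by omega⟩ : Fin (q.len + 1)) =
      ⟨t.val + k.val, by omega⟩ := by
    apply Fin.ext
    change t.val + (k.val - j.val) + j.val = t.val + k.val
    omega
  rw [e]
  omega

theorem tailMap_last {q p : SimplexCategory} (θ : q ⟶ p) (j : Fin (q.len + 1)) :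
    tailMap θ j ≫ lastIncl p (θ.toOrderHom j) = lastIncl q j ≫ θ := by
  apply SimplexCategory.Hom.ext
  ext t
  have h2 := j.isLt
  have h3 : t.val < q.len - j.val + 1 := t.isLt
  have key : (θ.toOrderHom j).val ≤ (θ.toOrderHom ⟨t.val + j.val, by omega⟩).val := by
    apply θ.toOrderHom.monotone
    change j.val ≤ t.val + j.val
    omega
  change (θ.toOrderHom ⟨t.val + j.val, _⟩).val - (θ.toOrderHom j).val + (θ.toOrderHom j).val
    = (θ.toOrderHom ⟨t.val + j.val, _⟩).val
  omega

theorem tailIncl_last (p : SimplexCategory) {j k : Fin (p.len + 1)} (h : j ≤ k) :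
    tailIncl p h ≫ lastIncl p j = lastIncl p k := by
  apply SimplexCategory.Hom.ext
  ext t
  have h1 : j.val ≤ k.val := h
  change t.val + (k.val - j.val) + j.val = t.val + k.val
  omega

theorem sset_map_id (X : SSet.{u}) {n : SimplexCategoryᵒᵖ} (x : X.obj n) :
    X.map (𝟙 n) x = x := by
  rw [X.map_id]; rfl

theorem sset_map_comp (X : SSet.{u}) {n m k : SimplexCategoryᵒᵖ} (θ : n ⟶ m) (ψ : m ⟶ k)
    (x : X.obj n) : X.map (θ ≫ ψ) x = X.map ψ (X.map θ x) := by
  rw [X.map_comp]; rfl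

theorem ab_map_id (A : SimplicialObject AddCommGrpCat.{u}) {n : SimplexCategoryᵒᵖ}
    (a : A.obj n) : A.map (𝟙 n) a = a := by
  rw [A.map_id]; rfl

theorem ab_map_comp (A : SimplicialObject AddCommGrpCat.{u}) {n m k : SimplexCategoryᵒᵖ}
    (θ : n ⟶ m) (ψ : m ⟶ k) (a : A.obj n) : A.map (θ ≫ ψ) a = A.map ψ (A.map θ a) := by
  rw [A.map_comp]; rfl

/-! ## Simplicial groupoids -/

/-- A simplicial groupoid (with constant objects): a simplicial object in groupoids whose
simplicial set of objects is the constant one on `Obj`. For each `n`, the sets `(Hom x y)_n`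
are the morphism sets of the groupoid in level `n`; simplicial operators are functors that are
the identity on objects. -/
structure SGpd where
  Obj : Type u
  Hom : Obj → Obj → SSet.{u}
  id : ∀ (x : Obj) (n : SimplexCategoryᵒᵖ), (Hom x x).obj n
  comp : ∀ {x y z : Obj} {n : SimplexCategoryᵒᵖ},
    (Hom x y).obj n → (Hom y z).obj n → (Hom x z).obj n
  inv : ∀ {x y : Obj} {n : SimplexCategoryᵒᵖ}, (Hom x y).obj n → (Hom y x).obj n
  id_comp : ∀ {x y : Obj} {n : SimplexCategoryᵒᵖ} (g : (Hom x y).obj n), comp (id x n) g = g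
  comp_id : ∀ {x y : Obj} {n : SimplexCategoryᵒᵖ} (g : (Hom x y).obj n), comp g (id y n) = g
  assoc : ∀ {x y z w : Obj} {n : SimplexCategoryᵒᵖ} (g : (Hom x y).obj n) (h : (Hom y z).obj n)
    (k : (Hom z w).obj n), comp (comp g h) k = comp g (comp h k)
  inv_comp : ∀ {x y : Obj} {n : SimplexCategoryᵒᵖ} (g : (Hom x y).obj n),
    comp (inv g) g = id y n
  comp_inv : ∀ {x y : Obj} {n : SimplexCategoryᵒᵖ} (g : (Hom x y).obj n),
    comp g (inv g) = id x n
  map_id : ∀ (x : Obj) {n m : SimplexCategoryᵒᵖ} (θ : n ⟶ m),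
    (Hom x x).map θ (id x n) = id x m
  map_comp : ∀ {x y z : Obj} {n m : SimplexCategoryᵒᵖ} (θ : n ⟶ m) (g : (Hom x y).obj n)
    (h : (Hom y z).obj n),
    (Hom x z).map θ (comp g h) = comp ((Hom x y).map θ g) ((Hom y z).map θ h)

namespace SGpd

/-- Morphisms of simplicial groupoids: simplicial functors. -/
@[ext]
structure Mor (G H : SGpd.{u}) where
  obj : G.Obj → H.Obj
  map : ∀ x y, G.Hom x y ⟶ H.Hom (obj x) (obj y)
  map_id : ∀ x n, (map x x).app n (G.id x n) = H.id (obj x) n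
  map_comp : ∀ {x y z n} (g : (G.Hom x y).obj n) (h : (G.Hom y z).obj n),
    (map x z).app n (G.comp g h) = H.comp ((map x y).app n g) ((map y z).app n h)

instance : Category SGpd.{u} where
  Hom := Mor
  id G :=
    { obj := fun x => x
      map := fun x y => 𝟙 (G.Hom x y)
      map_id := fun _ _ => rfl
      map_comp := fun _ _ => rfl }
  comp F F' :=
    { obj := fun x => F'.obj (F.obj x)
      map := fun x y => F.map x y ≫ F'.map (F.obj x) (F.obj y)
      map_id := fun x n => by
        change (F'.map _ _).app n ((F.map x x).app n _) = _
        rw [F.map_id, F'.map_id]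
      map_comp := fun {x y z n} g h => by
        change (F'.map _ _).app n ((F.map x z).app n _) = _
        rw [F.map_comp, F'.map_comp]
        rfl }

theorem inv_unique (G : SGpd.{u}) {x y : G.Obj} {n} (g : (G.Hom x y).obj n)
    (h : (G.Hom y x).obj n) (e : G.comp h g = G.id y n) : h = G.inv g := by
  rw [← G.comp_id h, ← G.comp_inv g, ← G.assoc, e, G.id_comp]

theorem map_inv (G : SGpd.{u}) {x y : G.Obj} {n m : SimplexCategoryᵒᵖ} (θ : n ⟶ m)
    (g : (G.Hom x y).obj n) : (G.Hom y x).map θ (G.inv g) = G.inv ((G.Hom x y).map θ g) := by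
  apply inv_unique
  rw [← G.map_comp, G.inv_comp, G.map_id]

theorem Mor.map_inv {G H : SGpd.{u}} (F : Mor G H) {x y : G.Obj} {n}
    (g : (G.Hom x y).obj n) : (F.map y x).app n (G.inv g) = H.inv ((F.map x y).app n g) := by
  apply inv_unique
  rw [← F.map_comp, G.inv_comp, F.map_id]

theorem Mor.naturality {G H : SGpd.{u}} (F : Mor G H) {x y : G.Obj} {n m : SimplexCategoryᵒᵖ}
    (θ : n ⟶ m) (g : (G.Hom x y).obj n) :
    (F.map x y).app m ((G.Hom x y).map θ g) =
      (H.Hom (F.obj x) (F.obj y)).map θ ((F.map x y).app n g) :=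
  ConcreteCategory.congr_hom ((F.map x y).naturality θ) g

/-! ### The functor `W̄` -/

/-- A `p`-simplex of `W̄ G`: objects `x₀, …, x_p` and morphisms `g_{jk} : x_j ⟶ x_k` of the groupoid
`G_{p-k}`, for `j ≤ k`, with `g_{jj} = id` and `g_{ik} = (∂₀)^{k-j} g_{ij}` followed by `g_{jk}`.

This is a `p`-simplex `(s₀, …, s_p)` of the codiagonal `∇` of the bisimplicial nerve of `G`:
`s_k` is a `k`-simplex of the nerve of the groupoid `G_{p-k}`, the relation `∂₀ᵛ s_k = ∂ʰ_{k+1} s_{k+1}`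
says that the restriction of the `(k+1)`-chain `s_{k+1}` to its first `k+1` objects is `∂₀ s_k`, and
`g_{jk}` is the morphism from the `j`-th to the last object of `s_k`. Equivalently, it is the string
of the morphisms `g_{k-1,k} ∈ G_{p-k}` for `k = 1, …, p`. -/
@[ext]
structure WSimplex (G : SGpd.{u}) (p : SimplexCategory) where
  obj : Fin (p.len + 1) → G.Obj
  hom : ∀ (j k : Fin (p.len + 1)), j ≤ k → (G.Hom (obj j) (obj k)).obj (op (tail p k))
  hom_id : ∀ j, hom j j le_rfl = G.id (obj j) _
  hom_comp : ∀ (i j k) (hij : i ≤ j) (hjk : j ≤ k),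
    hom i k (hij.trans hjk) =
      G.comp ((G.Hom (obj i) (obj j)).map (tailIncl p hjk).op (hom i j hij)) (hom j k hjk)

/-- The simplicial operators of `W̄ G`; on `(s₀, …, s_p)` as above, `θ : [q] → [p]` acts by
sending `s_{θ k}` to its restriction along `θ : [k] → [θ k]` in the nerve direction and along
`θ : {k, …, q} → {θ k, …, p}` in the simplicial direction. -/
def WSimplex.restrict {G : SGpd.{u}} {q p : SimplexCategory} (θ : q ⟶ p) (s : G.WSimplex p) :
    G.WSimplex q where
  obj j := s.obj (θ.toOrderHom j)
  hom j k h := (G.Hom _ _).map (tailMap θ k).op (s.hom _ _ (θ.toOrderHom.monotone h))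
  hom_id j := by rw [s.hom_id, G.map_id]
  hom_comp i j k hij hjk := by
    rw [s.hom_comp _ _ _ (θ.toOrderHom.monotone hij) (θ.toOrderHom.monotone hjk), G.map_comp,
      ← Functor.map_comp_apply, ← Functor.map_comp_apply, ← op_comp, ← op_comp, tailMap_incl]

/-- The simplicial set `W̄ G`. -/
def WbarObj (G : SGpd.{u}) : SSet.{u} where
  obj p := G.WSimplex p.unop
  map θ := TypeCat.ofHom (fun s => s.restrict θ.unop)
  map_id p := by
    apply ConcreteCategory.hom_ext; intro s
    refine WSimplex.ext rfl (heq_of_eq ?_)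
    funext j k h
    change (G.Hom _ _).map (tailMap (𝟙 p.unop) k).op (s.hom j k h) = s.hom j k h
    rw [tailMap_id]
    exact sset_map_id (G.Hom _ _) _
  map_comp {p q r} θ ψ := by
    apply ConcreteCategory.hom_ext; intro s
    refine WSimplex.ext rfl (heq_of_eq ?_)
    funext j k h
    change (G.Hom _ _).map (tailMap (ψ.unop ≫ θ.unop) k).op _ =
      (G.Hom _ _).map (tailMap ψ.unop k).op ((G.Hom _ _).map (tailMap θ.unop _).op _)
    rw [tailMap_comp]
    exact sset_map_comp (G.Hom _ _) _ _ _

/-- The functor `W̄` from simplicial groupoids to simplicial sets. -/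
def Wbar : SGpd.{u} ⥤ SSet.{u} where
  obj := WbarObj
  map {G H} F :=
    { app := fun p => TypeCat.ofHom (fun s =>
        { obj := fun j => F.obj (s.obj j)
          hom := fun j k h => (F.map _ _).app _ (s.hom j k h)
          hom_id := fun j => by rw [s.hom_id, F.map_id]
          hom_comp := fun i j k hij hjk => by
            rw [s.hom_comp i j k hij hjk, F.map_comp, F.naturality] })
      naturality := fun p q θ => by
        apply ConcreteCategory.hom_ext; intro s
        refine WSimplex.ext rfl (heq_of_eq ?_)
        funext j k h
        exact F.naturality _ _ }
  map_id G := rfl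
  map_comp F F' := rfl

/-! ### Transport of morphisms and full images -/

/-- Transport of morphisms along equalities of objects. -/
def homCast (H : SGpd.{u}) {x x' y y' : H.Obj} (hx : x = x') (hy : y = y') :
    H.Hom x y ⟶ H.Hom x' y' :=
  eqToHom (by rw [hx, hy])

@[simp]
theorem homCast_rfl (H : SGpd.{u}) (x y : H.Obj) :
    H.homCast (rfl : x = x) (rfl : y = y) = 𝟙 _ := rfl

theorem homCast_id (H : SGpd.{u}) {x x' : H.Obj} (hx : x = x') (n) :
    (H.homCast hx hx).app n (H.id x n) = H.id x' n := by
  subst hx; rfl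

theorem homCast_comp (H : SGpd.{u}) {x x' y y' z z' : H.Obj} (hx : x = x') (hy : y = y')
    (hz : z = z') {n} (g : (H.Hom x y).obj n) (h : (H.Hom y z).obj n) :
    (H.homCast hx hz).app n (H.comp g h) =
      H.comp ((H.homCast hx hy).app n g) ((H.homCast hy hz).app n h) := by
  subst hx hy hz; rfl

theorem homCast_trans (H : SGpd.{u}) {x x' x'' y y' y'' : H.Obj} (hx : x = x') (hy : y = y')
    (hx' : x' = x'') (hy' : y' = y'') :
    H.homCast hx hy ≫ H.homCast hx' hy' = H.homCast (hx.trans hx') (hy.trans hy') := by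
  subst hx hy hx' hy'; rfl

theorem homCast_map {H K : SGpd.{u}} (v : H ⟶ K) {x x' y y' : H.Obj} (hx : x = x') (hy : y = y') :
    H.homCast hx hy ≫ v.map x' y' =
      v.map x y ≫ K.homCast (congrArg v.obj hx) (congrArg v.obj hy) := by
  subst hx hy; rfl

theorem homCast_of_eq {G H : SGpd.{u}} {v w : G ⟶ H} (e : v = w) (x y : G.Obj) :
    v.map x y ≫ H.homCast (congrArg (fun t => Mor.obj t x) e)
      (congrArg (fun t => Mor.obj t y) e) = w.map x y := by
  subst e; rfl

/-- The simplicial groupoid with object set `O` obtained by pulling `H` back along `φ : O → Ob H`.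
When `φ` is a bijection it is `H` with its objects relabelled. -/
abbrev pull (H : SGpd.{u}) {O : Type u} (φ : O → H.Obj) : SGpd.{u} where
  Obj := O
  Hom x y := H.Hom (φ x) (φ y)
  id x n := H.id (φ x) n
  comp g h := H.comp g h
  inv g := H.inv g
  id_comp := H.id_comp
  comp_id := H.comp_id
  assoc := H.assoc
  inv_comp := H.inv_comp
  comp_inv := H.comp_inv
  map_id x := H.map_id (φ x)
  map_comp := H.map_comp

/-- The functor between pullbacks induced by `v : H ⟶ H'` and a compatible map of objects. -/
def pullMap {H H' : SGpd.{u}} (v : H ⟶ H') {O O' : Type u} (φ : O → H.Obj) (φ' : O' → H'.Obj)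
    (α : O → O') (hα : ∀ x, v.obj (φ x) = φ' (α x)) : H.pull φ ⟶ H'.pull φ' :=
  Mor.mk (G := H.pull φ) (H := H'.pull φ') α
    (fun x y => v.map (φ x) (φ y) ≫ H'.homCast (hα x) (hα y))
    (fun x n => by
      change (H'.homCast _ _).app n ((v.map _ _).app n (H.id _ n)) = _
      rw [v.map_id, homCast_id])
    (fun {x y z n} g h => by
      refine Eq.trans (congrArg ((H'.homCast (hα x) (hα z)).app n)
        (v.map_comp (x := φ x) (y := φ y) (z := φ z) g h)) ?_
      exact homCast_comp H' (hα x) (hα y) (hα z) _ _)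

/-- The projection from the pullback along `φ`, given by `φ` on objects. -/
def pullProj (H : SGpd.{u}) {O : Type u} (φ : O → H.Obj) : H.pull φ ⟶ H :=
  Mor.mk (G := H.pull φ) (H := H) φ (fun x y => 𝟙 (H.Hom (φ x) (φ y)))
    (fun _ _ => rfl) (fun _ _ => rfl)

end SGpd

/-! ## The simplicial abelian group `W̄ A` -/

/-- The group of `p`-simplices of `W̄ A` for a simplicial abelian group `A`: families
`a_{jk} ∈ A_{p-k}`, `j ≤ k`, with `a_{ik} = (∂₀)^{k-j} a_{ij} + a_{jk}` (so `a_{jj} = 0`).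
This is the description of `SGpd.WSimplex` for `A` as a simplicial groupoid with one object;
the entries `a_{k-1,k}` identify it with `A_{p-1} × ⋯ × A_0`. -/
@[ext]
structure WbarAbSimplex (A : SimplicialObject AddCommGrpCat.{u}) (p : SimplexCategory) where
  val : ∀ (j k : Fin (p.len + 1)), j ≤ k → A.obj (op (tail p k))
  cocycle : ∀ (i j k) (hij : i ≤ j) (hjk : j ≤ k),
    val i k (hij.trans hjk) = A.map (tailIncl p hjk).op (val i j hij) + val j k hjk

section

variable (A : SimplicialObject AddCommGrpCat.{u}) (p : SimplexCategory)

instance : Zero (WbarAbSimplex A p) where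
  zero := ⟨fun _ _ _ => 0, fun i j k hij hjk => by simp⟩

instance : Add (WbarAbSimplex A p) where
  add a b := ⟨fun j k h => a.val j k h + b.val j k h, fun i j k hij hjk => by
    rw [a.cocycle i j k hij hjk, b.cocycle i j k hij hjk, map_add]
    abel⟩

instance : Neg (WbarAbSimplex A p) where
  neg a := ⟨fun j k h => -a.val j k h, fun i j k hij hjk => by
    rw [a.cocycle i j k hij hjk, map_neg]
    abel⟩

instance : AddCommGroup (WbarAbSimplex A p) where
  add_assoc a b c := WbarAbSimplex.ext (by funext j k h; exact add_assoc _ _ _)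
  zero_add a := WbarAbSimplex.ext (by funext j k h; exact zero_add _)
  add_zero a := WbarAbSimplex.ext (by funext j k h; exact add_zero _)
  neg_add_cancel a := WbarAbSimplex.ext (by funext j k h; exact neg_add_cancel _)
  add_comm a b := WbarAbSimplex.ext (by funext j k h; exact add_comm _ _)
  nsmul := nsmulRec
  zsmul := zsmulRec

end

/-- Simplicial operators of `W̄ A`. -/
def wbarAbRestrict (A : SimplicialObject AddCommGrpCat.{u}) {q p : SimplexCategory} (θ : q ⟶ p) :
    WbarAbSimplex A p →+ WbarAbSimplex A q where
  toFun a := ⟨fun j k h =>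
      A.map (tailMap θ k).op (a.val (θ.toOrderHom j) (θ.toOrderHom k) (θ.toOrderHom.monotone h)), by
    intro i j k hij hjk
    rw [a.cocycle _ _ _ (θ.toOrderHom.monotone hij) (θ.toOrderHom.monotone hjk), map_add,
      ← Functor.map_comp_apply, ← Functor.map_comp_apply, ← op_comp, ← op_comp, tailMap_incl]⟩
  map_zero' := by
    apply WbarAbSimplex.ext
    funext j k h
    exact map_zero _
  map_add' a b := by
    apply WbarAbSimplex.ext
    funext j k h
    exact map_add _ _ _

/-- The functor `W̄` from simplicial abelian groups to simplicial abelian groups. -/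
def wbarAb : SimplicialObject AddCommGrpCat.{u} ⥤ SimplicialObject AddCommGrpCat.{u} where
  obj A :=
    { obj := fun p => AddCommGrpCat.of (WbarAbSimplex A p.unop)
      map := fun θ => AddCommGrpCat.ofHom (wbarAbRestrict A θ.unop)
      map_id := fun p => by
        apply ConcreteCategory.hom_ext; intro (a : WbarAbSimplex A p.unop)
        apply WbarAbSimplex.ext
        funext j k h
        change A.map (tailMap (𝟙 p.unop) k).op (a.val j k h) = a.val j k h
        rw [tailMap_id]
        exact ab_map_id A _
      map_comp := fun {p q r} θ ψ => by
        apply ConcreteCategory.hom_ext; intro (a : WbarAbSimplex A p.unop)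
        apply WbarAbSimplex.ext
        funext j k h
        change A.map (tailMap (ψ.unop ≫ θ.unop) k).op _ =
          A.map (tailMap ψ.unop k).op (A.map (tailMap θ.unop _).op _)
        rw [tailMap_comp]
        exact ab_map_comp A _ _ _ }
  map {A B} f :=
    { app := fun p => AddCommGrpCat.ofHom
        { toFun := fun (a : WbarAbSimplex A p.unop) => WbarAbSimplex.mk (fun j k h => f.app _ (a.val j k h)) (by
            intro i j k hij hjk
            rw [a.cocycle i j k hij hjk, map_add]
            congr 1
            exact ConcreteCategory.congr_hom (f.naturality _) _)
          map_zero' := by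
            apply WbarAbSimplex.ext
            funext j k h
            exact map_zero _
          map_add' := fun a b => by
            apply WbarAbSimplex.ext
            funext j k h
            exact map_add _ _ _ }
      naturality := fun p q θ => by
        apply ConcreteCategory.hom_ext; intro (a : WbarAbSimplex A p.unop)
        apply WbarAbSimplex.ext
        funext j k h
        exact ConcreteCategory.congr_hom (f.naturality _) _ }
  map_id A := rfl
  map_comp f g := rfl

/-! ## Representations and semidirect products -/

/-- An `H`-representation in simplicial abelian groups, for a simplicial groupoid `H`: a simplicial
abelian group `A x` for every object, on which the morphisms of `H_n` act functorially and
additively in level `n`, compatibly with the simplicial operators. -/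
structure SRep (H : SGpd.{u}) where
  A : H.Obj → SimplicialObject AddCommGrpCat.{u}
  act : ∀ {x y : H.Obj} {n : SimplexCategoryᵒᵖ},
    (H.Hom x y).obj n → ((A x).obj n →+ (A y).obj n)
  act_id : ∀ {x : H.Obj} {n : SimplexCategoryᵒᵖ} (a : (A x).obj n), act (H.id x n) a = a
  act_comp : ∀ {x y z : H.Obj} {n : SimplexCategoryᵒᵖ} (g : (H.Hom x y).obj n)
    (h : (H.Hom y z).obj n) (a : (A x).obj n), act (H.comp g h) a = act h (act g a)
  map_act : ∀ {x y : H.Obj} {n m : SimplexCategoryᵒᵖ} (θ : n ⟶ m) (g : (H.Hom x y).obj n)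
    (a : (A x).obj n), (A y).map θ (act g a) = act ((H.Hom x y).map θ g) ((A x).map θ a)

namespace SRep

/-- The `H`-representation `W̄ A`: an element of `H_p` acts on `a_{jk} ∈ A_{p-k}` through its
image under `(∂₀)^k` in `H_{p-k}`. -/
def wbar {H : SGpd.{u}} (M : SRep H) : SRep H where
  A x := wbarAb.obj (M.A x)
  act {x y n} h :=
    { toFun := fun (a : WbarAbSimplex (M.A x) n.unop) => WbarAbSimplex.mk (fun j k hjk =>
          M.act ((H.Hom x y).map (lastIncl n.unop k).op h) (a.val j k hjk)) (by
        intro i j k hij hjk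
        rw [a.cocycle i j k hij hjk, map_add, M.map_act, ← Functor.map_comp_apply, ← op_comp,
          tailIncl_last])
      map_zero' := by
        apply WbarAbSimplex.ext
        funext j k h
        exact map_zero _
      map_add' := fun a b => by
        apply WbarAbSimplex.ext
        funext j k h
        exact map_add _ _ _ }
  act_id {x n} a := by
    apply WbarAbSimplex.ext
    funext j k h
    change M.act ((H.Hom x x).map _ _) _ = _
    rw [H.map_id, M.act_id]
  act_comp {x y z n} g h a := by
    apply WbarAbSimplex.ext
    funext j k hjk
    change M.act ((H.Hom x z).map _ _) _ = _
    rw [H.map_comp, M.act_comp]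
    rfl
  map_act {x y n m} θ g a := by
    apply WbarAbSimplex.ext
    funext j k hjk
    change (M.A y).map (tailMap θ.unop k).op (M.act ((H.Hom x y).map _ g) _) =
      M.act ((H.Hom x y).map _ ((H.Hom x y).map θ g)) ((M.A x).map (tailMap θ.unop k).op _)
    rw [M.map_act, ← Functor.map_comp_apply, ← Functor.map_comp_apply, ← op_comp, tailMap_last]
    rfl

/-- The semidirect product `H ⋉ A`: it has the objects of `H`, and morphisms `x ⟶ y` in level `n`
are pairs `(h, a)` with `h : x ⟶ y` in `H_n` and `a ∈ A(y)_n`. -/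
abbrev semidirect {H : SGpd.{u}} (M : SRep H) : SGpd.{u} where
  Obj := H.Obj
  Hom x y :=
    { obj := fun n => (H.Hom x y).obj n × (M.A y).obj n
      map := fun θ => TypeCat.ofHom (fun c => ((H.Hom x y).map θ c.1, (M.A y).map θ c.2))
      map_id := fun n => by
        apply ConcreteCategory.hom_ext; intro c
        exact Prod.ext (sset_map_id (H.Hom x y) c.1) (ab_map_id (M.A y) c.2)
      map_comp := fun θ ψ => by
        apply ConcreteCategory.hom_ext; intro c
        exact Prod.ext (sset_map_comp (H.Hom x y) _ _ c.1) (ab_map_comp (M.A y) _ _ c.2) }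
  id x n := (H.id x n, 0)
  comp c d := (H.comp c.1 d.1, M.act d.1 c.2 + d.2)
  inv c := (H.inv c.1, -M.act (H.inv c.1) c.2)
  id_comp c := by simp [H.id_comp]
  comp_id c := by simp [H.comp_id, M.act_id]
  assoc c d e := by simp [H.assoc, M.act_comp, add_assoc]
  inv_comp c := by simp [H.inv_comp, ← M.act_comp, M.act_id]
  comp_inv c := by simp [H.comp_inv]
  map_id x n m θ := Prod.ext (H.map_id _ _) (map_zero _)
  map_comp {x y z n m} θ c d := Prod.ext (H.map_comp _ _ _) (by
    change (M.A z).map θ (M.act d.1 c.2 + d.2) = M.act _ _ + _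
    rw [map_add, M.map_act]; rfl)

/-- The projection `H ⋉ A ⟶ H`. -/
def semidirectProj {H : SGpd.{u}} (M : SRep H) : M.semidirect ⟶ H :=
  SGpd.Mor.mk (G := M.semidirect) (H := H) (fun x => x)
    (fun _ _ => { app := fun _ => TypeCat.ofHom (fun c => c.1), naturality := fun _ _ _ => rfl })
    (fun _ _ => rfl) (fun _ _ => rfl)

/-- The zero section `H ⟶ H ⋉ A`. -/
def semidirectZero {H : SGpd.{u}} (M : SRep H) : H ⟶ M.semidirect :=
  SGpd.Mor.mk (G := H) (H := M.semidirect) (fun x => x)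
    (fun x y =>
      { app := fun n => TypeCat.ofHom (fun h => (h, 0))
        naturality := fun n m θ => by
          apply ConcreteCategory.hom_ext; intro h
          exact Prod.ext rfl (map_zero ((M.A y).map θ).hom).symm })
    (fun _ _ => rfl)
    (fun {x y z n} g h => Prod.ext rfl (by
      change (0 : (M.A z).obj n) = M.act h 0 + 0
      simp))

/-- A morphism of representations over a morphism `F` of simplicial groupoids. -/
structure Mor {H H' : SGpd.{u}} (F : H ⟶ H') (M : SRep H) (M' : SRep H') where
  app : ∀ x, M.A x ⟶ M'.A (F.obj x)
  act : ∀ {x y n} (h : (H.Hom x y).obj n) (a : (M.A x).obj n),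
    (app y).app n (M.act h a) = M'.act ((F.map x y).app n h) ((app x).app n a)

/-- Functoriality of `A ↦ W̄ A`. -/
def Mor.wbar {H H' : SGpd.{u}} {F : H ⟶ H'} {M : SRep H} {M' : SRep H'} (φ : Mor F M M') :
    Mor F M.wbar M'.wbar where
  app x := wbarAb.map (φ.app x)
  act {x y n} h a := by
    apply WbarAbSimplex.ext
    funext j k hjk
    change (φ.app y).app _ (M.act ((H.Hom x y).map _ h) _) =
      M'.act ((H'.Hom _ _).map _ ((F.map x y).app n h)) ((φ.app x).app _ _)
    rw [φ.act, F.naturality]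

/-- Functoriality of `H ⋉ A`. -/
def Mor.semidirect {H H' : SGpd.{u}} {F : H ⟶ H'} {M : SRep H} {M' : SRep H'} (φ : Mor F M M') :
    M.semidirect ⟶ M'.semidirect :=
  SGpd.Mor.mk (G := M.semidirect) (H := M'.semidirect) F.obj
    (fun x y =>
      { app := fun n => TypeCat.ofHom (fun c => ((F.map x y).app n c.1, (φ.app y).app n c.2))
        naturality := fun n m θ => by
          apply ConcreteCategory.hom_ext; intro c
          exact Prod.ext (F.naturality _ _)
            (ConcreteCategory.congr_hom ((φ.app y).naturality θ) c.2) })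
    (fun x n => Prod.ext (F.map_id x n) (map_zero _))
    (fun {x y z n} c d => Prod.ext (F.map_comp _ _) (by
      refine Eq.trans (map_add ((φ.app z).app n).hom _ _) ?_
      exact congrArg (· + _) (φ.act (x := y) (y := z) d.1 c.2)))

end SRep

/-! ## Abelian extensions of simplicial groupoids -/

/-- `f : G ⟶ H` is an abelian extension: in each level it is bijective on objects, surjective on
morphisms, and the kernels of `G(x, x) → H(f x, f x)` are abelian. -/
def IsAbelianExtension {G H : SGpd.{u}} (f : G ⟶ H) : Prop :=
  Function.Bijective f.obj ∧
  (∀ (x y : G.Obj) (n : SimplexCategoryᵒᵖ), Function.Surjective ((f.map x y).app n)) ∧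
  (∀ (x : G.Obj) (n : SimplexCategoryᵒᵖ) (a b : (G.Hom x x).obj n),
    (f.map x x).app n a = H.id _ n → (f.map x x).app n b = H.id _ n → G.comp a b = G.comp b a)

/-- The category of abelian extensions of simplicial groupoids; morphisms are commutative squares. -/
abbrev AbExt : Type (u + 1) :=
  ObjectProperty.FullSubcategory
    (fun f : Arrow SGpd.{u} => IsAbelianExtension f.hom)

namespace AbExt

/-- The functor `(G ⟶ H) ↦ G`. -/
abbrev total : AbExt.{u} ⥤ SGpd.{u} := ObjectProperty.ι _ ⋙ Arrow.leftFunc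

/-- The functor `(G ⟶ H) ↦ H`. -/
abbrev base : AbExt.{u} ⥤ SGpd.{u} := ObjectProperty.ι _ ⋙ Arrow.rightFunc

/-- The map `G ⟶ H`. -/
abbrev hom (E : AbExt.{u}) : total.obj E ⟶ base.obj E := E.obj.hom

variable (E : AbExt.{u})

/-- The kernel `A(x)_n` of `G_n(x, x) → H_n(f x, f x)`, written additively. -/
@[ext]
structure Ker (x : (total.obj E).Obj) (n : SimplexCategoryᵒᵖ) where
  val : ((total.obj E).Hom x x).obj n
  map_val : (E.hom.map x x).app n val = (base.obj E).id _ n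

instance (x : (total.obj E).Obj) (n : SimplexCategoryᵒᵖ) : Zero (E.Ker x n) where
  zero := ⟨(total.obj E).id x n, E.hom.map_id x n⟩

instance (x : (total.obj E).Obj) (n : SimplexCategoryᵒᵖ) : Add (E.Ker x n) where
  add a b := ⟨(total.obj E).comp a.val b.val, by
    rw [E.hom.map_comp, a.map_val, b.map_val, SGpd.id_comp]⟩

instance (x : (total.obj E).Obj) (n : SimplexCategoryᵒᵖ) : Neg (E.Ker x n) where
  neg a := ⟨(total.obj E).inv a.val, by
    rw [E.hom.map_inv, a.map_val]
    exact (SGpd.inv_unique _ _ _ (SGpd.id_comp _ _)).symm⟩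

instance (x : (total.obj E).Obj) (n : SimplexCategoryᵒᵖ) : AddCommGroup (E.Ker x n) where
  add_assoc a b c := Ker.ext ((total.obj E).assoc _ _ _)
  zero_add a := Ker.ext ((total.obj E).id_comp _)
  add_zero a := Ker.ext ((total.obj E).comp_id _)
  neg_add_cancel a := Ker.ext ((total.obj E).inv_comp _)
  add_comm a b := Ker.ext (E.property.2.2 x n _ _ a.map_val b.map_val)
  nsmul := nsmulRec
  zsmul := zsmulRec

/-- The simplicial abelian group `A(x)`. -/
def kerAb (x : (total.obj E).Obj) : SimplicialObject AddCommGrpCat.{u} where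
  obj n := AddCommGrpCat.of (E.Ker x n)
  map {n m} θ := AddCommGrpCat.ofHom
    { toFun := fun a => ⟨((total.obj E).Hom x x).map θ a.val, by
        rw [E.hom.naturality, a.map_val, SGpd.map_id]⟩
      map_zero' := Ker.ext ((total.obj E).map_id _ _)
      map_add' := fun a b => Ker.ext ((total.obj E).map_comp _ _ _) }
  map_id n := by
    apply ConcreteCategory.hom_ext; intro (a : E.Ker x _)
    exact Ker.ext (sset_map_id ((total.obj E).Hom x x) _)
  map_comp θ ψ := by
    apply ConcreteCategory.hom_ext; intro (a : E.Ker x _)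
    exact Ker.ext (sset_map_comp ((total.obj E).Hom x x) _ _ _)

/-- Conjugation `a ↦ g⁻¹ a g` from `A(x)` to `A(y)`, for `g : x ⟶ y` in `G_n` (morphisms
composed from left to right). -/
def conj {x y : (total.obj E).Obj} {n : SimplexCategoryᵒᵖ}
    (g : ((total.obj E).Hom x y).obj n) : E.Ker x n →+ E.Ker y n where
  toFun a := ⟨(total.obj E).comp ((total.obj E).inv g) ((total.obj E).comp a.val g), by
    rw [E.hom.map_comp, E.hom.map_comp, a.map_val, SGpd.id_comp, ← E.hom.map_comp, SGpd.inv_comp,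
      E.hom.map_id]⟩
  map_zero' := Ker.ext (by
    change (total.obj E).comp _ ((total.obj E).comp ((total.obj E).id x n) g) =
      (total.obj E).id y n
    rw [SGpd.id_comp, SGpd.inv_comp])
  map_add' a b := Ker.ext (by
    change (total.obj E).comp _ ((total.obj E).comp ((total.obj E).comp a.val b.val) g) =
      (total.obj E).comp ((total.obj E).comp _ ((total.obj E).comp a.val g))
        ((total.obj E).comp ((total.obj E).inv g) ((total.obj E).comp b.val g))
    simp only [SGpd.assoc]
    rw [← (total.obj E).assoc g ((total.obj E).inv g), SGpd.comp_inv, SGpd.id_comp])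

/-- Conjugation by `g` depends only on the image of `g` in `H`, as the kernel is abelian. -/
theorem conj_eq {x y : (total.obj E).Obj} {n : SimplexCategoryᵒᵖ}
    {g g' : ((total.obj E).Hom x y).obj n}
    (e : (E.hom.map x y).app n g = (E.hom.map x y).app n g') : E.conj g = E.conj g' := by
  apply AddMonoidHom.ext; intro a
  apply Ker.ext
  have hk : (E.hom.map x x).app n ((total.obj E).comp g' ((total.obj E).inv g)) =
      (base.obj E).id _ n := by
    rw [E.hom.map_comp, ← e, ← E.hom.map_comp, SGpd.comp_inv, E.hom.map_id]
  have hc := E.property.2.2 x n _ _ a.map_val hk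
  change (total.obj E).comp ((total.obj E).inv g) ((total.obj E).comp a.val g) =
    (total.obj E).comp ((total.obj E).inv g') ((total.obj E).comp a.val g')
  have h1 : (total.obj E).comp ((total.obj E).comp ((total.obj E).inv g')
        ((total.obj E).comp a.val ((total.obj E).comp g' ((total.obj E).inv g)))) g =
      (total.obj E).comp ((total.obj E).comp ((total.obj E).inv g')
        ((total.obj E).comp ((total.obj E).comp g' ((total.obj E).inv g)) a.val)) g :=
    congrArg (fun t => (total.obj E).comp ((total.obj E).comp ((total.obj E).inv g') t) g) hc
  simp only [SGpd.assoc, SGpd.inv_comp, SGpd.comp_id] at h1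
  rw [h1, ← (total.obj E).assoc ((total.obj E).inv g') g', SGpd.inv_comp, SGpd.id_comp]

theorem conj_id {x : (total.obj E).Obj} {n : SimplexCategoryᵒᵖ} (a : E.Ker x n) :
    E.conj ((total.obj E).id x n) a = a := by
  apply Ker.ext
  change (total.obj E).comp _ ((total.obj E).comp _ ((total.obj E).id x n)) = _
  rw [SGpd.comp_id, ← SGpd.inv_unique _ _ _ ((total.obj E).id_comp _), SGpd.id_comp]

theorem conj_comp {x y z : (total.obj E).Obj} {n : SimplexCategoryᵒᵖ}
    (g : ((total.obj E).Hom x y).obj n) (h : ((total.obj E).Hom y z).obj n) (a : E.Ker x n) :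
    E.conj ((total.obj E).comp g h) a = E.conj h (E.conj g a) := by
  apply Ker.ext
  have hi : (total.obj E).comp ((total.obj E).inv h) ((total.obj E).inv g) =
      (total.obj E).inv ((total.obj E).comp g h) := by
    apply SGpd.inv_unique
    rw [SGpd.assoc, ← (total.obj E).assoc ((total.obj E).inv g), SGpd.inv_comp, SGpd.id_comp,
      SGpd.inv_comp]
  change (total.obj E).comp ((total.obj E).inv ((total.obj E).comp g h))
      ((total.obj E).comp a.val ((total.obj E).comp g h)) =
    (total.obj E).comp ((total.obj E).inv h) ((total.obj E).comp
      ((total.obj E).comp ((total.obj E).inv g) ((total.obj E).comp a.val g)) h)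
  rw [← hi]
  simp only [SGpd.assoc]

theorem conj_restrict {x y : (total.obj E).Obj} {n m : SimplexCategoryᵒᵖ} (θ : n ⟶ m)
    (g : ((total.obj E).Hom x y).obj n) (a : E.Ker x n) :
    (E.kerAb y).map θ (E.conj g a) =
      E.conj (((total.obj E).Hom x y).map θ g) ((E.kerAb x).map θ a) := by
  apply Ker.ext
  change ((total.obj E).Hom y y).map θ ((total.obj E).comp ((total.obj E).inv g)
      ((total.obj E).comp a.val g)) =
    (total.obj E).comp ((total.obj E).inv (((total.obj E).Hom x y).map θ g))
      ((total.obj E).comp (((total.obj E).Hom x x).map θ a.val) (((total.obj E).Hom x y).map θ g))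
  rw [SGpd.map_comp, SGpd.map_comp, SGpd.map_inv]

/-- A lift to `G` of a morphism of `H`. -/
def lift {x y : (total.obj E).Obj} {n : SimplexCategoryᵒᵖ}
    (h : ((base.obj E).Hom (E.hom.obj x) (E.hom.obj y)).obj n) :
    ((total.obj E).Hom x y).obj n :=
  (E.property.2.1 x y n h).choose

theorem map_lift {x y : (total.obj E).Obj} {n : SimplexCategoryᵒᵖ}
    (h : ((base.obj E).Hom (E.hom.obj x) (E.hom.obj y)).obj n) :
    (E.hom.map x y).app n (E.lift h) = h :=
  (E.property.2.1 x y n h).choose_spec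

/-- `H` with its objects renamed to be those of `G` by means of the bijection `Ob G → Ob H`. -/
abbrev base' : SGpd.{u} := (base.obj E).pull E.hom.obj

/-- The kernel `A` as an `H`-representation, where `H` acts through conjugation by lifts to `G`. -/
def ker : SRep E.base' where
  A x := E.kerAb x
  act {x y _} h := E.conj (E.lift (x := x) (y := y) h)
  act_id {x n} a := by
    refine (DFunLike.congr_fun (E.conj_eq ?_) a).trans (E.conj_id (x := x) a)
    exact (E.map_lift _).trans (E.hom.map_id x n).symm
  act_comp {x y z n} g h a := by
    refine (DFunLike.congr_fun (E.conj_eq ?_) a).trans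
      (E.conj_comp (E.lift (x := x) (y := y) g) (E.lift (x := y) (y := z) h) a)
    refine (E.map_lift _).trans ?_
    rw [E.hom.map_comp, E.map_lift, E.map_lift]
  map_act {x y n m} θ h a := by
    refine (E.conj_restrict θ (E.lift (x := x) (y := y) h) a).trans
      (DFunLike.congr_fun (E.conj_eq ?_) _)
    rw [E.map_lift, E.hom.naturality, E.map_lift]

variable {E} {E' E'' : AbExt.{u}}

theorem hom_w (φ : E ⟶ E') : E.hom ≫ base.map φ = total.map φ ≫ E'.hom :=
  (Arrow.w φ.hom).symm

theorem obj_w (φ : E ⟶ E') (x : (total.obj E).Obj) :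
    (base.map φ).obj (E.hom.obj x) = E'.hom.obj ((total.map φ).obj x) :=
  congrArg (fun t => SGpd.Mor.obj t x) (hom_w φ)

/-- The map induced on `H` (with objects those of `G`) by a morphism of extensions. -/
def baseMap' (φ : E ⟶ E') : E.base' ⟶ E'.base' :=
  SGpd.pullMap (base.map φ) E.hom.obj E'.hom.obj (total.map φ).obj (obj_w φ)

theorem baseMap'_hom (φ : E ⟶ E') {x y : (total.obj E).Obj} {n : SimplexCategoryᵒᵖ}
    (g : ((total.obj E).Hom x y).obj n) :
    ((baseMap' φ).map x y).app n ((E.hom.map x y).app n g) =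
      (E'.hom.map _ _).app n (((total.map φ).map x y).app n g) :=
  ConcreteCategory.congr_hom (NatTrans.congr_app (SGpd.homCast_of_eq (hom_w φ) x y) n) g

/-- The map induced by a morphism of extensions on `A(x)_n`. -/
def kerMapApp (φ : E ⟶ E') (x : (total.obj E).Obj) (n : SimplexCategoryᵒᵖ) :
    E.Ker x n →+ E'.Ker ((total.map φ).obj x) n where
  toFun a := ⟨((total.map φ).map x x).app n a.val, by
    rw [← baseMap'_hom, a.map_val]
    exact (baseMap' φ).map_id x n⟩
  map_zero' := Ker.ext ((total.map φ).map_id _ _)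
  map_add' a b := Ker.ext ((total.map φ).map_comp _ _)

theorem kerMapApp_conj (φ : E ⟶ E') {x y : (total.obj E).Obj} {n : SimplexCategoryᵒᵖ}
    (g : ((total.obj E).Hom x y).obj n) (a : E.Ker x n) :
    kerMapApp φ y n (E.conj g a) =
      E'.conj (((total.map φ).map x y).app n g) (kerMapApp φ x n a) := by
  apply Ker.ext
  change ((total.map φ).map y y).app n ((total.obj E).comp ((total.obj E).inv g)
      ((total.obj E).comp a.val g)) =
    (total.obj E').comp ((total.obj E').inv (((total.map φ).map x y).app n g))
      ((total.obj E').comp (((total.map φ).map x x).app n a.val) (((total.map φ).map x y).app n g))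
  rw [(total.map φ).map_comp, (total.map φ).map_comp, (total.map φ).map_inv]

/-- The map induced on kernels by a morphism of extensions. -/
def kerMap (φ : E ⟶ E') : SRep.Mor (baseMap' φ) E.ker E'.ker where
  app x :=
    { app := fun n => AddCommGrpCat.ofHom (kerMapApp φ x n)
      naturality := fun n m θ => by
        apply ConcreteCategory.hom_ext; intro (a : E.Ker x _)
        exact Ker.ext ((total.map φ).naturality _ _) }
  act {x y n} h a := by
    refine (kerMapApp_conj φ (E.lift (x := x) (y := y) h) a).trans
      (DFunLike.congr_fun (E'.conj_eq ?_) _)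
    rw [← baseMap'_hom, E.map_lift]
    exact (E'.map_lift _).symm

variable (E)

/-- The simplicial groupoid `H ⋉ W̄ A`. -/
abbrev classifyingObj : SGpd.{u} := E.ker.wbar.semidirect

/-- The projection `H ⋉ W̄ A ⟶ H`. -/
def proj : E.classifyingObj ⟶ base.obj E :=
  E.ker.wbar.semidirectProj ≫ (base.obj E).pullProj E.hom.obj

/-- The zero section `H ⟶ H ⋉ W̄ A`. -/
def zero : base.obj E ⟶ E.classifyingObj :=
  SGpd.pullMap (𝟙 (base.obj E)) id E.hom.obj (Equiv.ofBijective _ E.property.1).symm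
      (fun y => ((Equiv.ofBijective _ E.property.1).apply_symm_apply y).symm) ≫
    E.ker.wbar.semidirectZero

/-- The functor `(G ⟶ H) ↦ H ⋉ W̄ A`. -/
def classifying : AbExt.{u} ⥤ SGpd.{u} where
  obj E := E.classifyingObj
  map φ := (kerMap φ).wbar.semidirect
  map_id E := rfl
  map_comp {E E' E''} φ ψ := by
    refine SGpd.Mor.ext rfl (heq_of_eq ?_)
    funext x y
    ext n : 1
    apply ConcreteCategory.hom_ext; intro c
    refine Prod.ext ?_ rfl
    have h := SGpd.homCast_map (base.map ψ) (obj_w φ x) (obj_w φ y)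
    have h' := ConcreteCategory.congr_hom (NatTrans.congr_app h n)
      (((base.map φ).map _ _).app n c.1)
    have h2 := SGpd.homCast_trans (base.obj E'') (congrArg (base.map ψ).obj (obj_w φ x))
      (congrArg (base.map ψ).obj (obj_w φ y)) (obj_w ψ _) (obj_w ψ _)
    have h2' := ConcreteCategory.congr_hom (NatTrans.congr_app h2 n)
      (((base.map ψ).map _ _).app n (((base.map φ).map _ _).app n c.1))
    refine Eq.trans ?_ (congrArg (((base.obj E'').homCast (obj_w ψ _) (obj_w ψ _)).app n) h').symm
    exact h2'.symm

end AbExt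

/-! ## Central extensions of simplicial groups -/

/-- A simplicial group as a simplicial groupoid with one object; as for Mathlib's `SingleObj`,
`g` followed by `h` is `h * g`. -/
def oneObj : SimplicialObject GrpCat.{u} ⥤ SGpd.{u} where
  obj G :=
    { Obj := PUnit
      Hom := fun _ _ =>
        { obj := fun n => G.obj n
          map := fun θ => TypeCat.ofHom (fun g => G.map θ g)
          map_id := fun n => by
            apply ConcreteCategory.hom_ext; intro g
            change G.map (𝟙 n) g = g
            rw [G.map_id]; rfl
          map_comp := fun θ ψ => by
            apply ConcreteCategory.hom_ext; intro g
            change G.map (θ ≫ ψ) g = G.map ψ (G.map θ g)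
            rw [G.map_comp]; rfl }
      id := fun _ n => (1 : G.obj n)
      comp := fun {_ _ _ n} (g h : G.obj n) => h * g
      inv := fun {_ _ n} (g : G.obj n) => g⁻¹
      id_comp := fun _ => mul_one (M := G.obj _) _
      comp_id := fun _ => one_mul (M := G.obj _) _
      assoc := fun _ _ _ => (mul_assoc (G := G.obj _) _ _ _).symm
      inv_comp := fun _ => mul_inv_cancel (G := G.obj _) _
      comp_inv := fun _ => inv_mul_cancel (G := G.obj _) _
      map_id := fun _ _ _ θ => map_one (G.map θ).hom
      map_comp := fun θ _ _ => map_mul (G.map θ).hom _ _ }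
  map f :=
    { obj := fun x => x
      map := fun _ _ =>
        { app := fun n => TypeCat.ofHom (fun g => f.app n g)
          naturality := fun n m θ => by
            apply ConcreteCategory.hom_ext; intro g
            exact ConcreteCategory.congr_hom (f.naturality θ) g }
      map_id := fun _ n => map_one (f.app n).hom
      map_comp := fun {_ _ _ n} _ _ => map_mul (f.app n).hom _ _ }
  map_id _ := rfl
  map_comp _ _ := rfl

/-- `f : G ⟶ H` is levelwise a surjection of groups with central kernel. -/
def IsCentralExtension {G H : SimplicialObject GrpCat.{u}} (f : G ⟶ H) : Prop :=
  ∀ n : SimplexCategoryᵒᵖ, Function.Surjective (f.app n) ∧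
    ∀ a g : G.obj n, f.app n a = 1 → a * g = g * a

/-- The category of central extensions of simplicial groups; morphisms are commutative squares. -/
abbrev CentralExt : Type (u + 1) :=
  ObjectProperty.FullSubcategory
    (fun f : Arrow (SimplicialObject GrpCat.{u}) => IsCentralExtension f.hom)

namespace CentralExt

/-- The functor `(G ⟶ H) ↦ G`. -/
abbrev total : CentralExt.{u} ⥤ SimplicialObject GrpCat.{u} := ObjectProperty.ι _ ⋙ Arrow.leftFunc

/-- The functor `(G ⟶ H) ↦ H`. -/
abbrev base : CentralExt.{u} ⥤ SimplicialObject GrpCat.{u} := ObjectProperty.ι _ ⋙ Arrow.rightFunc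

/-- The map `G ⟶ H`. -/
abbrev hom (E : CentralExt.{u}) : total.obj E ⟶ base.obj E := E.obj.hom

/-- The kernel `A_n` of `G_n → H_n`, written additively. -/
@[ext]
structure Ker (E : CentralExt.{u}) (n : SimplexCategoryᵒᵖ) where
  val : (total.obj E).obj n
  map_val : E.hom.app n val = 1

section

variable (E : CentralExt.{u}) (n : SimplexCategoryᵒᵖ)

instance : Zero (E.Ker n) where
  zero := ⟨1, map_one (E.hom.app n).hom⟩

instance : Add (E.Ker n) where
  add a b := ⟨a.val * b.val, by rw [map_mul, a.map_val, b.map_val, mul_one]⟩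

instance : Neg (E.Ker n) where
  neg a := ⟨a.val⁻¹, by rw [map_inv, a.map_val, inv_one]⟩

instance : AddCommGroup (E.Ker n) where
  add_assoc a b c := Ker.ext (mul_assoc _ _ _)
  zero_add a := Ker.ext (one_mul _)
  add_zero a := Ker.ext (mul_one _)
  neg_add_cancel a := Ker.ext (inv_mul_cancel _)
  add_comm a b := Ker.ext ((E.property n).2 _ _ a.map_val)
  nsmul := nsmulRec
  zsmul := zsmulRec

end

/-- The functor sending `G ⟶ H` to its kernel, the simplicial abelian group `A`. -/
def ker : CentralExt.{u} ⥤ SimplicialObject AddCommGrpCat.{u} where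
  obj E :=
    { obj := fun n => AddCommGrpCat.of (E.Ker n)
      map := fun {n m} θ => AddCommGrpCat.ofHom
        { toFun := fun (a : E.Ker n) => Ker.mk ((total.obj E).map θ a.val) (by
            refine (ConcreteCategory.congr_hom (E.hom.naturality θ) a.val).trans ?_
            change (base.obj E).map θ (E.hom.app n a.val) = 1
            rw [a.map_val, map_one])
          map_zero' := Ker.ext (map_one ((total.obj E).map θ).hom)
          map_add' := fun a b => Ker.ext (map_mul ((total.obj E).map θ).hom _ _) }
      map_id := fun n => by
        apply ConcreteCategory.hom_ext; intro (a : E.Ker n)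
        apply Ker.ext
        change (total.obj E).map (𝟙 n) a.val = a.val
        rw [(total.obj E).map_id]; rfl
      map_comp := fun {n m k} θ ψ => by
        apply ConcreteCategory.hom_ext; intro (a : E.Ker n)
        apply Ker.ext
        change (total.obj E).map (θ ≫ ψ) a.val =
          (total.obj E).map ψ ((total.obj E).map θ a.val)
        rw [(total.obj E).map_comp]; rfl }
  map {E E'} φ :=
    { app := fun n => AddCommGrpCat.ofHom
        { toFun := fun (a : E.Ker n) => Ker.mk ((total.map φ).app n a.val) (by
            have h := ConcreteCategory.congr_hom (NatTrans.congr_app (Arrow.w φ.hom) n) a.val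
            refine h.trans ?_
            change (base.map φ).app n (E.hom.app n a.val) = 1
            rw [a.map_val, map_one])
          map_zero' := Ker.ext (map_one ((total.map φ).app n).hom)
          map_add' := fun a b => Ker.ext (map_mul ((total.map φ).app n).hom _ _) }
      naturality := fun n m θ => by
        apply ConcreteCategory.hom_ext; intro (a : E.Ker n)
        exact Ker.ext (ConcreteCategory.congr_hom ((total.map φ).naturality θ) a.val) }
  map_id _ := rfl
  map_comp _ _ := rfl

end CentralExt

/-- The underlying simplicial set of a simplicial abelian group. -/
abbrev underlying : SimplicialObject AddCommGrpCat.{u} ⥤ SSet.{u} :=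
  (SimplicialObject.whiskering _ _).obj (forget AddCommGrpCat.{u})

/-- The base point of `W̄² A`: the map from the terminal simplicial set at the zero vertex. -/
def basePoint (A : SimplicialObject AddCommGrpCat.{u}) :
    (⊤_ SSet.{u}) ⟶ underlying.obj A :=
  SSet.const (X := ⊤_ SSet.{u}) (Y := underlying.obj A) (0 : A.obj (op ⦋0⦌))

end

/-! Let `WA` be the contractible simplicial group with `(WA)_n = A_n × (W̄A)_n`, an extension of
`W̄A` by `A`. Quotienting `G ⋉ WA` by the antidiagonal copy of `A` gives a simplicial groupoid,
`AbExt.cocone`, that extends `H` by `WA` and also extends `H ⋉ W̄A` by `A`. The space `Y'` is `W̄`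
of it. Concretely a morphism is a pair `(g, b)` with `b` in `W̄A`, and an operator `θ` sends it to
`(θ*g · b_θ, θ*b)`, where `b_θ` is the entry of `b` from vertex 0 to vertex `θ 0`, restricted along
`θ`. The twist `b_θ` lies in `A`, so it is killed in `H`, and it vanishes when `b = 0`. Hence `(g,
b) ↦ (f g, b)` is a map to `H ⋉ W̄A`, and `g ↦ (g, 0)` identifies `G` with the preimage of the zero
section.

Two facts turn this algebra into homotopy theory. A levelwise surjection of simplicial groupoids is
a Kan fibration on morphism sets, by Moore's argument of correcting the faces of an arbitrary lift
one at a time (`SGpd.liftsFaces_map_compl`). If moreover spheres in the kernel can be filled, it is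
a trivial fibration there (`SGpd.liftsFaces_map_univ`). Next, a simplex of `W̄G` is its zeroth face
together with one morphism into the initial vertex of that face, so a lifting problem for `W̄`
reduces to one for morphism sets, one dimension lower (`SGpd.liftsFaces_Wbar_of_zero_mem`,
`SGpd.liftsFaces_Wbar_of_one_mem`). Thus `p` is a Kan fibration, and since `(WA)_n` is
`(W̄A)_{n+1}`, which provides the fillers (`AbExt.exists_contraction`), `w` is a trivial fibration.
A strict pullback along a Kan fibration is a homotopy pullback.

If `A` is central, `H` acts trivially on it and `(h, b) ↦ b` is a homomorphism from `H ⋉ W̄A` to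
`W̄A`. Composed with the projection of `AbExt.cocone` it is levelwise surjective with kernel `G`,
and `W̄` of this composite is `φ`. Nothing depends on the choice of lifts from `H` to `G`, so all
maps are natural. -/

noncomputable section

/-! ### Weak equivalences and homotopy pullbacks obtained from lifting properties. -/

section

open MonoidalCategory SSet HomotopicalAlgebra

namespace SSet

/-- A simplicial homotopy from a map out of the cylinder. -/
def Homotopy.ofCylinder {X Y : SSet.{u}} {f g : X ⟶ Y} (h : X ⊗ Δ[1] ⟶ Y) (h₀ : ι₀ ≫ h = f)
    (h₁ : ι₁ ≫ h = g) : Homotopy f g :=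
  RelativeMorphism.Homotopy.mk h h₀ h₁ (by
    ext n x
    exact x.1.2.elim)

/-- The two ends `X ⊗ ∂Δ[1]` of the cylinder on `X`. -/
def cylinderEnds (X : SSet.{u}) : (X ⊗ Δ[1]).Subcomplex where
  obj n := {x | ∀ i j : Fin (n.unop.len + 1),
    stdSimplex.asOrderHom x.2 i = stdSimplex.asOrderHom x.2 j}
  map θ _ hx i j := hx (θ.unop.toOrderHom i) (θ.unop.toOrderHom j)

/-- The map on the two ends of the cylinder given by `f` and `g`. -/
def cylinderEndsDesc {X Y : SSet.{u}} (f g : X ⟶ Y) : (cylinderEnds X : SSet.{u}) ⟶ Y where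
  app n := TypeCat.ofHom fun x =>
    if stdSimplex.asOrderHom x.1.2 0 = 0 then f.app n x.1.1 else g.app n x.1.1
  naturality n m θ := by
    apply ConcreteCategory.hom_ext; intro x
    have h : stdSimplex.asOrderHom x.1.2 (θ.unop.toOrderHom 0) = stdSimplex.asOrderHom x.1.2 0 :=
      x.2 _ _
    change (if stdSimplex.asOrderHom x.1.2 (θ.unop.toOrderHom 0) = 0
        then f.app m (X.map θ x.1.1) else g.app m (X.map θ x.1.1)) =
      Y.map θ (if stdSimplex.asOrderHom x.1.2 0 = 0 then f.app n x.1.1 else g.app n x.1.1)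
    rw [h]
    split_ifs
    · exact ConcreteCategory.congr_hom (f.naturality θ) x.1.1
    · exact ConcreteCategory.congr_hom (g.naturality θ) x.1.1

/-- Lifting against a trivial fibration on the end-points of a cylinder. -/
theorem exists_cylinder_lift {X Y Z : SSet.{u}} {p : Y ⟶ Z} (hp : modelCategoryQuillen.I.rlp p)
    (f g : X ⟶ Y) (k : X ⊗ Δ[1] ⟶ Z) (h₀ : ι₀ ≫ k = f ≫ p) (h₁ : ι₁ ≫ k = g ≫ p) :
    ∃ h : X ⊗ Δ[1] ⟶ Y, ι₀ ≫ h = f ∧ ι₁ ≫ h = g := by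
  rw [← rlp_monomorphisms] at hp
  have : HasLiftingProperty (cylinderEnds X).ι p :=
    hp _ (MorphismProperty.monomorphisms.infer_property _)
  -- A simplex of the two ends has a constant second component, so it comes from `ι₀` or from `ι₁`,
  -- where `h₀` and `h₁` apply.
  have sq : CommSq (cylinderEndsDesc f g) (cylinderEnds X).ι p k := ⟨by
    ext n ⟨⟨x, t⟩, hx⟩
    change p.app n (if stdSimplex.asOrderHom t 0 = 0 then f.app n x else g.app n x) =
      k.app n (x, t)
    have ht : ∀ c : Fin 2, stdSimplex.asOrderHom t 0 = c →
        t = (SSet.const (X := X) (stdSimplex.obj₀Equiv.{u}.symm c)).app n x := by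
      rintro c hc
      apply stdSimplex.ext
      intro i
      exact (hx i 0).trans hc
    split_ifs with h
    · rw [ht 0 h]
      exact (ConcreteCategory.congr_hom (NatTrans.congr_app h₀ n) x).symm
    · rw [ht 1 (Fin.eq_one_of_ne_zero _ h)]
      exact (ConcreteCategory.congr_hom (NatTrans.congr_app h₁ n) x).symm⟩
  refine ⟨sq.lift, ?_, ?_⟩
  · have e : (ι₀ : X ⟶ X ⊗ Δ[1]) =
        Subcomplex.lift ι₀ (by rintro n _ ⟨x, rfl⟩ i j; rfl) ≫ (cylinderEnds X).ι := rfl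
    rw [e, Category.assoc, sq.fac_left]
    ext n x
    change (if (0 : Fin 2) = 0 then f.app n x else g.app n x) = f.app n x
    exact if_pos rfl
  · have e : (ι₁ : X ⟶ X ⊗ Δ[1]) =
        Subcomplex.lift ι₁ (by rintro n _ ⟨x, rfl⟩ i j; rfl) ≫ (cylinderEnds X).ι := rfl
    rw [e, Category.assoc, sq.fac_left]
    ext n x
    change (if (1 : Fin 2) = 0 then f.app n x else g.app n x) = g.app n x
    exact if_neg one_ne_zero

end SSet

/-- A retraction up to homotopy with a strict section is a weak equivalence. -/
theorem IsWeakEquivalence.of_section {X Y : SSet.{u}} {f : X ⟶ Y} (s : Y ⟶ X) (hs : s ≫ f = 𝟙 Y)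
    (k : X ⊗ Δ[1] ⟶ X) (h₀ : ι₀ ≫ k = f ≫ s) (h₁ : ι₁ ≫ k = 𝟙 X) : IsWeakEquivalence f := by
  refine fun Z _ => ⟨fun g => ⟨s ≫ g, ⟨.ofCylinder (k ≫ g) ?_ ?_⟩⟩, ?_⟩
  · rw [← Category.assoc, h₀, Category.assoc]
  · rw [← Category.assoc, h₁, Category.id_comp]
  -- Pulling the homotopy back along the section turns `f ≫ h` and `f ≫ h'` into `h` and `h'`,
  -- because `s ≫ f` is strictly the identity.
  · rintro h h' ⟨H⟩
    refine ⟨.ofCylinder (s ▷ _ ≫ H.h) ?_ ?_⟩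
    · rw [ι₀_comp_assoc, H.h₀, ← Category.assoc, hs, Category.id_comp]
    · rw [ι₁_comp_assoc, H.h₁, ← Category.assoc, hs, Category.id_comp]

theorem IsWeakEquivalence.of_isIso {X Y : SSet.{u}} (f : X ⟶ Y) [IsIso f] :
    IsWeakEquivalence f :=
  .of_section (inv f) (by simp) (CartesianMonoidalCategory.fst _ _) (by simp) (by simp)

/-- Trivial fibrations are weak equivalences. -/
theorem IsWeakEquivalence.of_rlp {X Y : SSet.{u}} {f : X ⟶ Y}
    (hf : modelCategoryQuillen.I.rlp f) : IsWeakEquivalence f := by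
  have hf' := hf
  rw [← rlp_monomorphisms] at hf'
  have : HasLiftingProperty (initial.to Y) f :=
    hf' _ (MorphismProperty.monomorphisms.infer_property _)
  have sq : CommSq (initial.to X) (initial.to Y) f (𝟙 Y) := ⟨by simp⟩
  -- The constant homotopy of `f` lifts to a fibrewise homotopy from `f ≫ s` to the identity, where
  -- `s` is the section just obtained.
  obtain ⟨k, h₀, h₁⟩ := exists_cylinder_lift hf (f ≫ sq.lift) (𝟙 X)
    (CartesianMonoidalCategory.fst _ _ ≫ f) (by simp) (by simp)
  exact .of_section sq.lift sq.fac_right k h₀ h₁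

/-- A pullback square along a Kan fibration is a homotopy pullback square. -/
theorem IsHomotopyPullback.of_isPullback {X Y Z B : SSet.{u}} {a : X ⟶ Y} {b : X ⟶ Z} {p : Y ⟶ B}
    {q : Z ⟶ B} (h : IsPullback a b p q) (hp : IsKanFibration p) : IsHomotopyPullback a b p q := by
  -- No replacement is needed: `p` is already a fibration, and the comparison map is the isomorphism
  -- with the strict pullback.
  refine ⟨h.w, Y, 𝟙 Y, p, Category.id_comp p, .of_isIso _, hp, ?_⟩
  have e : pullback.lift (f := p) (g := q) (a ≫ 𝟙 Y) b (by rw [Category.comp_id, h.w]) =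
      h.isoPullback.hom := by
    apply pullback.hom_ext
    · rw [h.isoPullback_hom_fst, pullback.lift_fst, Category.comp_id]
    · rw [h.isoPullback_hom_snd, pullback.lift_snd]
  rw [e]
  exact .of_isIso _

/-! ### Lifting properties as problems of prescribed faces. -/

/-- The matching condition on a partial family of `n`-simplices, for them to be faces of an
`(n + 1)`-simplex. -/
def FacesMatch (X : SSet.{u}) (n : ℕ) (S : Set (Fin (n + 2)))
    (x : ∀ i ∈ S, X.obj (op ⦋n⦌)) : Prop :=
  match n, S, x with
  -- Distinct faces of a 1-simplex are vertices and have no common face to agree on.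
  | 0, _, _ => True
  | n + 1, S, x => ∀ (i j : Fin (n + 2)), i ≤ j → ∀ (hi : i.castSucc ∈ S) (hj : j.succ ∈ S),
      X.map (SimplexCategory.δ i).op (x j.succ hj) = X.map (SimplexCategory.δ j).op (x _ hi)

/-- `f` has the lifting property for `(n + 1)`-simplices with prescribed faces in `S`. -/
def LiftsFaces {X Y : SSet.{u}} (f : X ⟶ Y) (n : ℕ) (S : Set (Fin (n + 2))) : Prop :=
  ∀ (y : Y.obj (op ⦋n + 1⦌)) (x : ∀ i ∈ S, X.obj (op ⦋n⦌)),
    (∀ i hi, f.app _ (x i hi) = Y.map (SimplexCategory.δ i).op y) → FacesMatch X n S x →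
      ∃ z : X.obj (op ⦋n + 1⦌), f.app _ z = y ∧
        ∀ i hi, X.map (SimplexCategory.δ i).op z = x i hi

/-- The faces of a map out of a horn match by the relations between the `δ i`, and such a map is
determined by them; a simplex with these faces therefore solves the lifting problem. -/
theorem IsKanFibration.of_liftsFaces {X Y : SSet.{u}} {f : X ⟶ Y}
    (hf : ∀ n k, LiftsFaces f n {k}ᶜ) : IsKanFibration f := by
  intro _ _ _ h
  simp only [modelCategoryQuillen.J, MorphismProperty.iSup_iff] at h
  obtain ⟨n, ⟨k⟩⟩ := h
  refine ⟨fun {a b} sq => ?_⟩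
  obtain ⟨z, hz, hz'⟩ := hf n k (SSet.yonedaEquiv b) (fun i hi => a.app _ (horn.face k i hi))
    (fun i hi => by
      refine (ConcreteCategory.congr_hom (NatTrans.congr_app sq.w _) (horn.face k i hi)).trans ?_
      exact (SSet.yonedaEquiv_naturality (SimplexCategory.δ i) b).symm) (by
      cases n with
      | zero => trivial
      | succ n =>
        intro i j hij hi hj
        refine (ConcreteCategory.congr_hom (a.naturality _) _).symm.trans
          (Eq.trans (congrArg (a.app _) ?_) (ConcreteCategory.congr_hom (a.naturality _) _))
        apply Subtype.ext
        exact congrArg stdSimplex.objEquiv.symm (SimplexCategory.δ_comp_δ hij))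
  refine ⟨⟨⟨SSet.yonedaEquiv.symm z, ?_, ?_⟩⟩⟩
  · apply horn.hom_ext
    intro j hj
    refine Eq.trans ?_ (hz' j hj)
    rfl
  · apply SSet.yonedaEquiv.injective
    rw [SSet.yonedaEquiv_comp, Equiv.apply_symm_apply, hz]

/-- As for horns. The separate condition on vertices covers the empty boundary of `Δ[0]`, since
`LiftsFaces` starts with 1-simplices. -/
theorem rlp_I_of_liftsFaces {X Y : SSet.{u}} {f : X ⟶ Y}
    (hf₀ : Function.Surjective (f.app (op ⦋0⦌))) (hf : ∀ n, LiftsFaces f n Set.univ) :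
    modelCategoryQuillen.I.rlp f := by
  rintro _ _ _ ⟨n⟩
  refine ⟨fun {a b} sq => ?_⟩
  cases n with
  | zero =>
    obtain ⟨z, hz⟩ := hf₀ (SSet.yonedaEquiv b)
    refine ⟨⟨⟨SSet.yonedaEquiv.symm z, boundary.hom_ext₀, ?_⟩⟩⟩
    apply SSet.yonedaEquiv.injective
    rw [SSet.yonedaEquiv_comp, Equiv.apply_symm_apply, hz]
  | succ n =>
    obtain ⟨z, hz, hz'⟩ := hf n (SSet.yonedaEquiv b)
      (fun i _ => SSet.yonedaEquiv (boundary.ι i ≫ a))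
      (fun i hi => by
        refine (congrArg SSet.yonedaEquiv ((Category.assoc _ _ _).trans
          (congrArg (boundary.ι i ≫ ·) sq.w))).trans ?_
        exact (SSet.yonedaEquiv_naturality (SimplexCategory.δ i) b).symm) (by
        cases n with
        | zero => trivial
        | succ n =>
          intro i j hij hi hj
          refine (ConcreteCategory.congr_hom (a.naturality _) _).symm.trans
            (Eq.trans (congrArg (a.app _) ?_) (ConcreteCategory.congr_hom (a.naturality _) _))
          apply Subtype.ext
          exact congrArg stdSimplex.objEquiv.symm (SimplexCategory.δ_comp_δ hij))
    refine ⟨⟨⟨SSet.yonedaEquiv.symm z, ?_, ?_⟩⟩⟩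
    · apply boundary.hom_ext
      intro i
      apply SSet.yonedaEquiv.injective
      rw [← hz' i trivial]
      rfl
    · apply SSet.yonedaEquiv.injective
      rw [SSet.yonedaEquiv_comp, Equiv.apply_symm_apply, hz]

end

/-! ### Factoring monotone maps through final segments. -/

/-- A monotone map `α : [q] → [p]` as a map to the final segment `{α 0, …, p}`. -/
def initMap {q p : SimplexCategory} (α : q ⟶ p) : q ⟶ tail p (α.toOrderHom 0) :=
  SimplexCategory.Hom.mk
    { toFun := fun t => ⟨(α.toOrderHom t).val - (α.toOrderHom 0).val, by
        change _ < p.len - _ + 1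
        have h1 := (α.toOrderHom t).isLt
        omega⟩
      monotone' := fun _ _ hst => Nat.sub_le_sub_right (α.toOrderHom.monotone hst) _ }

theorem initMap_lastIncl {q p : SimplexCategory} (α : q ⟶ p) :
    initMap α ≫ lastIncl p (α.toOrderHom 0) = α := by
  apply SimplexCategory.Hom.ext
  ext t
  have h : (α.toOrderHom 0).val ≤ (α.toOrderHom t).val := α.toOrderHom.monotone (Fin.zero_le t)
  change (α.toOrderHom t).val - (α.toOrderHom 0).val + (α.toOrderHom 0).val = _
  omega

theorem initMap_comp {r q p : SimplexCategory} (ψ : r ⟶ q) (θ : q ⟶ p) :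
    initMap (ψ ≫ θ) = initMap ψ ≫ tailMap θ (ψ.toOrderHom 0) := by
  apply SimplexCategory.Hom.ext
  ext t
  have h : (ψ.toOrderHom 0).val ≤ (ψ.toOrderHom t).val := ψ.toOrderHom.monotone (Fin.zero_le t)
  change (θ.toOrderHom (ψ.toOrderHom t)).val - (θ.toOrderHom (ψ.toOrderHom 0)).val =
    (θ.toOrderHom ⟨(ψ.toOrderHom t).val - (ψ.toOrderHom 0).val + (ψ.toOrderHom 0).val, _⟩).val -
      (θ.toOrderHom (ψ.toOrderHom 0)).val
  congr 4
  apply Fin.ext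
  change _ = _ - _ + _
  omega

theorem initMap_comp_tailIncl {r q p : SimplexCategory} (ψ : r ⟶ q) (θ : q ⟶ p) :
    initMap (ψ ≫ θ) ≫ tailIncl p (θ.toOrderHom.monotone (Fin.zero_le (ψ.toOrderHom 0))) =
      ψ ≫ initMap θ := by
  apply SimplexCategory.Hom.ext
  ext t
  have h : (θ.toOrderHom (ψ.toOrderHom 0)).val ≤ (θ.toOrderHom (ψ.toOrderHom t)).val :=
    θ.toOrderHom.monotone (ψ.toOrderHom.monotone (Fin.zero_le t))
  have h' : (θ.toOrderHom 0).val ≤ (θ.toOrderHom (ψ.toOrderHom 0)).val :=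
    θ.toOrderHom.monotone (Fin.zero_le _)
  change (θ.toOrderHom (ψ.toOrderHom t)).val - (θ.toOrderHom (ψ.toOrderHom 0)).val +
      ((θ.toOrderHom (ψ.toOrderHom 0)).val - (θ.toOrderHom 0).val) =
    (θ.toOrderHom (ψ.toOrderHom t)).val - (θ.toOrderHom 0).val
  omega

theorem lastIncl_zero (p : SimplexCategory) (k : Fin (p.len + 1)) :
    (lastIncl p k).toOrderHom 0 = k :=
  Fin.ext (Nat.zero_add _)

instance (p : SimplexCategory) (k : Fin (p.len + 1)) : Mono (lastIncl p k) := by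
  rw [SimplexCategory.mono_iff_injective]
  intro s t h
  have h' : s.val + k.val = t.val + k.val := congrArg Fin.val h
  exact Fin.ext (by omega)

theorem exists_lastIncl_factor {q p : SimplexCategory} (α : q ⟶ p) {k : Fin (p.len + 1)}
    (hk : α.toOrderHom 0 = k) :
    ∃ β : q ⟶ tail p k, β ≫ lastIncl p k = α ∧ β.toOrderHom 0 = 0 := by
  subst hk
  exact ⟨initMap α, initMap_lastIncl α, Fin.ext (Nat.sub_self _)⟩

/-! ### Coordinates of simplices of `W̄ G`. -/

namespace SGpd

variable {G H : SGpd.{u}}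

theorem comp_inv_cancel {x y z : G.Obj} {n} (g : (G.Hom x y).obj n) (h : (G.Hom x z).obj n) :
    G.comp g (G.comp (G.inv g) h) = h := by
  rw [← G.assoc, G.comp_inv, G.id_comp]

theorem inv_comp_cancel {x y z : G.Obj} {n} (g : (G.Hom x y).obj n) (h : (G.Hom y z).obj n) :
    G.comp (G.inv g) (G.comp g h) = h := by
  rw [← G.assoc, G.inv_comp, G.id_comp]

theorem comp_cancel_inv {x y z : G.Obj} {n} (g : (G.Hom x y).obj n) (h : (G.Hom y z).obj n) :
    G.comp (G.comp g h) (G.inv h) = g := by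
  rw [G.assoc, G.comp_inv, G.comp_id]

theorem inv_cancel_comp {x y z : G.Obj} {n} (g : (G.Hom x y).obj n) (h : (G.Hom z y).obj n) :
    G.comp (G.comp g (G.inv h)) h = g := by
  rw [G.assoc, G.inv_comp, G.comp_id]

theorem inv_id (x : G.Obj) (n) : G.inv (G.id x n) = G.id x n :=
  (G.inv_unique _ _ (G.id_comp _)).symm

namespace WSimplex

variable {p q r : SimplexCategory} (s : G.WSimplex p)

theorem hom_zero {k : Fin (p.len + 1)} (hk : k = 0) {x : G.Obj} (hx : s.obj 0 = x)
    (hy : s.obj k = x) :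
    (G.homCast hx hy).app _ (s.hom 0 k (Fin.zero_le k)) = G.id x (op (tail p k)) := by
  subst hk hx
  exact s.hom_id 0

/-- The morphism from the initial vertex of `s` to the vertex `α 0`, restricted along `α`. -/
def coord (α : q ⟶ p) {x y : G.Obj} (hx : s.obj 0 = x) (hy : s.obj (α.toOrderHom 0) = y) :
    (G.Hom x y).obj (op q) :=
  (G.Hom x y).map (initMap α).op
    ((G.homCast hx hy).app _ (s.hom 0 (α.toOrderHom 0) (Fin.zero_le _)))

theorem coord_of_zero (α : q ⟶ p) (hα : α.toOrderHom 0 = 0) {x : G.Obj} (hx : s.obj 0 = x)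
    (hy : s.obj (α.toOrderHom 0) = x) : s.coord α hx hy = G.id x _ := by
  rw [coord, s.hom_zero hα, G.map_id]

/-- This is the cocycle relation `hom_comp` from vertex 0, restricted along `ψ ≫ α`. Passing to
`s.restrict α` moves the base vertex from 0 to `α 0`, which accounts for the first factor; every
face formula below is an instance of this. -/
theorem coord_comp (ψ : r ⟶ q) (α : q ⟶ p) {x y z : G.Obj} (hx : s.obj 0 = x)
    (hy : s.obj (α.toOrderHom 0) = y) (hz : s.obj ((ψ ≫ α).toOrderHom 0) = z)
    (hy' : (s.restrict α).obj 0 = y) (hz' : (s.restrict α).obj (ψ.toOrderHom 0) = z) :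
    s.coord (ψ ≫ α) hx hz =
      G.comp ((G.Hom x y).map ψ.op (s.coord α hx hy)) ((s.restrict α).coord ψ hy' hz') := by
  subst hx hy hz
  have h := congrArg ((G.Hom _ _).map (initMap (ψ ≫ α)).op)
    (s.hom_comp 0 (α.toOrderHom 0) (α.toOrderHom (ψ.toOrderHom 0)) (Fin.zero_le _)
      (α.toOrderHom.monotone (Fin.zero_le _)))
  refine h.trans ((G.map_comp _ _ _).trans (congrArg₂ G.comp ?_ ?_))
  · refine (sset_map_comp (G.Hom _ _) _ _ _).symm.trans
      (Eq.trans ?_ (sset_map_comp (G.Hom _ _) _ _ _))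
    exact congrArg (fun t => (G.Hom _ _).map (Quiver.Hom.op t) _) (initMap_comp_tailIncl ψ α)
  · refine Eq.trans ?_ (sset_map_comp (G.Hom _ _) _ _ _)
    exact congrArg (fun t => (G.Hom _ _).map (Quiver.Hom.op t) _) (initMap_comp ψ α)

theorem restrict_coord (ψ : r ⟶ q) (α : q ⟶ p) {x y z : G.Obj} (hx : s.obj 0 = x)
    (hy : s.obj (α.toOrderHom 0) = y) (hz : s.obj ((ψ ≫ α).toOrderHom 0) = z)
    (hy' : (s.restrict α).obj 0 = y) (hz' : (s.restrict α).obj (ψ.toOrderHom 0) = z) :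
    (s.restrict α).coord ψ hy' hz' =
      G.comp (G.inv ((G.Hom x y).map ψ.op (s.coord α hx hy))) (s.coord (ψ ≫ α) hx hz) := by
  rw [s.coord_comp ψ α hx hy hz hy' hz', inv_comp_cancel]

theorem coord_comp_of_zero (ψ : r ⟶ q) (hψ : ψ.toOrderHom 0 = 0) (α : q ⟶ p) {x y : G.Obj}
    (hx : s.obj 0 = x) (hy : s.obj (α.toOrderHom 0) = y)
    (hz : s.obj ((ψ ≫ α).toOrderHom 0) = y) :
    s.coord (ψ ≫ α) hx hz = (G.Hom x y).map ψ.op (s.coord α hx hy) := by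
  have hy' : (s.restrict α).obj 0 = y := hy
  have hz' : (s.restrict α).obj (ψ.toOrderHom 0) = y := hz
  rw [s.coord_comp ψ α hx hy hz hy' hz', (s.restrict α).coord_of_zero ψ hψ, G.comp_id]

theorem restrict_coord_of_zero (ψ : r ⟶ q) (α : q ⟶ p) (hα : α.toOrderHom 0 = 0) {x z : G.Obj}
    (hx : s.obj 0 = x) (hy : (s.restrict α).obj 0 = x) (hz : s.obj ((ψ ≫ α).toOrderHom 0) = z)
    (hz' : (s.restrict α).obj (ψ.toOrderHom 0) = z) :
    (s.restrict α).coord ψ hy hz' = s.coord (ψ ≫ α) hx hz := by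
  have hy' : s.obj (α.toOrderHom 0) = x := hy
  rw [s.restrict_coord ψ α hx hy' hz hy hz', s.coord_of_zero α hα, G.map_id, inv_id, G.id_comp]

theorem coord_congr {s t : G.WSimplex p} (h : s = t) {α β : q ⟶ p} (hαβ : α = β) {x y : G.Obj}
    (hx : s.obj 0 = x) (hy : s.obj (α.toOrderHom 0) = y) (hx' : t.obj 0 = x)
    (hy' : t.obj (β.toOrderHom 0) = y) : s.coord α hx hy = t.coord β hx' hy' := by
  subst h hαβ; rfl

/-- The vertex is a free variable `k` here, so that it can be substituted. The factorisation `β` is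
forced, `lastIncl` being mono. -/
theorem coord_eq_map_hom (α : q ⟶ p) {k : Fin (p.len + 1)} (hk : α.toOrderHom 0 = k)
    (β : q ⟶ tail p k) (hβ : β ≫ lastIncl p k = α) {x y : G.Obj} (hx : s.obj 0 = x)
    (hy : s.obj (α.toOrderHom 0) = y) (hy' : s.obj k = y) :
    s.coord α hx hy =
      (G.Hom x y).map β.op ((G.homCast hx hy').app _ (s.hom 0 k (Fin.zero_le k))) := by
  subst hk
  obtain rfl : β = initMap α := by
    rw [← cancel_mono (lastIncl p (α.toOrderHom 0)), hβ, initMap_lastIncl]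
  rfl

theorem hom_eq_coord (k : Fin (p.len + 1)) (hy : s.obj ((lastIncl p k).toOrderHom 0) = s.obj k) :
    s.hom 0 k (Fin.zero_le k) = s.coord (lastIncl p k) rfl hy := by
  rw [s.coord_eq_map_hom (lastIncl p k) (lastIncl_zero p k) (𝟙 _) (Category.id_comp _) rfl hy rfl]
  exact (sset_map_id (G.Hom _ _) _).symm

theorem hom_eq_inv_comp {j k : Fin (p.len + 1)} (h : j ≤ k) :
    s.hom j k h = G.comp (G.inv ((G.Hom _ _).map (tailIncl p h).op (s.hom 0 j (Fin.zero_le j))))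
      (s.hom 0 k (Fin.zero_le k)) := by
  rw [s.hom_comp 0 j k (Fin.zero_le j) h, inv_comp_cancel]

/-- By the cocycle relation the morphisms out of vertex 0 determine all the others, and they are the
coordinates at the maps `lastIncl`. Quantifying over `x` and `y` leaves the reader of a coordinate
free to choose the names of its end objects. -/
theorem ext_coord {s t : G.WSimplex p} (ho : ∀ j, s.obj j = t.obj j)
    (hc : ∀ (q : SimplexCategory) (α : q ⟶ p) (x y : G.Obj) (hx : s.obj 0 = x)
      (hy : s.obj (α.toOrderHom 0) = y) (hx' : t.obj 0 = x) (hy' : t.obj (α.toOrderHom 0) = y),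
      s.coord α hx hy = t.coord α hx' hy') : s = t := by
  obtain ⟨so, sh, sid, sc⟩ := s
  obtain ⟨o, th, tid, tc⟩ := t
  obtain rfl : so = o := funext ho
  have h0 : ∀ k, sh 0 k (Fin.zero_le k) = th 0 k (Fin.zero_le k) := by
    intro k
    have hx : so ((lastIncl p k).toOrderHom 0) = so k := congrArg so (lastIncl_zero p k)
    refine (hom_eq_coord ⟨so, sh, sid, sc⟩ k hx).trans (Eq.trans ?_
      (hom_eq_coord ⟨so, th, tid, tc⟩ k hx).symm)
    exact hc _ (lastIncl p k) _ _ rfl hx rfl hx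
  refine WSimplex.ext rfl (heq_of_eq ?_)
  funext j k h
  refine (hom_eq_inv_comp ⟨so, sh, sid, sc⟩ h).trans (Eq.trans ?_
    (hom_eq_inv_comp ⟨so, th, tid, tc⟩ h).symm)
  change G.comp (G.inv ((G.Hom _ _).map _ (sh 0 j _))) (sh 0 k _) =
    G.comp (G.inv ((G.Hom _ _).map _ (th 0 j _))) (th 0 k _)
  rw [h0 j, h0 k]

theorem map_coord (F : G ⟶ H) (α : q ⟶ p) {x y : G.Obj} (hx : s.obj 0 = x)
    (hy : s.obj (α.toOrderHom 0) = y) {s' : H.WSimplex p}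
    (hs : (Wbar.map F).app (op p) s = s') (hx' : s'.obj 0 = F.obj x)
    (hy' : s'.obj (α.toOrderHom 0) = F.obj y) :
    (F.map x y).app _ (s.coord α hx hy) = s'.coord α hx' hy' := by
  subst hs hx hy
  exact F.naturality _ _

/-- Take the coboundary `c_j⁻¹ c_k` of the cochain `c`. Normalising `c` to be the identity at vertex
0 makes the coordinates equal to `c` itself. -/
theorem exists_coord (x : Fin (p.len + 1) → G.Obj)
    (c : ∀ k, (G.Hom (x 0) (x k)).obj (op (tail p k))) (hc : c 0 = G.id (x 0) _) :
    ∃ s : G.WSimplex p, s.obj = x ∧ ∀ (q : SimplexCategory) (α : q ⟶ p) (k : Fin (p.len + 1))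
      (β : q ⟶ tail p k), α.toOrderHom 0 = k → β ≫ lastIncl p k = α →
      ∀ (hx : s.obj 0 = x 0) (hy : s.obj (α.toOrderHom 0) = x k),
        s.coord α hx hy = (G.Hom _ _).map β.op (c k) := by
  let s : G.WSimplex p :=
    { obj := x
      hom := fun j k h => G.comp (G.inv ((G.Hom _ _).map (tailIncl p h).op (c j))) (c k)
      hom_id := fun j => by
        have : tailIncl p (le_refl j) = 𝟙 _ := by
          apply SimplexCategory.Hom.ext
          ext t
          change t.val + (j.val - j.val) = t.val
          omega
        rw [this, op_id, sset_map_id (G.Hom _ _), G.inv_comp]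
      hom_comp := fun i j k hij hjk => by
        have : tailIncl p (hij.trans hjk) = tailIncl p hjk ≫ tailIncl p hij := by
          apply SimplexCategory.Hom.ext
          ext t
          have h1 : i.val ≤ j.val := hij
          have h2 : j.val ≤ k.val := hjk
          change t.val + (k.val - i.val) = t.val + (k.val - j.val) + (j.val - i.val)
          omega
        rw [G.map_comp, G.map_inv, ← sset_map_comp, ← op_comp, ← this, G.assoc, comp_inv_cancel] }
  refine ⟨s, rfl, fun q α k β hα hβ hx hy => ?_⟩
  rw [s.coord_eq_map_hom α hα β hβ hx hy rfl]
  refine congrArg ((G.Hom _ _).map β.op) ?_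
  change G.comp (G.inv ((G.Hom _ _).map _ (c 0))) (c k) = c k
  rw [hc, G.map_id, inv_id, G.id_comp]

/-- A simplex is determined by an arbitrary morphism into the initial vertex of its `0`-th face. -/
theorem exists_cons {n : ℕ} (t : G.WSimplex ⦋n⦌) {x : G.Obj}
    (g : (G.Hom x (t.obj 0)).obj (op ⦋n⦌)) :
    ∃ s : G.WSimplex ⦋n + 1⦌, s.restrict (SimplexCategory.δ 0) = t ∧ s.obj 0 = x ∧
      ∀ (hx : s.obj 0 = x)
        (hy : s.obj ((SimplexCategory.δ (0 : Fin (n + 2))).toOrderHom 0) = t.obj 0),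
        s.coord (SimplexCategory.δ 0) hx hy = g := by
  -- This is the inclusion of the final segment `{k, …, n}` of `⦋n⦌`. Going through `⦋n + 1⦌` and
  -- back by `σ 0` gives it the source that is needed, without identifying `n + 1 - (k + 1)` with `n
  -- - k`.
  let κ (k : Fin (n + 1)) : tail ⦋n + 1⦌ k.succ ⟶ ⦋n⦌ :=
    lastIncl ⦋n + 1⦌ k.succ ≫ SimplexCategory.σ 0
  have hκ (k : Fin (n + 1)) : (κ k).toOrderHom 0 = k := by
    change (SimplexCategory.σ (0 : Fin (n + 1))).toOrderHom
      ((lastIncl ⦋n + 1⦌ k.succ).toOrderHom 0) = k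
    rw [lastIncl_zero]
    rfl
  -- The cochain is forced: reaching vertex `k + 1` from the new vertex means applying `g` and then
  -- travelling inside `t`.
  obtain ⟨s, hs, hc⟩ := exists_coord (G := G) (p := ⦋n + 1⦌)
    (Fin.cons x t.obj : Fin (n + 2) → G.Obj)
    (fun k => Fin.cases (motive := fun k : Fin (n + 2) =>
        (G.Hom x ((Fin.cons x t.obj : Fin (n + 2) → G.Obj) k)).obj (op (tail ⦋n + 1⦌ k)))
      (G.id x _)
      (fun k => G.comp ((G.Hom x (t.obj 0)).map (κ k).op g)
        (t.coord (κ k) rfl (congrArg t.obj (hκ k)))) k) rfl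
  have hx : s.obj 0 = x := by rw [hs]; rfl
  have hy (k : Fin (n + 1)) : s.obj k.succ = t.obj k := by rw [hs]; rfl
  have key : ∀ (q : SimplexCategory) (α : q ⟶ ⦋n⦌) (y : G.Obj)
      (h : s.obj ((α ≫ SimplexCategory.δ 0).toOrderHom 0) = y) (h' : t.obj (α.toOrderHom 0) = y),
      s.coord (α ≫ SimplexCategory.δ 0) hx h =
        G.comp ((G.Hom x (t.obj 0)).map α.op g) (t.coord α rfl h') := by
    rintro q α _ h rfl
    obtain ⟨β, hβ, hβ0⟩ := exists_lastIncl_factor (α ≫ SimplexCategory.δ 0)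
      (k := (α.toOrderHom 0).succ) rfl
    have hα : β ≫ κ (α.toOrderHom 0) = α := by
      change β ≫ lastIncl _ _ ≫ _ = _
      rw [← Category.assoc, hβ, Category.assoc]
      exact (congrArg (α ≫ ·) (SimplexCategory.δ_comp_σ_self (i := (0 : Fin (n + 1))))).trans
        (Category.comp_id α)
    refine (hc q _ (α.toOrderHom 0).succ β rfl hβ hx h).trans ?_
    refine (G.map_comp _ _ _).trans ?_
    refine congrArg₂ G.comp ?_ ?_
    · refine (sset_map_comp (G.Hom _ _) _ _ _).symm.trans ?_
      exact congrArg (fun θ => (G.Hom _ _).map (Quiver.Hom.op θ) g) hα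
    · refine (t.coord_comp_of_zero β hβ0 (κ _) rfl _ (congrArg (t.obj) (congrArg
        (fun θ => SimplexCategory.Hom.toOrderHom θ 0) hα))).symm.trans ?_
      exact coord_congr rfl hα _ _ _ _
  have key0 : s.coord (SimplexCategory.δ 0) hx (hy 0) = g := by
    have hy0 : s.obj ((𝟙 ⦋n⦌ ≫ SimplexCategory.δ 0).toOrderHom 0) = t.obj 0 := hy 0
    have h0 : t.obj ((𝟙 ⦋n⦌ : ⦋n⦌ ⟶ ⦋n⦌).toOrderHom 0) = t.obj 0 := rfl
    refine (coord_congr rfl (Category.id_comp _).symm _ _ hx hy0).trans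
      ((key _ (𝟙 _) _ hy0 h0).trans ?_)
    rw [t.coord_of_zero (𝟙 _) rfl, G.comp_id]
    exact sset_map_id (G.Hom _ _) g
  refine ⟨s, ext_coord hy ?_, hx, fun _ _ => key0⟩
  rintro q α _ _ hx' hy' rfl h'
  have hy'' : s.obj ((α ≫ SimplexCategory.δ 0).toOrderHom 0) = _ := hy'
  rw [s.restrict_coord α (SimplexCategory.δ 0) hx (hy 0) hy'' hx' hy', key0,
    key _ _ _ hy'' h', inv_comp_cancel]

end WSimplex

end SGpd

/-! ### Reconstructing a simplex of `W̄ G` from one face and its first morphism. -/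

namespace SGpd

variable {G H : SGpd.{u}}

namespace WSimplex

theorem restrict_comp {p q r : SimplexCategory} (s : G.WSimplex p) (ψ : r ⟶ q) (θ : q ⟶ p) :
    s.restrict (ψ ≫ θ) = (s.restrict θ).restrict ψ :=
  sset_map_comp (WbarObj G) θ.op ψ.op s

theorem map_restrict {p q : SimplexCategory} (F : G ⟶ H) (s : G.WSimplex p) (θ : q ⟶ p) :
    (Wbar.map F).app (op q) (s.restrict θ) =
      ((Wbar.map F).app (op p) s : H.WSimplex p).restrict θ :=
  ConcreteCategory.congr_hom ((Wbar.map F).naturality θ.op) s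

theorem exists_comp_δ {q : SimplexCategory} {n : ℕ} (i : Fin (n + 2)) (α : q ⟶ ⦋n + 1⦌)
    (h : ∀ t, α.toOrderHom t ≠ i) : ∃ β : q ⟶ ⦋n⦌, β ≫ SimplexCategory.δ i = α := by
  obtain ⟨β, hβ⟩ := SimplexCategory.eq_comp_δ_of_not_surjective' α i h
  exact ⟨β, hβ.symm⟩

theorem ext_vertex {s t : G.WSimplex ⦋0⦌} (h : s.obj 0 = t.obj 0) : s = t := by
  have ho : ∀ j : Fin 1, s.obj j = t.obj j := fun j => by rw [Subsingleton.elim j 0, h]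
  refine ext_coord ho ?_
  rintro q α x y hx hy hx' hy'
  have hα : α.toOrderHom 0 = 0 := Subsingleton.elim (α := Fin 1) _ _
  obtain rfl : y = x := by rw [← hy, ← hx, hα]
  rw [s.coord_of_zero α hα, t.coord_of_zero α hα]

theorem exists_vertex (x : G.Obj) : ∃ s : G.WSimplex ⦋0⦌, s.obj 0 = x := by
  obtain ⟨s, hs, -⟩ := exists_coord (G := G) (p := ⦋0⦌) (fun _ => x) (fun k => G.id x _) rfl
  exact ⟨s, by rw [hs]⟩

/-- A map missing vertex 0 factors through `δ 0`, and there `coord_comp` expresses the coordinate by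
the first morphism and the zeroth face. -/
theorem ext_cons {n : ℕ} {s t : G.WSimplex ⦋n + 1⦌}
    (h : s.restrict (SimplexCategory.δ 0) = t.restrict (SimplexCategory.δ 0)) {x y : G.Obj}
    (hx : s.obj 0 = x) (hx' : t.obj 0 = x)
    (hy : s.obj ((SimplexCategory.δ (0 : Fin (n + 2))).toOrderHom 0) = y)
    (hy' : t.obj ((SimplexCategory.δ (0 : Fin (n + 2))).toOrderHom 0) = y)
    (hc : s.coord (SimplexCategory.δ 0) hx hy = t.coord (SimplexCategory.δ 0) hx' hy') :
    s = t := by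
  have ho : ∀ j : Fin (n + 2), s.obj j = t.obj j := by
    refine Fin.cases (hx.trans hx'.symm) fun j => ?_
    exact congrFun (congrArg WSimplex.obj h) j
  refine ext_coord ho ?_
  rintro q α x z hs hz ht hz'
  subst hx
  obtain rfl := hs
  by_cases hα : α.toOrderHom 0 = 0
  · obtain rfl : z = s.obj 0 := by rw [← hz, hα]
    rw [s.coord_of_zero α hα, t.coord_of_zero α hα]
  · obtain ⟨β, rfl⟩ := exists_comp_δ 0 α fun i hi => hα (Fin.le_zero_iff.1
      ((α.toOrderHom.monotone (Fin.zero_le i)).trans_eq hi))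
    rw [s.coord_comp β _ rfl hy hz hy hz, t.coord_comp β _ ht hy' hz' hy' hz', hc]
    exact congrArg _ (coord_congr h rfl _ _ _ _)

/-- The coordinates at vertices above 1 are read off the face `δ 1`, which keeps vertex 0; the one
at vertex 1 is a restriction of the first morphism. This serves horns whose zeroth face is missing.
-/
theorem ext_cons_one {n : ℕ} {s t : G.WSimplex ⦋n + 1⦌}
    (h : s.restrict (SimplexCategory.δ 1) = t.restrict (SimplexCategory.δ 1)) {x y : G.Obj}
    (hx : s.obj 0 = x) (hx' : t.obj 0 = x)
    (hy : s.obj ((SimplexCategory.δ (0 : Fin (n + 2))).toOrderHom 0) = y)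
    (hy' : t.obj ((SimplexCategory.δ (0 : Fin (n + 2))).toOrderHom 0) = y)
    (hc : s.coord (SimplexCategory.δ 0) hx hy = t.coord (SimplexCategory.δ 0) hx' hy') :
    s = t := by
  have ho : ∀ j : Fin (n + 2), s.obj j = t.obj j := by
    intro j
    by_cases hj : j = 1
    · subst hj
      exact hy.trans hy'.symm
    · obtain ⟨k, rfl⟩ := Fin.exists_succAbove_eq hj
      exact congrFun (congrArg WSimplex.obj h) k
  refine ext_coord ho ?_
  rintro q α x z hs hz ht hz'
  subst hx
  obtain rfl := hs
  by_cases hα : α.toOrderHom 0 = 0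
  · obtain rfl : z = s.obj 0 := by rw [← hz, hα]
    rw [s.coord_of_zero α hα, t.coord_of_zero α hα]
  by_cases hα' : α.toOrderHom 0 = (1 : Fin (n + 2))
  · obtain ⟨β, rfl⟩ := exists_comp_δ 0 α fun i hi => hα (Fin.le_zero_iff.1
      ((α.toOrderHom.monotone (Fin.zero_le i)).trans_eq hi))
    have hβ : β.toOrderHom 0 = 0 := Fin.succ_injective _ hα'
    obtain rfl : z = y := by rw [← hz, hα', ← hy]; rfl
    rw [s.coord_comp_of_zero β hβ _ rfl hy hz, t.coord_comp_of_zero β hβ _ ht hy' hz', hc]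
  · have h1 : (1 : Fin (n + 2)) < α.toOrderHom 0 :=
      lt_of_le_of_ne (Fin.one_le_of_ne_zero hα) (Ne.symm hα')
    obtain ⟨β, rfl⟩ := exists_comp_δ 1 α fun i hi => by
      have := α.toOrderHom.monotone (Fin.zero_le i)
      rw [hi] at this
      exact absurd h1 (not_lt.2 this)
    have e : (SimplexCategory.δ (1 : Fin (n + 2))).toOrderHom 0 = 0 := rfl
    have h0 : (s.restrict (SimplexCategory.δ 1)).obj 0 = s.obj 0 := rfl
    have h0' : (t.restrict (SimplexCategory.δ 1)).obj 0 = s.obj 0 := ht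
    rw [← s.restrict_coord_of_zero β _ e rfl h0 hz hz,
      ← t.restrict_coord_of_zero β _ e ht h0' hz' hz']
    exact coord_congr h rfl _ _ _ _

/-- Compatibility of quotients of coordinates with simplicial operators. -/
theorem map_coord_div {p p' q r : SimplexCategory} (s : G.WSimplex p) (t : G.WSimplex p')
    (θ : q ⟶ p) (θ' : q ⟶ p') (h : s.restrict θ = t.restrict θ') (ψ : r ⟶ q) {x y z w : G.Obj}
    (hx : s.obj 0 = x) (hy : t.obj 0 = y) (hz : s.obj (θ.toOrderHom 0) = z)
    (hz' : t.obj (θ'.toOrderHom 0) = z) (hw : s.obj ((ψ ≫ θ).toOrderHom 0) = w)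
    (hw' : t.obj ((ψ ≫ θ').toOrderHom 0) = w) :
    (G.Hom x y).map ψ.op (G.comp (s.coord θ hx hz) (G.inv (t.coord θ' hy hz'))) =
      G.comp (s.coord (ψ ≫ θ) hx hw) (G.inv (t.coord (ψ ≫ θ') hy hw')) := by
  -- Restricting along `ψ` multiplies both coordinates on the right by this common factor, which
  -- cancels in the quotient.
  have e : (s.restrict θ).coord ψ hz hw = (t.restrict θ').coord ψ hz' hw' :=
    coord_congr h rfl _ _ _ _
  rw [s.coord_comp ψ θ hx hz hw hz hw, t.coord_comp ψ θ' hy hz' hw' hz' hw', e, G.map_comp,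
    G.map_inv]
  generalize (t.restrict θ').coord ψ hz' hw' = c
  generalize (G.Hom x z).map ψ.op _ = a
  generalize (G.Hom y z).map ψ.op _ = b
  have : G.inv (G.comp b c) = G.comp (G.inv c) (G.inv b) := by
    symm
    apply G.inv_unique
    rw [G.assoc, inv_comp_cancel, G.inv_comp]
  rw [this, G.assoc, comp_inv_cancel]

end WSimplex

end SGpd

/-! ### Reducing lifting problems for `W̄` to morphism sets. -/

namespace SGpd

open SimplexCategory (δ)

variable {G H : SGpd.{u}} {F : G ⟶ H}

theorem δ_zero_comp_δ_succ {n : ℕ} (i : Fin (n + 2)) :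
    δ (0 : Fin (n + 2)) ≫ δ i.succ = δ i ≫ δ 0 :=
  SimplexCategory.δ_comp_δ (Fin.zero_le i)

theorem Wbar_obj_eq {n : ℕ} {y : H.WSimplex ⦋n + 1⦌} {s : G.WSimplex ⦋n⦌} {i : Fin (n + 2)}
    (h : (Wbar.map F).app (op ⦋n⦌) s = y.restrict (δ i)) (j : Fin (n + 1)) :
    F.obj (s.obj j) = y.obj ((δ i).toOrderHom j) :=
  congrFun (congrArg WSimplex.obj h) j

open WSimplex

/-- Write the simplex sought as a morphism `g` followed by its prescribed zeroth face `t`. Its face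
`i + 1` has zeroth face `d_i t` and first morphism `d_i g` followed by the coordinate of `t` at `δ
i`. So the only unknown is `g`, with prescribed image and prescribed faces `d_i g` for `i + 1 ∈ S`.
-/
theorem liftsFaces_Wbar_of_zero_mem (hF : Function.Bijective F.obj) {n : ℕ} {S : Set (Fin (n + 3))}
    (h0 : 0 ∈ S) (h : ∀ x y, LiftsFaces (F.map x y) n {i | i.succ ∈ S}) :
    LiftsFaces (Wbar.map F) (n + 1) S := by
  intro (y : H.WSimplex ⦋n + 2⦌) (s : ∀ i ∈ S, G.WSimplex ⦋n + 1⦌)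
    (hs : ∀ i hi, (Wbar.map F).app (op ⦋n + 1⦌) (s i hi) = y.restrict (δ i))
    (hm : ∀ (i j : Fin (n + 2)), i ≤ j → ∀ (hi : i.castSucc ∈ S) (hj : j.succ ∈ S),
      (s j.succ hj).restrict (δ i) = (s _ hi).restrict (δ j))
  obtain ⟨x, hx⟩ := hF.2 (y.obj 0)
  set t := s 0 h0
  have ho := fun i hi j => Wbar_obj_eq (hs i hi) j
  have hx' : ∀ i (hi : Fin.succ i ∈ S), (s i.succ hi).obj 0 = x := fun i hi => by
    apply hF.1
    rw [hx]
    exact ho i.succ hi 0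
  have hz : ∀ i (hi : Fin.succ i ∈ S), (s i.succ hi).obj ((δ (0 : Fin (n + 2))).toOrderHom 0) =
      t.obj ((δ i).toOrderHom 0) := fun i hi => by
    apply hF.1
    rw [ho, ho]
    exact congrArg (fun θ => y.obj (SimplexCategory.Hom.toOrderHom θ 0)) (δ_zero_comp_δ_succ i)
  have hy0 : y.obj 0 = F.obj x := hx.symm
  have hy1 : y.obj ((δ (0 : Fin (n + 3))).toOrderHom 0) = F.obj (t.obj 0) := (ho 0 h0 0).symm
  have hyz : ∀ i : Fin (n + 2), y.obj ((δ i ≫ δ 0).toOrderHom 0) =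
      F.obj (t.obj ((δ i).toOrderHom 0)) := fun i => (ho 0 h0 _).symm
  -- The face required of `g` is the first morphism of `s (i + 1)` divided by the coordinate of `t`
  -- at `δ i`, a correction that is nontrivial only for `i = 0`.
  obtain ⟨g, hg, hg'⟩ := h x (t.obj 0) (y.coord (δ 0) hy0 hy1)
    (fun i hi => G.comp ((s i.succ hi).coord (δ 0) (hx' i hi) (hz i hi))
      (G.inv (t.coord (δ i) rfl rfl))) (by
      intro i hi
      have e0 : (y.restrict (δ i.succ)).obj 0 = F.obj x := hy0
      have e1 : (y.restrict (δ i.succ)).obj ((δ (0 : Fin (n + 2))).toOrderHom 0) =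
          F.obj (t.obj ((δ i).toOrderHom 0)) := by
        rw [← hz i hi]; exact (ho _ hi _).symm
      have e2 : y.obj ((δ 0 ≫ δ i.succ).toOrderHom 0) = F.obj (t.obj ((δ i).toOrderHom 0)) := e1
      rw [F.map_comp, F.map_inv, map_coord _ F (δ 0) (hx' i hi) (hz i hi) (hs i.succ hi) e0 e1,
        map_coord _ F (δ i) rfl rfl (hs 0 h0) hy1 (hyz i),
        y.restrict_coord_of_zero (δ 0) (δ i.succ) rfl hy0 e0 e2 e1,
        coord_congr rfl (δ_zero_comp_δ_succ i) hy0 e2 hy0 (hyz i),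
        y.coord_comp (δ i) (δ 0) hy0 hy1 (hyz i) hy1 (hyz i), comp_cancel_inv]) (by
      cases n with
      | zero => trivial
      | succ n =>
        intro i j hij hi hj
        have hi' : i.castSucc.succ ∈ S := hi
        have hj' : j.succ.succ ∈ S := hj
        have e1 : (s j.succ.succ hj').restrict (δ i.succ) =
            (s i.castSucc.succ hi').restrict (δ j.succ) :=
          hm i.succ j.succ (Fin.succ_le_succ_iff.2 hij) hi' hj'
        have e2 : (s j.succ.succ hj').restrict (δ 0) = t.restrict (δ j.succ) :=
          hm 0 j.succ (Fin.zero_le _) h0 hj'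
        have e3 : (s i.castSucc.succ hi').restrict (δ 0) = t.restrict (δ i.castSucc) :=
          hm 0 i.castSucc (Fin.zero_le _) h0 hi'
        have e4 : δ i ≫ δ j.succ = δ j ≫ δ i.castSucc := SimplexCategory.δ_comp_δ hij
        obtain ⟨w, hw⟩ : ∃ w, t.obj ((δ i ≫ δ j.succ).toOrderHom 0) = w := ⟨_, rfl⟩
        have hw' : t.obj ((δ j ≫ δ i.castSucc).toOrderHom 0) = w := by rw [← e4, hw]
        have hp : (s j.succ.succ hj').obj ((δ i ≫ δ 0).toOrderHom 0) = w :=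
          (congrFun (congrArg WSimplex.obj e2) ((δ i).toOrderHom 0)).trans hw
        have hq : (s i.castSucc.succ hi').obj ((δ j ≫ δ 0).toOrderHom 0) = w :=
          (congrFun (congrArg WSimplex.obj e3) ((δ j).toOrderHom 0)).trans hw'
        have hp' : (s j.succ.succ hj').obj ((δ 0 ≫ δ i.succ).toOrderHom 0) = w := by
          rw [δ_zero_comp_δ_succ, hp]
        have hq' : (s i.castSucc.succ hi').obj ((δ 0 ≫ δ j.succ).toOrderHom 0) = w := by
          rw [δ_zero_comp_δ_succ, hq]
        -- Matching with the zeroth face makes these quotients compatible with restriction; what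
        -- remains is matching among the other prescribed faces.
        refine (map_coord_div _ _ _ _ e2 (δ i) _ _ _ _ hp hw).trans (Eq.trans ?_
          (map_coord_div _ _ _ _ e3 (δ j) _ _ _ _ hq hw').symm)
        refine congrArg₂ G.comp ?_ (congrArg G.inv (coord_congr rfl e4 _ _ _ _))
        have a0 : ((s j.succ.succ hj').restrict (δ i.succ)).obj 0 = x := hx' _ hj'
        have a1 : ((s j.succ.succ hj').restrict (δ i.succ)).obj
          ((δ (0 : Fin (n + 2))).toOrderHom 0) = w := hp'
        have b0 : ((s i.castSucc.succ hi').restrict (δ j.succ)).obj 0 = x := hx' _ hi'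
        have b1 : ((s i.castSucc.succ hi').restrict (δ j.succ)).obj
          ((δ (0 : Fin (n + 2))).toOrderHom 0) = w := hq'
        rw [coord_congr rfl (δ_zero_comp_δ_succ i).symm (hx' _ hj') hp (hx' _ hj') hp',
          coord_congr rfl (δ_zero_comp_δ_succ j).symm (hx' _ hi') hq (hx' _ hi') hq',
          ← restrict_coord_of_zero _ (δ 0) (δ i.succ) rfl (hx' _ hj') a0 hp' a1,
          ← restrict_coord_of_zero _ (δ 0) (δ j.succ) rfl (hx' _ hi') b0 hq' b1]
        exact coord_congr e1 rfl _ _ _ _)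
  obtain ⟨r, hr, hr0, hr1⟩ := exists_cons t g
  have hr1' : r.obj ((δ (0 : Fin (n + 3))).toOrderHom 0) = t.obj 0 :=
    congrFun (congrArg WSimplex.obj hr) 0
  refine ⟨r, ?_, (?_ : ∀ i hi, r.restrict (δ i) = s i hi)⟩
  · have hR : ((Wbar.map F).app (op ⦋n + 2⦌) r : H.WSimplex ⦋n + 2⦌).restrict (δ 0) =
        y.restrict (δ 0) := by
      rw [← map_restrict, hr]
      exact hs 0 h0
    have e0 : ((Wbar.map F).app (op ⦋n + 2⦌) r : H.WSimplex ⦋n + 2⦌).obj 0 = F.obj x :=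
      congrArg F.obj hr0
    have e1 : ((Wbar.map F).app (op ⦋n + 2⦌) r : H.WSimplex ⦋n + 2⦌).obj
        ((δ (0 : Fin (n + 3))).toOrderHom 0) = F.obj (t.obj 0) := congrArg F.obj hr1'
    refine ext_cons hR e0 hy0 e1 hy1 ?_
    rw [← hg, ← hr1 hr0 hr1']
    exact (map_coord r F (δ 0) hr0 hr1' rfl e0 e1).symm
  · refine Fin.cases (fun _ => hr) fun i hi => ?_
    have e0 : (r.restrict (δ i.succ)).obj 0 = x := hr0
    have e1 : (r.restrict (δ i.succ)).obj ((δ (0 : Fin (n + 2))).toOrderHom 0) =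
        t.obj ((δ i).toOrderHom 0) := by
      rw [← hr]
      exact congrArg (fun θ => r.obj (SimplexCategory.Hom.toOrderHom θ 0)) (δ_zero_comp_δ_succ i)
    have e2 : r.obj ((δ 0 ≫ δ i.succ).toOrderHom 0) = t.obj ((δ i).toOrderHom 0) := e1
    have e3 : r.obj ((δ i ≫ δ 0).toOrderHom 0) = t.obj ((δ i).toOrderHom 0) :=
      congrFun (congrArg WSimplex.obj hr) _
    have e4 : (r.restrict (δ 0)).obj ((δ i).toOrderHom 0) = t.obj ((δ i).toOrderHom 0) := e3
    refine ext_cons (x := x) ?_ e0 (hx' i hi) e1 (hz i hi) ?_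
    · refine Eq.trans ?_ (hm 0 i (Fin.zero_le i) h0 hi).symm
      rw [← restrict_comp, δ_zero_comp_δ_succ, restrict_comp, hr]
      rfl
    · rw [r.restrict_coord_of_zero (δ 0) (δ i.succ) rfl hr0 e0 e2 e1,
        coord_congr rfl (δ_zero_comp_δ_succ i) hr0 e2 hr0 e3,
        r.coord_comp (δ i) (δ 0) hr0 hr1' e3 hr1' e4, hr1 hr0 hr1', hg' i hi,
        coord_congr hr rfl hr1' e4 rfl rfl, inv_cancel_comp]

end SGpd

namespace SGpd

open SimplexCategory (δ)
open WSimplex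

variable {G H : SGpd.{u}} {F : G ⟶ H}

/-- With the zeroth face missing, the face `t` at 1 takes over. The faces `d_i g` with `i ≥ 1` are
prescribed, without correction since `δ i` then fixes 0. Once `g` is found, the zeroth face is
forced: the condition at face 1 can be solved for it because morphisms are invertible. -/
theorem liftsFaces_Wbar_of_one_mem (hF : Function.Bijective F.obj) {n : ℕ} {S : Set (Fin (n + 3))}
    (h0 : 0 ∉ S) (h1 : 1 ∈ S) (h : ∀ x y, LiftsFaces (F.map x y) n {i | i.succ ∈ S ∧ i ≠ 0}) :
    LiftsFaces (Wbar.map F) (n + 1) S := by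
  intro (y : H.WSimplex ⦋n + 2⦌) (s : ∀ i ∈ S, G.WSimplex ⦋n + 1⦌)
    (hs : ∀ i hi, (Wbar.map F).app (op ⦋n + 1⦌) (s i hi) = y.restrict (δ i))
    (hm : ∀ (i j : Fin (n + 2)), i ≤ j → ∀ (hi : i.castSucc ∈ S) (hj : j.succ ∈ S),
      (s j.succ hj).restrict (δ i) = (s _ hi).restrict (δ j))
  obtain ⟨x', hx'⟩ := hF.2 (y.obj 1)
  set t := s 1 h1
  have ho := fun i hi j => Wbar_obj_eq (hs i hi) j
  have hy0 : y.obj 0 = F.obj (t.obj 0) := (ho 1 h1 0).symm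
  have hy1 : y.obj ((δ (0 : Fin (n + 3))).toOrderHom 0) = F.obj x' := hx'.symm
  have hx : ∀ i (hi : Fin.succ i ∈ S), (s i.succ hi).obj 0 = t.obj 0 := fun i hi => by
    apply hF.1
    rw [← hy0]
    exact ho i.succ hi 0
  have hδ : ∀ i : Fin (n + 2), i ≠ 0 → (δ i).toOrderHom 0 = 0 := fun i hi =>
    Fin.succAbove_ne_zero_zero hi
  have hδ' : ∀ i : Fin (n + 2), i ≠ 0 →
      (δ i.succ).toOrderHom ((δ (0 : Fin (n + 2))).toOrderHom 0) =
        (δ (0 : Fin (n + 3))).toOrderHom 0 := fun i hi =>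
    (congrArg (fun θ => SimplexCategory.Hom.toOrderHom θ 0) (δ_zero_comp_δ_succ i)).trans
      (congrArg (δ (0 : Fin (n + 3))).toOrderHom (hδ i hi))
  have hz : ∀ i (hi : Fin.succ i ∈ S), i ≠ 0 →
      (s i.succ hi).obj ((δ (0 : Fin (n + 2))).toOrderHom 0) = x' := fun i hi hi0 => by
    apply hF.1
    rw [ho, hδ' i hi0, hy1]
  obtain ⟨g, hg, hg'⟩ := h (t.obj 0) x' (y.coord (δ 0) hy0 hy1)
    (fun i hi => (s i.succ hi.1).coord (δ 0) (hx i hi.1) (hz i hi.1 hi.2)) (by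
      rintro i ⟨hi, hi0⟩
      have e0 : (y.restrict (δ i.succ)).obj 0 = F.obj (t.obj 0) := hy0
      have e1 : (y.restrict (δ i.succ)).obj ((δ (0 : Fin (n + 2))).toOrderHom 0) = F.obj x' := by
        rw [← hz i hi hi0]; exact (ho _ hi _).symm
      have e2 : y.obj ((δ 0 ≫ δ i.succ).toOrderHom 0) = F.obj x' := e1
      have e3 : y.obj ((δ i ≫ δ 0).toOrderHom 0) = F.obj x' := by
        rw [← δ_zero_comp_δ_succ]; exact e2
      rw [map_coord _ F (δ 0) (hx i hi) (hz i hi hi0) (hs i.succ hi) e0 e1,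
        y.restrict_coord_of_zero (δ 0) (δ i.succ) rfl hy0 e0 e2 e1,
        coord_congr rfl (δ_zero_comp_δ_succ i) hy0 e2 hy0 e3,
        y.coord_comp_of_zero (δ i) (hδ i hi0) (δ 0) hy0 hy1 e3]) (by
      cases n with
      | zero => trivial
      | succ n =>
        rintro i j hij ⟨hi, hi0⟩ ⟨hj, hj0⟩
        have hi' : i.castSucc.succ ∈ S := hi
        have hj' : j.succ.succ ∈ S := hj
        have hi0' : i ≠ 0 := fun h => hi0 (by rw [h]; rfl)
        have hj0' : j ≠ 0 := fun h => hi0' (Fin.le_zero_iff.1 (hij.trans_eq h))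
        have e1 : (s j.succ.succ hj').restrict (δ i.succ) =
            (s i.castSucc.succ hi').restrict (δ j.succ) :=
          hm i.succ j.succ (Fin.succ_le_succ_iff.2 hij) hi' hj'
        have hδ'' : ∀ i : Fin (n + 2), i ≠ 0 → (δ i).toOrderHom 0 = 0 := fun i hi =>
          Fin.succAbove_ne_zero_zero hi
        have hp : (s j.succ.succ hj').obj ((δ i ≫ δ 0).toOrderHom 0) = x' :=
          (congrArg (fun k => (s j.succ.succ hj').obj ((δ (0 : Fin (n + 3))).toOrderHom k))
            (hδ'' i hi0')).trans (hz _ hj' hj0)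
        have hq : (s i.castSucc.succ hi').obj ((δ j ≫ δ 0).toOrderHom 0) = x' :=
          (congrArg (fun k => (s i.castSucc.succ hi').obj ((δ (0 : Fin (n + 3))).toOrderHom k))
            (hδ'' j hj0')).trans (hz _ hi' hi0)
        have hp' : (s j.succ.succ hj').obj ((δ 0 ≫ δ i.succ).toOrderHom 0) = x' := by
          rw [δ_zero_comp_δ_succ, hp]
        have hq' : (s i.castSucc.succ hi').obj ((δ 0 ≫ δ j.succ).toOrderHom 0) = x' := by
          rw [δ_zero_comp_δ_succ, hq]
        have a0 : ((s j.succ.succ hj').restrict (δ i.succ)).obj 0 = t.obj 0 := hx _ hj'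
        have a1 : ((s j.succ.succ hj').restrict (δ i.succ)).obj
          ((δ (0 : Fin (n + 2))).toOrderHom 0) = x' := hp'
        have b0 : ((s i.castSucc.succ hi').restrict (δ j.succ)).obj 0 = t.obj 0 := hx _ hi'
        have b1 : ((s i.castSucc.succ hi').restrict (δ j.succ)).obj
          ((δ (0 : Fin (n + 2))).toOrderHom 0) = x' := hq'
        refine (coord_comp_of_zero _ (δ i) (hδ'' i hi0') (δ 0) _ (hz _ hj' hj0) hp).symm.trans
          (Eq.trans ?_
            (coord_comp_of_zero _ (δ j) (hδ'' j hj0') (δ 0) _ (hz _ hi' hi0) hq))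
        rw [coord_congr rfl (δ_zero_comp_δ_succ i).symm (hx _ hj') hp (hx _ hj') hp',
          coord_congr rfl (δ_zero_comp_δ_succ j).symm (hx _ hi') hq (hx _ hi') hq',
          ← restrict_coord_of_zero _ (δ 0) (δ i.succ) rfl (hx _ hj') a0 hp' a1,
          ← restrict_coord_of_zero _ (δ 0) (δ j.succ) rfl (hx _ hi') b0 hq' b1]
        exact coord_congr e1 rfl _ _ _ _)
  have ht1 : t.obj ((δ (0 : Fin (n + 2))).toOrderHom 0) = (t.restrict (δ 0)).obj 0 := rfl
  have hδ10 : δ (0 : Fin (n + 2)) ≫ δ (1 : Fin (n + 3)) = δ 0 ≫ δ 0 := δ_zero_comp_δ_succ 0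
  -- The missing face `τ`. Its first morphism is chosen so that `d_0 g` followed by it is the first
  -- morphism of `t`, which is the equation for face 1.
  obtain ⟨τ, hτ, hτ0, hτ1⟩ := exists_cons (t.restrict (δ 0)) (x := x')
    (G.comp (G.inv ((G.Hom _ _).map (δ 0).op g)) (t.coord (δ 0) rfl ht1))
  obtain rfl := hτ0
  obtain ⟨r, hr, hr0, hr1⟩ := exists_cons τ g
  have hr1' : r.obj ((δ (0 : Fin (n + 3))).toOrderHom 0) = τ.obj 0 :=
    congrFun (congrArg WSimplex.obj hr) 0
  have hrt : r.restrict (δ 1) = t := by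
    have e0 : (r.restrict (δ 1)).obj 0 = t.obj 0 := hr0
    have e1 : r.obj ((δ 0 ≫ δ 0).toOrderHom 0) = (t.restrict (δ 0)).obj 0 := by
      rw [← hτ, ← hr]; rfl
    have e2 : (r.restrict (δ 1)).obj ((δ (0 : Fin (n + 2))).toOrderHom 0) =
        (t.restrict (δ 0)).obj 0 := e1
    have e3 : r.obj ((δ 0 ≫ δ 1).toOrderHom 0) = (t.restrict (δ 0)).obj 0 := e1
    have e4 : (r.restrict (δ 0)).obj ((δ (0 : Fin (n + 2))).toOrderHom 0) =
        (t.restrict (δ 0)).obj 0 := e1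
    have e5 : τ.obj ((δ (0 : Fin (n + 2))).toOrderHom 0) = (t.restrict (δ 0)).obj 0 := by
      rw [← hτ]; rfl
    refine ext_cons ?_ e0 rfl e2 ht1 ?_
    · rw [← restrict_comp, hδ10, restrict_comp, hr, hτ]
    · rw [r.restrict_coord_of_zero (δ 0) (δ 1) rfl hr0 e0 e3 e2,
        coord_congr rfl hδ10 hr0 e3 hr0 e1, r.coord_comp (δ 0) (δ 0) hr0 hr1' e1 hr1' e4,
        hr1 hr0 hr1', coord_congr hr rfl hr1' e4 rfl e5, hτ1 rfl e5, comp_inv_cancel]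
  refine ⟨r, ?_, (?_ : ∀ i hi, r.restrict (δ i) = s i hi)⟩
  · have hR : ((Wbar.map F).app (op ⦋n + 2⦌) r : H.WSimplex ⦋n + 2⦌).restrict (δ 1) =
        y.restrict (δ 1) := by
      rw [← map_restrict, hrt]
      exact hs 1 h1
    have e0 : ((Wbar.map F).app (op ⦋n + 2⦌) r : H.WSimplex ⦋n + 2⦌).obj 0 = F.obj (t.obj 0) :=
      congrArg F.obj hr0
    have e1 : ((Wbar.map F).app (op ⦋n + 2⦌) r : H.WSimplex ⦋n + 2⦌).obj
        ((δ (0 : Fin (n + 3))).toOrderHom 0) = F.obj (τ.obj 0) := congrArg F.obj hr1'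
    refine ext_cons_one hR e0 hy0 e1 hy1 ?_
    rw [← hg, ← hr1 hr0 hr1']
    exact (map_coord r F (δ 0) hr0 hr1' rfl e0 e1).symm
  · refine Fin.cases (fun h => (h0 h).elim) fun i hi => ?_
    by_cases hi0 : i = 0
    · subst hi0
      exact hrt
    have e0 : (r.restrict (δ i.succ)).obj 0 = t.obj 0 := hr0
    have e3 : r.obj ((δ i ≫ δ 0).toOrderHom 0) = τ.obj 0 :=
      (congrArg (fun k => r.obj ((δ (0 : Fin (n + 3))).toOrderHom k)) (hδ i hi0)).trans hr1'
    have e2 : r.obj ((δ 0 ≫ δ i.succ).toOrderHom 0) = τ.obj 0 := by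
      rw [δ_zero_comp_δ_succ, e3]
    have e1 : (r.restrict (δ i.succ)).obj ((δ (0 : Fin (n + 2))).toOrderHom 0) = τ.obj 0 := e2
    have hi1 : 1 ≤ i := Fin.one_le_of_ne_zero hi0
    -- The other faces are compared through their own face 1, where the matching with `t` applies,
    -- and through their first morphism.
    refine ext_cons_one (x := t.obj 0) ?_ e0 (hx i hi) e1 (hz i hi hi0) ?_
    · refine Eq.trans ?_ (hm 1 i hi1 h1 hi).symm
      rw [← restrict_comp, SimplexCategory.δ_comp_δ hi1, restrict_comp]
      exact congrArg _ hrt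
    · rw [r.restrict_coord_of_zero (δ 0) (δ i.succ) rfl hr0 e0 e2 e1,
        coord_congr rfl (δ_zero_comp_δ_succ i) hr0 e2 hr0 e3,
        r.coord_comp_of_zero (δ i) (hδ i hi0) (δ 0) hr0 hr1' e3, hr1 hr0 hr1', hg' i ⟨hi, hi0⟩]

/-- A vertex of `W̄ G` is just an object. As `F` is injective on objects, any edge over `y`
automatically has the prescribed end points. -/
theorem liftsFaces_Wbar_zero (hF : Function.Bijective F.obj)
    (h : ∀ x y, Function.Surjective ((F.map x y).app (op ⦋0⦌))) (S : Set (Fin 2)) :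
    LiftsFaces (Wbar.map F) 0 S := by
  intro (y : H.WSimplex ⦋1⦌) (s : ∀ i ∈ S, G.WSimplex ⦋0⦌)
    (hs : ∀ i hi, (Wbar.map F).app (op ⦋0⦌) (s i hi) = y.restrict (δ i)) _
  obtain ⟨x, hx⟩ := hF.2 (y.obj 0)
  obtain ⟨x', hx'⟩ := hF.2 (y.obj 1)
  obtain ⟨t, rfl⟩ := exists_vertex x'
  have hy1 : y.obj ((δ (0 : Fin 2)).toOrderHom 0) = F.obj (t.obj 0) := hx'.symm
  obtain ⟨g, hg⟩ := h x (t.obj 0) (y.coord (δ 0) hx.symm hy1)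
  obtain ⟨r, hr, hr0, hr1⟩ := exists_cons t g
  have hr1' : r.obj ((δ (0 : Fin 2)).toOrderHom 0) = t.obj 0 :=
    congrFun (congrArg WSimplex.obj hr) 0
  have e0 : ((Wbar.map F).app (op ⦋1⦌) r : H.WSimplex ⦋1⦌).obj 0 = F.obj x := congrArg F.obj hr0
  have e1 : ((Wbar.map F).app (op ⦋1⦌) r : H.WSimplex ⦋1⦌).obj
      ((δ (0 : Fin 2)).toOrderHom 0) = F.obj (t.obj 0) := congrArg F.obj hr1'
  have hry : (Wbar.map F).app (op ⦋1⦌) r = y := by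
    refine ext_cons ?_ e0 hx.symm e1 hy1 ?_
    · apply ext_vertex
      exact e1.trans hy1.symm
    · rw [← hg, ← hr1 hr0 hr1']
      exact (map_coord r F (δ 0) hr0 hr1' rfl e0 e1).symm
  refine ⟨r, hry, (?_ : ∀ i hi, r.restrict (δ i) = s i hi)⟩
  intro i hi
  apply ext_vertex
  apply hF.1
  refine Eq.trans ?_ (Wbar_obj_eq (hs i hi) 0).symm
  exact congrFun (congrArg WSimplex.obj hry) ((δ i).toOrderHom 0)

/-- `W̄` sends fibrations that are bijective on objects and surjective to Kan fibrations. -/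
theorem isKanFibration_Wbar (hF : Function.Bijective F.obj)
    (h₀ : ∀ x y, Function.Surjective ((F.map x y).app (op ⦋0⦌)))
    (h : ∀ x y n k, LiftsFaces (F.map x y) n {k}ᶜ) : IsKanFibration (Wbar.map F) := by
  refine .of_liftsFaces fun n k => ?_
  cases n with
  | zero => exact liftsFaces_Wbar_zero hF h₀ _
  | succ n =>
    -- A horn of index `l + 1` in `W̄` becomes the horn of index `l` in a morphism set; the horn of
    -- index 0 becomes again one of index 0.
    obtain rfl | ⟨l, rfl⟩ := Fin.eq_zero_or_eq_succ k
    · refine liftsFaces_Wbar_of_one_mem hF (by simp) (by simp) fun x y => ?_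
      convert h x y n 0 using 2
      ext i
      simp
    · refine liftsFaces_Wbar_of_zero_mem hF (Fin.succ_ne_zero l).symm fun x y => ?_
      convert h x y n l using 2
      ext i
      simp

theorem isWeakEquivalence_Wbar (hF : Function.Bijective F.obj)
    (h₀ : ∀ x y, Function.Surjective ((F.map x y).app (op ⦋0⦌)))
    (h : ∀ x y n, LiftsFaces (F.map x y) n Set.univ) : IsWeakEquivalence (Wbar.map F) := by
  refine .of_rlp (rlp_I_of_liftsFaces (fun (y : H.WSimplex ⦋0⦌) => ?_) fun n => ?_)
  · obtain ⟨x, hx⟩ := hF.2 (y.obj 0)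
    obtain ⟨t, rfl⟩ := exists_vertex x
    exact ⟨t, ext_vertex hx⟩
  · cases n with
    | zero => exact liftsFaces_Wbar_zero hF h₀ _
    | succ n => exact liftsFaces_Wbar_of_zero_mem hF trivial fun x y => h x y n

end SGpd

/-! ### Moore's argument: levelwise surjections are fibrations on morphism sets. -/

namespace SGpd

open SimplexCategory (δ σ)

variable {G H : SGpd.{u}}

/-- One step of the construction of a simplex with prescribed faces: the `i`-th face is corrected
by means of a degenerate simplex. -/
theorem exists_correct_face (F : G ⟶ H) {x y : G.Obj} {n : ℕ}
    {h : (H.Hom (F.obj x) (F.obj y)).obj (op ⦋n + 1⦌)} (w : (G.Hom x y).obj (op ⦋n + 1⦌))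
    (hw : (F.map x y).app _ w = h) (i : Fin (n + 2)) (c : (G.Hom x y).obj (op ⦋n⦌))
    (hc : (F.map x y).app _ c = (H.Hom _ _).map (δ i).op h) (e : Fin (n + 1))
    (hie : δ i ≫ σ e = 𝟙 _) :
    ∃ w' : (G.Hom x y).obj (op ⦋n + 1⦌), (F.map x y).app _ w' = h ∧
      (G.Hom x y).map (δ i).op w' = c ∧
      ∀ (j : Fin (n + 2)) {q : SimplexCategory} (ψ : ⦋n⦌ ⟶ q) (θ : q ⟶ ⦋n⦌), δ j ≫ σ e = ψ ≫ θ →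
        (G.Hom x y).map θ.op ((G.Hom x y).map (δ i).op w) = (G.Hom x y).map θ.op c →
        (G.Hom x y).map (δ j).op w' = (G.Hom x y).map (δ j).op w := by
  refine ⟨G.comp w ((G.Hom y y).map (σ e).op
    (G.comp (G.inv ((G.Hom x y).map (δ i).op w)) c)), ?_, ?_, ?_⟩
  · rw [F.map_comp, F.naturality, F.map_comp, F.map_inv, F.naturality, hw, hc, H.inv_comp,
      H.map_id, H.comp_id]
  · rw [G.map_comp, ← sset_map_comp, ← op_comp, hie, op_id, sset_map_id (G.Hom y y),
      comp_inv_cancel]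
  · intro j q ψ θ hj hθ
    rw [G.map_comp, ← sset_map_comp, ← op_comp, hj, op_comp, sset_map_comp (G.Hom y y),
      G.map_comp θ.op, G.map_inv, hθ, G.inv_comp, G.map_id, G.comp_id]

/-- Start from any lift of `h` and correct its faces one by one, multiplying by degenerate elements
of the kernel. The faces below `k` are treated upwards and those above `k` downwards, so that each
correction leaves the earlier ones intact. -/
theorem liftsFaces_map_compl (F : G ⟶ H)
    (hF : ∀ x y n, Function.Surjective ((F.map x y).app n)) (x y : G.Obj) (n : ℕ)
    (k : Fin (n + 2)) : LiftsFaces (F.map x y) n {k}ᶜ := by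
  intro h c hc hm
  -- For `j` below `i` and `e`, the composite `δ j ≫ σ e` factors through `δ j` in dimension one
  -- less. Along that face `d_i w` and `c i` already agree, because `d_j w = c j` and the `c`'s
  -- match; hence correcting face `i` does not disturb face `j`.
  have lower : ∀ (i : Fin (n + 2)) (hi : i ∈ ({k}ᶜ : Set _)) (e : Fin (n + 1))
      (w : (G.Hom x y).obj (op ⦋n + 1⦌)) (j : Fin (n + 2)) (hj : j ∈ ({k}ᶜ : Set _)),
      j.val < i.val → j.val < e.val → (G.Hom x y).map (δ j).op w = c j hj →
      ∃ (q : SimplexCategory) (ψ : ⦋n⦌ ⟶ q) (θ : q ⟶ ⦋n⦌), δ j ≫ σ e = ψ ≫ θ ∧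
        (G.Hom x y).map θ.op ((G.Hom x y).map (δ i).op w) = (G.Hom x y).map θ.op (c i hi) := by
    intro i hi e w j hj hji hje hw
    cases n with
    | zero => omega
    | succ n =>
      obtain ⟨i, rfl⟩ := Fin.exists_succ_eq.2 (fun h : i = 0 => by
        rw [h] at hji; exact absurd hji (Nat.not_lt_zero _))
      obtain ⟨e, rfl⟩ := Fin.exists_succ_eq.2 (fun h : e = 0 => by
        rw [h] at hje; exact absurd hje (Nat.not_lt_zero _))
      obtain ⟨j, rfl⟩ := Fin.exists_castSucc_eq.2 (fun h : j = Fin.last _ => by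
        rw [h] at hji; exact absurd hji (by simp))
      have hji' : j ≤ i := by rw [Fin.le_def]; simp at hji; omega
      have hje' : j ≤ e.castSucc := by rw [Fin.le_def]; simp at hje ⊢; omega
      refine ⟨_, σ e, δ j, SimplexCategory.δ_comp_σ_of_le hje', ?_⟩
      rw [← sset_map_comp, ← op_comp, SimplexCategory.δ_comp_δ hji', op_comp,
        sset_map_comp (G.Hom x y), hw]
      exact (hm j i hji' hj hi).symm
  have upper : ∀ (i : Fin (n + 2)) (hi : i ∈ ({k}ᶜ : Set _)) (e : Fin (n + 1))
      (w : (G.Hom x y).obj (op ⦋n + 1⦌)) (j : Fin (n + 2)) (hj : j ∈ ({k}ᶜ : Set _)),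
      i.val < j.val → e.val + 1 < j.val → (G.Hom x y).map (δ j).op w = c j hj →
      ∃ (q : SimplexCategory) (ψ : ⦋n⦌ ⟶ q) (θ : q ⟶ ⦋n⦌), δ j ≫ σ e = ψ ≫ θ ∧
        (G.Hom x y).map θ.op ((G.Hom x y).map (δ i).op w) = (G.Hom x y).map θ.op (c i hi) := by
    intro i hi e w j hj hij hej hw
    cases n with
    | zero => omega
    | succ n =>
      obtain ⟨j, rfl⟩ := Fin.exists_succ_eq.2 (fun h : j = 0 => by
        rw [h] at hij; exact absurd hij (Nat.not_lt_zero _))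
      obtain ⟨e, rfl⟩ := Fin.exists_castSucc_eq.2 (fun h : e = Fin.last _ => by
        rw [h] at hej; exact absurd hej (by have := j.isLt; simp; omega))
      obtain ⟨i, rfl⟩ := Fin.exists_castSucc_eq.2 (fun h : i = Fin.last _ => by
        rw [h] at hij; exact absurd hij (by simp))
      have hij' : i ≤ j := by rw [Fin.le_def]; simp at hij; omega
      have hej' : e.castSucc < j := by rw [Fin.lt_def]; simp at hej ⊢; omega
      refine ⟨_, σ e, δ j, SimplexCategory.δ_comp_σ_of_gt hej', ?_⟩
      rw [← sset_map_comp, ← op_comp, ← SimplexCategory.δ_comp_δ hij', op_comp,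
        sset_map_comp (G.Hom x y), hw]
      exact hm i j hij' hi hj
  have asc : ∀ a : ℕ, a ≤ k.val → ∃ w : (G.Hom x y).obj (op ⦋n + 1⦌), (F.map x y).app _ w = h ∧
      ∀ j hj, j.val < a → (G.Hom x y).map (δ j).op w = c j hj := by
    intro a
    induction a with
    | zero =>
      intro _
      obtain ⟨w, hw⟩ := hF x y _ h
      exact ⟨w, hw, fun j _ hj => absurd hj (Nat.not_lt_zero _)⟩
    | succ a ih =>
      intro ha
      obtain ⟨w, hw, hw'⟩ := ih (by omega)
      have hk := k.isLt
      let e : Fin (n + 1) := ⟨a, by omega⟩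
      have he : e.castSucc ∈ ({k}ᶜ : Set _) := fun h => by
        have : a = k.val := congrArg Fin.val h
        omega
      obtain ⟨w₁, h1, h2, h3⟩ := exists_correct_face F w hw e.castSucc (c _ he) (hc _ he) e
        SimplexCategory.δ_comp_σ_self
      refine ⟨w₁, h1, fun j hj hja => ?_⟩
      by_cases hj' : j = e.castSucc
      · subst hj'
        exact h2
      · have hja' : j.val < a := lt_of_le_of_ne (by omega) fun h => hj' (Fin.ext h)
        obtain ⟨q, ψ, θ, e1, e2⟩ := lower _ he e w j hj hja' hja' (hw' j hj hja')
        rw [h3 j ψ θ e1 e2, hw' j hj hja']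
  have desc : ∀ b : ℕ, b + k.val ≤ n + 1 → ∃ w : (G.Hom x y).obj (op ⦋n + 1⦌),
      (F.map x y).app _ w = h ∧
      ∀ j hj, (j.val < k.val ∨ n + 2 ≤ j.val + b) → (G.Hom x y).map (δ j).op w = c j hj := by
    intro b
    induction b with
    | zero =>
      intro _
      obtain ⟨w, hw, hw'⟩ := asc _ le_rfl
      exact ⟨w, hw, fun j hj h => hw' j hj (by have := j.isLt; omega)⟩
    | succ b ih =>
      intro hb
      obtain ⟨w, hw, hw'⟩ := ih (by omega)
      -- The face now corrected is `n + 1 - b`, using the degeneracy one index lower. Faces below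
      -- `k` satisfy `j < n - b`, so `lower` protects them, and `upper` protects those already
      -- treated from above.
      let e : Fin (n + 1) := ⟨n - b, by omega⟩
      have he : e.succ ∈ ({k}ᶜ : Set _) := fun h => by
        have : n - b + 1 = k.val := congrArg Fin.val h
        omega
      obtain ⟨w₁, h1, h2, h3⟩ := exists_correct_face F w hw e.succ (c _ he) (hc _ he) e
        SimplexCategory.δ_comp_σ_succ
      refine ⟨w₁, h1, fun j hj hjb => ?_⟩
      by_cases hj' : j = e.succ
      · subst hj'
        exact h2
      · have hj'' : j.val ≠ n - b + 1 := fun h => hj' (Fin.ext h)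
        have hjw := hw' j hj (by omega)
        obtain ⟨q, ψ, θ, e1, e2⟩ : ∃ (q : SimplexCategory) (ψ : ⦋n⦌ ⟶ q) (θ : q ⟶ ⦋n⦌),
            δ j ≫ σ e = ψ ≫ θ ∧ (G.Hom x y).map θ.op ((G.Hom x y).map (δ e.succ).op w) =
              (G.Hom x y).map θ.op (c e.succ he) := by
          by_cases hjk : j.val < k.val
          · exact lower _ he e w j hj (show j.val < n - b + 1 by omega)
              (show j.val < n - b by omega) hjw
          · exact upper _ he e w j hj (show n - b + 1 < j.val by omega)
              (show n - b + 1 < j.val by omega) hjw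
        rw [h3 j ψ θ e1 e2, hjw]
  obtain ⟨w, hw, hw'⟩ := desc (n + 1 - k.val) (by have := k.isLt; omega)
  refine ⟨w, hw, fun j hj => hw' j hj ?_⟩
  have : j.val ≠ k.val := fun h => hj (Fin.ext h)
  have := k.isLt
  omega

/-- The faces of simplices can all be prescribed when moreover every simplex of the kernel with
trivial faces is the `0`-th face of a simplex of the kernel whose other faces are trivial. -/
theorem liftsFaces_map_univ (F : G ⟶ H)
    (hF : ∀ x y n, Function.Surjective ((F.map x y).app n))
    (hK : ∀ (y : G.Obj) (n : ℕ) (v : (G.Hom y y).obj (op ⦋n⦌)),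
      (F.map y y).app _ v = H.id _ _ →
      (∀ m, ∀ θ : ⦋m⦌ ⟶ ⦋n⦌, m < n → (G.Hom y y).map θ.op v = G.id y _) →
      ∃ z : (G.Hom y y).obj (op ⦋n + 1⦌), (F.map y y).app _ z = H.id _ _ ∧
        (G.Hom y y).map (δ 0).op z = v ∧
        ∀ j : Fin (n + 1), (G.Hom y y).map (δ j.succ).op z = G.id y _)
    (x y : G.Obj) (n : ℕ) : LiftsFaces (F.map x y) n Set.univ := by
  intro h c hc hm
  -- Fill the horn without its zeroth face. The defect `(d_0 w)⁻¹ c_0` lies in the kernel, and `hK`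
  -- supplies a `z` by which to multiply `w`.
  obtain ⟨w, hw, hw'⟩ := liftsFaces_map_compl F hF x y n 0 h (fun i _ => c i (Set.mem_univ _))
    (fun i _ => hc i (Set.mem_univ _)) (by
      cases n with
      | zero => trivial
      | succ n => exact fun i j hij _ _ => hm i j hij (Set.mem_univ _) (Set.mem_univ _))
  obtain ⟨z, hz, hz0, hz1⟩ := hK y n
    (G.comp (G.inv ((G.Hom x y).map (δ 0).op w)) (c 0 (Set.mem_univ _)))
    (by rw [F.map_comp, F.map_inv, F.naturality, hw, hc, H.inv_comp]) (by
      intro m θ hmn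
      cases n with
      | zero => omega
      | succ n =>
        -- A map from lower dimension factors through some `δ j`, and there the defect is trivial:
        -- `d_j d_0 w = d_0 d_{j+1} w = d_0 c_{j+1} = d_j c_0`.
        obtain ⟨j, θ, rfl⟩ := SimplexCategory.eq_comp_δ_of_not_surjective θ (fun hs => by
          have := Fintype.card_le_of_surjective _ hs
          simp at this
          omega)
        rw [op_comp, sset_map_comp (G.Hom y y), G.map_comp (δ j).op, G.map_inv, ← sset_map_comp,
          ← op_comp, ← δ_zero_comp_δ_succ, op_comp, sset_map_comp (G.Hom x y),
          hw' j.succ (Fin.succ_ne_zero j)]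
        have := hm 0 j (Fin.zero_le j) (Set.mem_univ _) (Set.mem_univ _)
        rw [this]
        change (G.Hom y y).map θ.op
          (G.comp (G.inv ((G.Hom x y).map (δ j).op (c 0 (Set.mem_univ _)))) _) = _
        rw [G.inv_comp, G.map_id])
  refine ⟨G.comp w z, ?_, ?_⟩
  · rw [F.map_comp, hw, hz, H.comp_id]
  · refine Fin.cases (fun _ => ?_) fun j _ => ?_
    · rw [G.map_comp, hz0, comp_inv_cancel]
    · rw [G.map_comp, hz1, G.comp_id, hw' j.succ (Fin.succ_ne_zero j)]

end SGpd

/-! ### Coordinates on `W̄ A`. -/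

namespace WbarAbSimplex

variable {A : SimplicialObject AddCommGrpCat.{u}} {p q r : SimplexCategory}

theorem val_self (b : WbarAbSimplex A p) (k : Fin (p.len + 1)) : b.val k k le_rfl = 0 := by
  have h := b.cocycle k k k le_rfl le_rfl
  have e : tailIncl p (le_refl k) = 𝟙 _ := by
    apply SimplexCategory.Hom.ext
    ext t
    change t.val + (k.val - k.val) = t.val
    omega
  rw [e, op_id, ab_map_id A] at h
  exact left_eq_add.1 h

/-- The entry `b_{0,α0}`, restricted along `α`. -/
def coord (b : WbarAbSimplex A p) (α : q ⟶ p) : A.obj (op q) :=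
  A.map (initMap α).op (b.val 0 (α.toOrderHom 0) (Fin.zero_le _))

theorem coord_zero (α : q ⟶ p) : (0 : WbarAbSimplex A p).coord α = 0 :=
  map_zero _

theorem coord_add (b c : WbarAbSimplex A p) (α : q ⟶ p) :
    (b + c).coord α = b.coord α + c.coord α :=
  map_add (A.map (initMap α).op).hom _ _

theorem coord_of_zero (b : WbarAbSimplex A p) (α : q ⟶ p) (h : α.toOrderHom 0 = 0) :
    b.coord α = 0 := by
  have : ∀ k (hk : k = 0), b.val 0 k (Fin.zero_le k) = 0 := by
    rintro _ rfl
    exact b.val_self 0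
  rw [coord, this _ h, map_zero]

/-- The additive cocycle relation. It is exactly what makes the twisted operators of `AbExt.cocone`
compose correctly. -/
theorem coord_comp (b : WbarAbSimplex A p) (ψ : r ⟶ q) (α : q ⟶ p) :
    b.coord (ψ ≫ α) = A.map ψ.op (b.coord α) + (wbarAbRestrict A α b).coord ψ := by
  have h := congrArg (A.map (initMap (ψ ≫ α)).op)
    (b.cocycle 0 (α.toOrderHom 0) (α.toOrderHom (ψ.toOrderHom 0)) (Fin.zero_le _)
      (α.toOrderHom.monotone (Fin.zero_le _)))
  refine h.trans ((map_add (A.map (initMap (ψ ≫ α)).op).hom _ _).trans (congrArg₂ _ ?_ ?_))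
  · refine (ab_map_comp A _ _ _).symm.trans (Eq.trans ?_ (ab_map_comp A _ _ _))
    exact congrArg (fun t => A.map (Quiver.Hom.op t) _) (initMap_comp_tailIncl ψ α)
  · refine Eq.trans ?_ (ab_map_comp A _ _ _)
    exact congrArg (fun t => A.map (Quiver.Hom.op t) _) (initMap_comp ψ α)

end WbarAbSimplex

/-! ### The extension of `H` by `WA`. -/

namespace AbExt

variable (E : AbExt.{u})

variable {E}

theorem ker_act_hom {x y : (total.obj E).Obj} {n : SimplexCategoryᵒᵖ}
    (g : ((total.obj E).Hom x y).obj n) (a : E.Ker x n) :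
    E.ker.act (x := x) (y := y) ((E.hom.map x y).app n g) a = E.conj g a :=
  DFunLike.congr_fun (E.conj_eq (E.map_lift _)) a

/-- Moves an element of the kernel past `g`; this is how the twists of two factors are collected
into the twist of their composite. -/
theorem comp_conj {x y : (total.obj E).Obj} {n : SimplexCategoryᵒᵖ}
    (g : ((total.obj E).Hom x y).obj n) (a : E.Ker x n) :
    (total.obj E).comp g (E.conj g a).val = (total.obj E).comp a.val g :=
  SGpd.comp_inv_cancel g _

/-- The action of `G` on `W̄ A` through `H`. -/
def wact {x y : (total.obj E).Obj} {n : SimplexCategoryᵒᵖ} (g : ((total.obj E).Hom x y).obj n) :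
    WbarAbSimplex (E.kerAb x) n.unop →+ WbarAbSimplex (E.kerAb y) n.unop :=
  E.ker.wbar.act (x := x) (y := y) ((E.hom.map x y).app n g)

theorem wact_id {x : (total.obj E).Obj} {n : SimplexCategoryᵒᵖ}
    (b : WbarAbSimplex (E.kerAb x) n.unop) : wact ((total.obj E).id x n) b = b := by
  refine Eq.trans ?_ (E.ker.wbar.act_id (x := x) b)
  exact congrArg (fun h => E.ker.wbar.act (x := x) (y := x) h b) (E.hom.map_id x n)

theorem wact_comp {x y z : (total.obj E).Obj} {n : SimplexCategoryᵒᵖ}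
    (g : ((total.obj E).Hom x y).obj n) (h : ((total.obj E).Hom y z).obj n)
    (b : WbarAbSimplex (E.kerAb x) n.unop) :
    wact ((total.obj E).comp g h) b = wact h (wact g b) := by
  refine Eq.trans ?_ (E.ker.wbar.act_comp (x := x) (y := y) (z := z) _ _ b)
  exact congrArg (fun h => E.ker.wbar.act (x := x) (y := z) h b) (E.hom.map_comp g h)

theorem restrict_wact {x y : (total.obj E).Obj} {n m : SimplexCategoryᵒᵖ} (θ : n ⟶ m)
    (g : ((total.obj E).Hom x y).obj n) (b : WbarAbSimplex (E.kerAb x) n.unop) :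
    wbarAbRestrict (E.kerAb y) θ.unop (wact g b) =
      wact (((total.obj E).Hom x y).map θ g) (wbarAbRestrict (E.kerAb x) θ.unop b) := by
  refine (E.ker.wbar.map_act (x := x) (y := y) θ _ b).trans ?_
  exact congrArg (fun h => E.ker.wbar.act (x := x) (y := y) h
    (wbarAbRestrict (E.kerAb x) θ.unop b)) (E.hom.naturality θ g).symm

theorem wact_val {x y : (total.obj E).Obj} {n : SimplexCategoryᵒᵖ}
    (g : ((total.obj E).Hom x y).obj n) (b : WbarAbSimplex (E.kerAb x) n.unop)
    (j k : Fin (n.unop.len + 1)) (h : j ≤ k) : (wact g b).val j k h =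
      E.conj (((total.obj E).Hom x y).map (lastIncl n.unop k).op g) (b.val j k h) := by
  refine Eq.trans ?_ (ker_act_hom _ (b.val j k h))
  exact congrArg (fun h' => E.ker.act (x := x) (y := y) h' (b.val j k h))
    (E.hom.naturality (lastIncl n.unop k).op g).symm

theorem wact_coord {x y : (total.obj E).Obj} {n : SimplexCategoryᵒᵖ} {q : SimplexCategory}
    (g : ((total.obj E).Hom x y).obj n) (b : WbarAbSimplex (E.kerAb x) n.unop)
    (α : q ⟶ n.unop) :
    (wact g b).coord α = E.conj (((total.obj E).Hom x y).map α.op g) (b.coord α) := by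
  refine (congrArg ((E.kerAb y).map (initMap α).op) (wact_val g b _ _ _)).trans
    ((E.conj_restrict (initMap α).op _ (b.val 0 (α.toOrderHom 0) (Fin.zero_le _))).trans ?_)
  refine congrArg (fun t => E.conj t (b.coord α)) ?_
  rw [← sset_map_comp, ← op_comp, initMap_lastIncl]

/-- Elements of `A` have trivial image in `H`, through which the action factors. So twisting a
morphism by `A` does not change its action. -/
theorem wact_ker {x : (total.obj E).Obj} {n : SimplexCategoryᵒᵖ} (a : E.Ker x n)
    (b : WbarAbSimplex (E.kerAb x) n.unop) : wact a.val b = b := by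
  refine Eq.trans ?_ (wact_id b)
  exact congrArg (fun h => E.ker.wbar.act (x := x) (y := x) h b)
    (a.map_val.trans (E.hom.map_id x n).symm)

variable (E)

/-- The quotient of `G ⋉ WA` by the antidiagonal copy of `A`, an extension of `H` by the
contractible `WA` and of `H ⋉ W̄ A` by `A`. Each class has a unique representative in `G ⋉ W̄ A`, which describes
the groupoid in each level; the simplicial operators are those of `G ⋉ W̄ A` twisted by the first
entry of the element of `W̄ A`. -/
def cocone : SGpd.{u} where
  Obj := (total.obj E).Obj
  Hom x y :=
    { obj := fun n => ((total.obj E).Hom x y).obj n × WbarAbSimplex (E.kerAb y) n.unop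
      map := fun θ => TypeCat.ofHom (fun c =>
        ((total.obj E).comp (((total.obj E).Hom x y).map θ c.1) (c.2.coord θ.unop).val,
          wbarAbRestrict (E.kerAb y) θ.unop c.2))
      map_id := fun n => by
        apply ConcreteCategory.hom_ext; intro c
        refine Prod.ext ?_ (ab_map_id (wbarAb.obj (E.kerAb y)) c.2)
        change (total.obj E).comp (((total.obj E).Hom x y).map (𝟙 n) c.1)
          (c.2.coord (𝟙 n.unop)).val = c.1
        rw [sset_map_id ((total.obj E).Hom x y), c.2.coord_of_zero _ rfl]
        exact SGpd.comp_id _ _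
      map_comp := fun {n m k} θ ψ => by
        apply ConcreteCategory.hom_ext; intro c
        refine Prod.ext ?_ (ab_map_comp (wbarAb.obj (E.kerAb y)) _ _ c.2)
        change (total.obj E).comp (((total.obj E).Hom x y).map (θ ≫ ψ) c.1)
          (c.2.coord (ψ.unop ≫ θ.unop)).val = (total.obj E).comp
            (((total.obj E).Hom x y).map ψ ((total.obj E).comp _ (c.2.coord θ.unop).val))
            ((wbarAbRestrict (E.kerAb y) θ.unop c.2).coord ψ.unop).val
        rw [c.2.coord_comp, SGpd.map_comp, sset_map_comp ((total.obj E).Hom x y), SGpd.assoc]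
        rfl }
  id x n := ((total.obj E).id x n, 0)
  comp c d := ((total.obj E).comp c.1 d.1, wact d.1 c.2 + d.2)
  inv c := ((total.obj E).inv c.1, -wact ((total.obj E).inv c.1) c.2)
  id_comp c := by simp [SGpd.id_comp]
  comp_id c := Prod.ext (SGpd.comp_id _ _) ((add_zero _).trans (wact_id _))
  assoc c d e := Prod.ext (SGpd.assoc _ _ _ _) (by
    change wact e.1 (wact d.1 c.2 + d.2) + e.2 =
      wact ((total.obj E).comp d.1 e.1) c.2 + (wact e.1 d.2 + e.2)
    rw [map_add, wact_comp, add_assoc])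
  inv_comp c := Prod.ext (SGpd.inv_comp _ _) (by
    change wact c.1 (-wact ((total.obj E).inv c.1) c.2) + c.2 = 0
    rw [map_neg, ← wact_comp, SGpd.inv_comp, wact_id, neg_add_cancel])
  comp_inv c := by simp [SGpd.comp_inv]
  map_id x n m θ := Prod.ext (by
    change (total.obj E).comp (((total.obj E).Hom x x).map θ ((total.obj E).id x n))
      ((0 : WbarAbSimplex (E.kerAb x) n.unop).coord θ.unop).val = _
    rw [WbarAbSimplex.coord_zero, SGpd.map_id]
    exact SGpd.comp_id _ _) (map_zero (wbarAbRestrict (E.kerAb x) θ.unop))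
  map_comp {x y z n m} θ c d := Prod.ext (by
    change (total.obj E).comp (((total.obj E).Hom x z).map θ ((total.obj E).comp c.1 d.1))
        ((wact d.1 c.2 + d.2).coord θ.unop).val =
      (total.obj E).comp
        ((total.obj E).comp (((total.obj E).Hom x y).map θ c.1) (c.2.coord θ.unop).val)
        ((total.obj E).comp (((total.obj E).Hom y z).map θ d.1) (d.2.coord θ.unop).val)
    -- The twist of a composite is the twist of `c` conjugated by the restriction of `d.1`, plus
    -- that of `d`; `comp_conj` puts the former back beside the restriction of `c.1`.
    rw [WbarAbSimplex.coord_add, wact_coord, SGpd.map_comp, SGpd.assoc, SGpd.assoc]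
    refine congrArg ((total.obj E).comp _) ?_
    refine ((total.obj E).assoc _ _ _).symm.trans (Eq.trans ?_ ((total.obj E).assoc _ _ _))
    exact congrArg (fun t => (total.obj E).comp t _) (comp_conj _ _)) (by
    change wbarAbRestrict (E.kerAb z) θ.unop (wact d.1 c.2 + d.2) =
      wact ((total.obj E).comp (((total.obj E).Hom y z).map θ d.1) (d.2.coord θ.unop).val)
        (wbarAbRestrict (E.kerAb y) θ.unop c.2) + wbarAbRestrict (E.kerAb z) θ.unop d.2
    rw [map_add, restrict_wact, wact_comp]
    exact congrArg (· + _) (wact_ker (d.2.coord θ.unop) _).symm)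

end AbExt

/-! ### Contractibility of `WA`. -/

namespace WbarAbSimplex

variable {A : SimplicialObject AddCommGrpCat.{u}} {p q r : SimplexCategory}

theorem ext_coord {b c : WbarAbSimplex A p}
    (h : ∀ (q : SimplexCategory) (α : q ⟶ p), b.coord α = c.coord α) : b = c := by
  have h0 : ∀ k, b.val 0 k (Fin.zero_le _) = c.val 0 k (Fin.zero_le _) := by
    intro k
    have e : (lastIncl p k).toOrderHom 0 = k := Fin.ext (Nat.zero_add _)
    have key : ∀ (k' : Fin (p.len + 1)) (hk : k' = k) (f : tail p k ⟶ tail p k'),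
        f ≫ lastIncl p k' = lastIncl p k →
        A.map f.op (b.val 0 k' (Fin.zero_le _)) = A.map f.op (c.val 0 k' (Fin.zero_le _)) →
        b.val 0 k (Fin.zero_le _) = c.val 0 k (Fin.zero_le _) := by
      rintro _ rfl f hf hbc
      have hf' : f = 𝟙 _ := by
        rw [← cancel_mono (lastIncl p _), hf, Category.id_comp]
      rw [hf', op_id, ab_map_id A, ab_map_id A] at hbc
      exact hbc
    exact key _ e (initMap (lastIncl p k)) (initMap_lastIncl _) (h _ (lastIncl p k))
  apply WbarAbSimplex.ext
  funext j k hjk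
  have hb := b.cocycle 0 j k (Fin.zero_le _) hjk
  have hc := c.cocycle 0 j k (Fin.zero_le _) hjk
  rw [h0 k, h0 j, hc] at hb
  exact (add_left_cancel hb).symm

/-- The cocycle which is the coboundary of `c`. -/
def ofCochain (c : ∀ k, A.obj (op (tail p k))) : WbarAbSimplex A p where
  val j k h := c k - A.map (tailIncl p h).op (c j)
  cocycle i j k hij hjk := by
    have e : tailIncl p (hij.trans hjk) = tailIncl p hjk ≫ tailIncl p hij := by
      rw [← cancel_mono (lastIncl p _), Category.assoc, tailIncl_last, tailIncl_last, tailIncl_last]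
    rw [map_sub, e, op_comp, ab_map_comp A]
    abel

theorem map_coord {A B : SimplicialObject AddCommGrpCat.{u}} (f : A ⟶ B) {p q : SimplexCategory}
    (b : WbarAbSimplex A p) (α : q ⟶ p) :
    f.app (op q) (b.coord α) =
      coord (((wbarAb.map f).app (op p) b : WbarAbSimplex B p)) α :=
  ConcreteCategory.congr_hom (f.naturality (initMap α).op) _

/-- This is surjectivity of `(W̄A)_{n+1} → A_n × (W̄A)_n`, whose target is `(WA)_n`. The simplex is
the coboundary of a cochain vanishing at vertex 0, and `σ 0` again serves to reindex the final
segments. -/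
theorem exists_cons {n : ℕ} (a : A.obj (op ⦋n⦌)) (b : WbarAbSimplex A ⦋n⦌) :
    ∃ c : WbarAbSimplex A ⦋n + 1⦌, c.coord (SimplexCategory.δ 0) = a ∧
      wbarAbRestrict A (SimplexCategory.δ 0) c = b := by
  let c : WbarAbSimplex A ⦋n + 1⦌ := ofCochain fun k =>
    if k = 0 then 0 else
      A.map (lastIncl ⦋n + 1⦌ k ≫ SimplexCategory.σ 0).op a +
        b.coord (lastIncl ⦋n + 1⦌ k ≫ SimplexCategory.σ 0)
  have hc : ∀ {q : SimplexCategory} (α : q ⟶ ⦋n + 1⦌), α.toOrderHom 0 ≠ 0 → c.coord α =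
      A.map (α ≫ SimplexCategory.σ 0).op a + b.coord (α ≫ SimplexCategory.σ 0) := by
    intro q α hα
    have h0 : (initMap α).toOrderHom 0 = 0 := Fin.ext (Nat.sub_self _)
    have e : α ≫ SimplexCategory.σ 0 =
        initMap α ≫ lastIncl ⦋n + 1⦌ (α.toOrderHom 0) ≫ SimplexCategory.σ 0 := by
      rw [← Category.assoc, initMap_lastIncl]
    rw [e, coord_comp, coord_of_zero _ _ h0, add_zero, op_comp, ab_map_comp A, ← map_add]
    refine congrArg (A.map (initMap α).op) ?_
    change ite _ _ _ - A.map _ (ite _ _ _) = _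
    rw [if_neg hα, if_pos rfl]
    exact (congrArg _ (map_zero (A.map _).hom)).trans (sub_zero _)
  have hδ : ∀ {q : SimplexCategory} (β : q ⟶ ⦋n⦌),
      c.coord (β ≫ SimplexCategory.δ 0) = A.map β.op a + b.coord β := by
    intro q β
    have e : SimplexCategory.δ 0 ≫ SimplexCategory.σ 0 = 𝟙 ⦋n⦌ := SimplexCategory.δ_comp_σ_self
    rw [hc, Category.assoc, e, Category.comp_id]
    exact Fin.succ_ne_zero (β.toOrderHom 0)
  have h1 : c.coord (SimplexCategory.δ 0) = a := by
    have := hδ (𝟙 ⦋n⦌)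
    rw [Category.id_comp] at this
    rw [this, op_id, ab_map_id A, coord_of_zero _ _ rfl, add_zero]
  refine ⟨c, h1, ext_coord fun q β => ?_⟩
  have h2 := c.coord_comp β (SimplexCategory.δ 0)
  rw [hδ, h1] at h2
  exact (add_left_cancel h2).symm

/-- A coordinate of the face `j + 1` away from vertex 0 factors through `δ 0 ≫ δ j.succ = δ j ≫ δ
0`. By `coord_comp` it is then a restriction of the `A`-component of `d_j` of the pair, which
vanishes. -/
theorem restrict_δ_succ_eq_zero {n : ℕ} (c : WbarAbSimplex A ⦋n + 1⦌)
    (h : ∀ (m : ℕ) (θ : ⦋m⦌ ⟶ ⦋n⦌), m < n →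
      A.map θ.op (c.coord (SimplexCategory.δ 0)) +
          (wbarAbRestrict A (SimplexCategory.δ 0) c).coord θ = 0 ∧
        wbarAbRestrict A θ (wbarAbRestrict A (SimplexCategory.δ 0) c) = 0)
    (j : Fin (n + 1)) : wbarAbRestrict A (SimplexCategory.δ j.succ) c = 0 := by
  apply ext_coord
  intro q α
  rw [coord_zero]
  by_cases hα : α.toOrderHom 0 = 0
  · exact coord_of_zero _ _ hα
  obtain ⟨n, rfl⟩ : ∃ n', n = n' + 1 := by
    refine Nat.exists_eq_succ_of_ne_zero ?_
    rintro rfl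
    exact hα (Subsingleton.elim (α := Fin 1) _ _)
  have h1 := c.coord_comp α (SimplexCategory.δ j.succ)
  rw [c.coord_of_zero (SimplexCategory.δ j.succ) (Fin.succ_succAbove_zero j), map_zero,
    zero_add] at h1
  rw [← h1]
  obtain ⟨α', rfl⟩ := SGpd.WSimplex.exists_comp_δ 0 α fun i hi => hα (Fin.le_zero_iff.1
    ((α.toOrderHom.monotone (Fin.zero_le i)).trans_eq hi))
  obtain ⟨h2, h3⟩ := h n (SimplexCategory.δ j) (Nat.lt_succ_self n)
  have e : (α' ≫ SimplexCategory.δ 0) ≫ SimplexCategory.δ j.succ =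
      (α' ≫ SimplexCategory.δ j) ≫ SimplexCategory.δ 0 := by
    rw [Category.assoc, Category.assoc, SGpd.δ_zero_comp_δ_succ]
  have h4 := (wbarAbRestrict A (SimplexCategory.δ 0) c).coord_comp α' (SimplexCategory.δ j)
  rw [h3, coord_zero, add_zero] at h4
  rw [e, coord_comp, h4, op_comp, ab_map_comp A, ← map_add, h2, map_zero]

end WbarAbSimplex

/-! ### The projections of `AbExt.cocone` and their naturality. -/

theorem SGpd.pull_homCast (H : SGpd.{u}) {O : Type u} (φ : O → H.Obj) {x x' y y' : O}
    (hx : x = x') (hy : y = y') :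
    (H.pull φ).homCast hx hy = H.homCast (congrArg φ hx) (congrArg φ hy) := by
  subst hx hy; rfl

theorem SGpd.Mor.ext' {G H : SGpd.{u}} {F F' : G ⟶ H} (ho : ∀ x, F.obj x = F'.obj x)
    (hm : ∀ x y, F.map x y ≫ H.homCast (ho x) (ho y) = F'.map x y) : F = F' := by
  obtain ⟨o, m, h1, h2⟩ := F
  obtain ⟨o', m', h1', h2'⟩ := F'
  obtain rfl : o = o' := funext ho
  refine SGpd.Mor.ext rfl (heq_of_eq ?_)
  funext x y
  exact hm x y

namespace AbExt

variable (E : AbExt.{u})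

/-- The projection of `AbExt.cocone` to `H ⋉ W̄ A`. -/
def coconeProj : E.cocone ⟶ E.classifyingObj :=
  SGpd.Mor.mk (G := E.cocone) (H := E.classifyingObj) (fun x => x)
    (fun x y =>
      { app := fun n => TypeCat.ofHom (fun c => ((E.hom.map x y).app n c.1, c.2))
        naturality := fun n m θ => by
          apply ConcreteCategory.hom_ext; intro c
          refine Prod.ext ?_ rfl
          change (E.hom.map x y).app m ((total.obj E).comp (((total.obj E).Hom x y).map θ c.1)
            (c.2.coord θ.unop).val) = ((base.obj E).Hom _ _).map θ ((E.hom.map x y).app n c.1)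
          -- The twist lies in the kernel and disappears in `H`.
          refine (E.hom.map_comp _ _).trans ((congrArg ((base.obj E).comp _)
            (c.2.coord θ.unop).map_val).trans ?_)
          exact (SGpd.comp_id _ _).trans (E.hom.naturality θ c.1) })
    (fun x n => Prod.ext (E.hom.map_id x n) rfl)
    (fun c d => Prod.ext (E.hom.map_comp c.1 d.1) rfl)

/-- The inclusion of `G` in `AbExt.cocone`. -/
def coconeIncl : total.obj E ⟶ E.cocone :=
  SGpd.Mor.mk (G := total.obj E) (H := E.cocone) (fun x => x)
    (fun x y =>
      { app := fun n => TypeCat.ofHom (fun g => (g, 0))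
        naturality := fun n m θ => by
          apply ConcreteCategory.hom_ext; intro g
          refine Prod.ext ?_ (map_zero (wbarAbRestrict (E.kerAb y) θ.unop)).symm
          change ((total.obj E).Hom x y).map θ g =
            (total.obj E).comp (((total.obj E).Hom x y).map θ g)
              ((0 : WbarAbSimplex (E.kerAb y) n.unop).coord θ.unop).val
          rw [WbarAbSimplex.coord_zero]
          exact (SGpd.comp_id _ _).symm })
    (fun _ _ => rfl)
    (fun {x y z n} c d => Prod.ext rfl (by
      change (0 : WbarAbSimplex (E.kerAb z) n.unop) = wact d 0 + 0
      rw [map_zero, add_zero]))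

theorem coconeProj_surjective (x y : (total.obj E).Obj) (n : SimplexCategoryᵒᵖ) :
    Function.Surjective ((E.coconeProj.map x y).app n) := by
  rintro ⟨h, b⟩
  obtain ⟨g, rfl⟩ := E.property.2.1 x y n h
  exact ⟨(g, b), rfl⟩

theorem isKanFibration_Wbar_coconeProj : IsKanFibration (SGpd.Wbar.map E.coconeProj) :=
  SGpd.isKanFibration_Wbar Function.bijective_id (fun x y => E.coconeProj_surjective x y _)
    (SGpd.liftsFaces_map_compl _ E.coconeProj_surjective)

theorem coconeProj_proj_surjective (x y : (total.obj E).Obj) (n : SimplexCategoryᵒᵖ) :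
    Function.Surjective (((E.coconeProj ≫ E.proj).map x y).app n) := fun h => by
  obtain ⟨g, hg⟩ := E.property.2.1 x y n h
  exact ⟨(g, 0), hg⟩

/-- An element of the kernel over `H` is a pair `(a, b)` in `(WA)_n`, that is, an element `c` of
`(W̄A)_{n+1}`. The filler is `(id, c)`. Its zeroth face is `(a, b)`, since the twist by `δ 0` is the
first entry of `c`; its other faces have no twist, and their `W̄ A`-components vanish because `(a,
b)` has trivial faces. -/
theorem exists_contraction (y : (total.obj E).Obj) (n : ℕ)
    (v : (E.cocone.Hom y y).obj (op ⦋n⦌))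
    (hv : ((E.coconeProj ≫ E.proj).map y y).app _ v = (base.obj E).id _ _)
    (hθ : ∀ m, ∀ θ : ⦋m⦌ ⟶ ⦋n⦌, m < n → (E.cocone.Hom y y).map θ.op v = E.cocone.id y _) :
    ∃ z : (E.cocone.Hom y y).obj (op ⦋n + 1⦌),
      ((E.coconeProj ≫ E.proj).map y y).app _ z = (base.obj E).id _ _ ∧
      (E.cocone.Hom y y).map (SimplexCategory.δ 0).op z = v ∧
      ∀ j : Fin (n + 1), (E.cocone.Hom y y).map (SimplexCategory.δ j.succ).op z =
        E.cocone.id y _ := by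
  obtain ⟨g, (b : WbarAbSimplex (E.kerAb y) ⦋n⦌)⟩ := v
  let a : E.Ker y (op ⦋n⦌) := ⟨g, hv⟩
  obtain ⟨c, hc, hc'⟩ := WbarAbSimplex.exists_cons (A := E.kerAb y) a b
  have key (j : Fin (n + 1)) := c.restrict_δ_succ_eq_zero (fun m θ hm => by
    rw [hc, hc']
    have h := hθ m θ hm
    exact ⟨Ker.ext (congrArg Prod.fst h), congrArg Prod.snd h⟩) j
  have hid : ∀ {m : ℕ} (θ : ⦋m⦌ ⟶ ⦋n + 1⦌), (total.obj E).comp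
      (((total.obj E).Hom y y).map θ.op ((total.obj E).id y (op ⦋n + 1⦌)))
        (c.coord θ : E.Ker y (op ⦋m⦌)).val = (c.coord θ : E.Ker y (op ⦋m⦌)).val := by
    intro m θ
    rw [SGpd.map_id]
    exact SGpd.id_comp _ _
  refine ⟨((total.obj E).id y _, c), E.hom.map_id y _, Prod.ext ?_ hc',
    fun j => Prod.ext ?_ (key j)⟩
  · exact (hid _).trans (congrArg Ker.val hc)
  · exact (hid _).trans (congrArg Ker.val (c.coord_of_zero (SimplexCategory.δ j.succ)
      (Fin.succ_succAbove_zero j)))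

theorem isWeakEquivalence_Wbar_coconeProj_proj :
    IsWeakEquivalence (SGpd.Wbar.map (E.coconeProj ≫ E.proj)) :=
  SGpd.isWeakEquivalence_Wbar E.property.1 (fun x y => E.coconeProj_proj_surjective x y _)
    (SGpd.liftsFaces_map_univ _ E.coconeProj_proj_surjective E.exists_contraction)

variable {E} {E' : AbExt.{u}} (φ : E ⟶ E')

/-- Functoriality of `AbExt.cocone`. -/
def coconeMap : E.cocone ⟶ E'.cocone :=
  SGpd.Mor.mk (G := E.cocone) (H := E'.cocone) (total.map φ).obj
    (fun x y =>
      { app := fun n => TypeCat.ofHom (fun c => (((total.map φ).map x y).app n c.1,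
          (wbarAb.map ((kerMap φ).app y)).app n c.2))
        naturality := fun n m θ => by
          apply ConcreteCategory.hom_ext; intro c
          refine Prod.ext ?_ ?_
          swap
          · exact ConcreteCategory.congr_hom ((wbarAb.map ((kerMap φ).app y)).naturality θ) c.2
          refine ((total.map φ).map_comp _ _).trans ?_
          refine congrArg₂ (total.obj E').comp ((total.map φ).naturality θ c.1) ?_
          exact congrArg Ker.val (WbarAbSimplex.map_coord ((kerMap φ).app y) c.2 θ.unop) })
    (fun x n => Prod.ext ((total.map φ).map_id x n) (map_zero _))
    (fun {x y z n} c d => Prod.ext ((total.map φ).map_comp c.1 d.1) (by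
      refine Eq.trans (map_add ((wbarAb.map ((kerMap φ).app z)).app n).hom _ _) ?_
      refine congrArg (· + _) (((kerMap φ).wbar.act (x := y) (y := z) _ c.2).trans ?_)
      exact congrArg (fun h => E'.ker.wbar.act (x := (total.map φ).obj y)
        (y := (total.map φ).obj z) h ((wbarAb.map ((kerMap φ).app y)).app n c.2))
        (baseMap'_hom φ d.1)))

/-- The functor `AbExt.cocone`. -/
def coconeFunctor : AbExt.{u} ⥤ SGpd.{u} where
  obj E := E.cocone
  map φ := coconeMap φ
  map_id _ := rfl
  map_comp _ _ := rfl

/-- The natural transformation `AbExt.coconeProj`. -/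
def coconeProjNat : coconeFunctor.{u} ⟶ classifying where
  app E := E.coconeProj
  naturality E E' φ := by
    refine SGpd.Mor.ext rfl (heq_of_eq ?_)
    funext x y
    ext n : 1
    apply ConcreteCategory.hom_ext; intro c
    exact Prod.ext (baseMap'_hom φ c.1).symm rfl

/-- The natural transformation `AbExt.coconeIncl`. -/
def coconeInclNat : total.{u} ⟶ coconeFunctor where
  app E := E.coconeIncl
  naturality E E' φ := by
    refine SGpd.Mor.ext rfl (heq_of_eq ?_)
    funext x y
    ext n : 1
    apply ConcreteCategory.hom_ext; intro c
    exact Prod.ext rfl (map_zero ((wbarAb.map ((kerMap φ).app y)).app n).hom).symm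

/-- The natural transformation `AbExt.proj`. -/
def projNat : classifying.{u} ⟶ base where
  app E := E.proj
  naturality E E' φ := by
    -- In this direction the equality of objects is `obj_w`, and the transport along it is already
    -- built into `baseMap'`.
    symm
    refine SGpd.Mor.ext' (obj_w φ) fun x y => ?_
    rfl

theorem zero_proj : E.zero ≫ E.proj = 𝟙 _ := by
  let e := Equiv.ofBijective _ E.property.1
  symm
  refine SGpd.Mor.ext' (fun x => (e.apply_symm_apply x).symm) fun x y => ?_
  rfl

theorem coconeIncl_coconeProj : E.coconeIncl ≫ E.coconeProj = E.hom ≫ E.zero := by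
  let e := Equiv.ofBijective _ E.property.1
  have he := fun x => e.symm_apply_apply x
  -- The zero section renames objects by the inverse of the bijection on objects, so the two sides
  -- agree only up to transport; the transports combine to a trivial one.
  symm
  refine SGpd.Mor.ext' he fun x y => ?_
  have h1 := SGpd.homCast_map E.ker.wbar.semidirectZero (he x) (he y)
  have h2 := SGpd.pull_homCast (base.obj E) E.hom.obj (he x) (he y)
  have h3 := SGpd.homCast_trans (base.obj E) (e.apply_symm_apply (E.hom.obj x)).symm
    (e.apply_symm_apply (E.hom.obj y)).symm
    (congrArg E.hom.obj (he x)) (congrArg E.hom.obj (he y))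
  ext n : 1
  apply ConcreteCategory.hom_ext; intro g
  have k1 := ConcreteCategory.congr_hom (NatTrans.congr_app h1 n)
    (((base.obj E).homCast (e.apply_symm_apply (E.hom.obj x)).symm
      (e.apply_symm_apply (E.hom.obj y)).symm).app n ((E.hom.map x y).app n g))
  refine k1.symm.trans (congrArg ((E.ker.wbar.semidirectZero.map x y).app n) ?_)
  exact (ConcreteCategory.congr_hom (NatTrans.congr_app h2 n) _).trans
    (ConcreteCategory.congr_hom (NatTrans.congr_app h3 n) ((E.hom.map x y).app n g))

end AbExt

/-! ### The pullback square for abelian extensions. -/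

namespace AbExt

variable (E : AbExt.{u})

theorem Wbar_coconeIncl_injective {n : SimplexCategory} {s t : (total.obj E).WSimplex n}
    (h : (SGpd.Wbar.map E.coconeIncl).app (op n) s = (SGpd.Wbar.map E.coconeIncl).app (op n) t) :
    s = t := by
  obtain ⟨o, m, h1, h2⟩ := s
  obtain ⟨o', m', h1', h2'⟩ := t
  obtain rfl : o = o' := congrArg SGpd.WSimplex.obj h
  refine SGpd.WSimplex.ext rfl (heq_of_eq ?_)
  have h3 := (SGpd.WSimplex.ext_iff.1 h).2
  funext j k hjk
  exact congrArg Prod.fst (congrFun (congrFun (congrFun (eq_of_heq h3) j) k) hjk)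

/-- When the `W̄ A`-components vanish so do the twists, and the first components satisfy the cocycle
relation of `W̄ G` itself. -/
theorem exists_Wbar_coconeIncl {n : SimplexCategory} (s : E.cocone.WSimplex n)
    (h : ∀ j k hjk, (s.hom j k hjk).2 = 0) :
    ∃ t : (total.obj E).WSimplex n, (SGpd.Wbar.map E.coconeIncl).app (op n) t = s := by
  have hs : ∀ j k hjk, s.hom j k hjk = (E.coconeIncl.map _ _).app _ (s.hom j k hjk).1 :=
    fun j k hjk => Prod.ext rfl (h j k hjk)
  refine ⟨⟨s.obj, fun j k hjk => (s.hom j k hjk).1, fun j => congrArg Prod.fst (s.hom_id j),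
    fun i j k hij hjk => ?_⟩, SGpd.WSimplex.ext rfl (heq_of_eq ?_)⟩
  · refine (congrArg Prod.fst (s.hom_comp i j k hij hjk)).trans ?_
    refine congrArg (fun t => (total.obj E).comp t (s.hom j k hjk).1) ?_
    refine (congrArg (fun t => ((E.cocone.Hom _ _).map (tailIncl n hjk).op t).1) (hs i j hij)).trans
      ?_
    exact congrArg Prod.fst (E.coconeIncl.naturality (tailIncl n hjk).op (s.hom i j hij).1).symm
  · funext j k hjk
    exact (hs j k hjk).symm

theorem Wbar_zero_hom_snd {n : SimplexCategory} {t : (base.obj E).WSimplex n}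
    {s : E.classifyingObj.WSimplex n} (h : (SGpd.Wbar.map E.zero).app (op n) t = s)
    (j k : Fin (n.len + 1)) (hjk : j ≤ k) : (s.hom j k hjk).2 = 0 := by
  subst h
  rfl

theorem isPullback_Wbar : IsPullback (SGpd.Wbar.map E.coconeIncl) (SGpd.Wbar.map E.hom)
    (SGpd.Wbar.map E.coconeProj) (SGpd.Wbar.map E.zero) := by
  have w : SGpd.Wbar.map E.coconeIncl ≫ SGpd.Wbar.map E.coconeProj =
      SGpd.Wbar.map E.hom ≫ SGpd.Wbar.map E.zero := by
    rw [← Functor.map_comp, ← Functor.map_comp, coconeIncl_coconeProj]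
  refine IsPullback.of_forall_isPullback_app fun n => (Types.isPullback_iff _ _ _ _).2
    ⟨NatTrans.congr_app w n, fun s t hst => E.Wbar_coconeIncl_injective hst.1, ?_⟩
  intro (s : E.cocone.WSimplex n.unop) (t : (base.obj E).WSimplex n.unop) hst
  obtain ⟨r, hr⟩ := E.exists_Wbar_coconeIncl s
    (fun j k hjk => E.Wbar_zero_hom_snd hst.symm j k hjk)
  refine ⟨r, hr, ?_⟩
  have hz : SGpd.Wbar.map E.zero ≫ SGpd.Wbar.map E.proj = 𝟙 _ := by
    rw [← Functor.map_comp, zero_proj, CategoryTheory.Functor.map_id]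
  -- The component in `W̄ H` need not be checked separately: it is determined by its image under the
  -- zero section, which `proj` retracts.
  have hinj : Function.Injective ((SGpd.Wbar.map E.zero).app n) :=
    Function.LeftInverse.injective (g := (SGpd.Wbar.map E.proj).app n)
      fun x => ConcreteCategory.congr_hom (NatTrans.congr_app hz n) x
  apply hinj
  refine (ConcreteCategory.congr_hom (NatTrans.congr_app w n) r).symm.trans ?_
  exact (congrArg ((SGpd.Wbar.map E.coconeProj).app n) hr).trans hst

theorem exists_classifyingMap :
    ∃ (Y : AbExt.{u} ⥤ SSet.{u})
      (p : Y ⟶ AbExt.classifying ⋙ SGpd.Wbar)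
      (w : Y ⟶ AbExt.base ⋙ SGpd.Wbar)
      (i : AbExt.total ⋙ SGpd.Wbar ⟶ Y),
      ∀ E : AbExt.{u},
        IsKanFibration (p.app E) ∧
        w.app E = p.app E ≫ SGpd.Wbar.map E.proj ∧
        IsWeakEquivalence (w.app E) ∧
        IsPullback (i.app E) (SGpd.Wbar.map E.hom) (p.app E) (SGpd.Wbar.map E.zero) ∧
        IsHomotopyPullback (i.app E) (SGpd.Wbar.map E.hom) (p.app E) (SGpd.Wbar.map E.zero) :=
  ⟨coconeFunctor ⋙ SGpd.Wbar, Functor.whiskerRight coconeProjNat _,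
    Functor.whiskerRight (coconeProjNat ≫ projNat) _, Functor.whiskerRight coconeInclNat _,
    fun E => ⟨E.isKanFibration_Wbar_coconeProj, rfl, E.isWeakEquivalence_Wbar_coconeProj_proj,
      E.isPullback_Wbar,
      IsHomotopyPullback.of_isPullback E.isPullback_Wbar E.isKanFibration_Wbar_coconeProj⟩⟩

end AbExt

/-! ### Central extensions of simplicial groups. -/

/-- A simplicial abelian group as a simplicial groupoid with one object. -/
def ofAb : SimplicialObject AddCommGrpCat.{u} ⥤ SGpd.{u} where
  obj A :=
    { Obj := PUnit
      Hom := fun _ _ => underlying.obj A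
      id := fun _ n => (0 : A.obj n)
      comp := fun {_ _ _ n} (a b : A.obj n) => a + b
      inv := fun {_ _ n} (a : A.obj n) => -a
      id_comp := fun {_ _ n} _ => zero_add (M := A.obj n) _
      comp_id := fun {_ _ n} _ => add_zero (M := A.obj n) _
      assoc := fun {_ _ _ _ n} _ _ _ => add_assoc (G := A.obj n) _ _ _
      inv_comp := fun {_ _ n} _ => neg_add_cancel (G := A.obj n) _
      comp_inv := fun {_ _ n} _ => add_neg_cancel (G := A.obj n) _
      map_id := fun _ _ _ θ => map_zero (A.map θ).hom
      map_comp := fun θ _ _ => map_add (A.map θ).hom _ _ }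
  map f :=
    { obj := fun x => x
      map := fun _ _ => underlying.map f
      map_id := fun _ n => map_zero (f.app n).hom
      map_comp := fun {_ _ _ n} _ _ => map_add (f.app n).hom _ _ }
  map_id _ := rfl
  map_comp _ _ := rfl

/-- The two descriptions of `W̄ A` for a simplicial abelian group `A` agree. -/
def WbarOfAb (A : SimplicialObject AddCommGrpCat.{u}) :
    SGpd.Wbar.obj (ofAb.obj A) ≅ underlying.obj (wbarAb.obj A) :=
  NatIso.ofComponents (fun n => Equiv.toIso
    { toFun := fun (s : (ofAb.obj A).WSimplex n.unop) =>
        (⟨fun j k h => s.hom j k h, s.hom_comp⟩ : WbarAbSimplex A n.unop)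
      invFun := fun (b : WbarAbSimplex A n.unop) =>
        (⟨fun _ => PUnit.unit, fun j k h => b.val j k h, b.val_self, b.cocycle⟩ :
          (ofAb.obj A).WSimplex n.unop)
      left_inv := fun _ => rfl
      right_inv := fun _ => rfl }) (fun _ => rfl)

/-- `WbarOfAb` is natural. -/
def WbarOfAbNat : ofAb.{u} ⋙ SGpd.Wbar ≅ wbarAb ⋙ underlying :=
  NatIso.ofComponents WbarOfAb (fun _ => rfl)

namespace CentralExt

/-- A central extension of simplicial groups as an abelian extension of simplicial groupoids. -/
def toAbExt : CentralExt.{u} ⥤ AbExt.{u} :=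
  ObjectProperty.lift _ (ObjectProperty.ι _ ⋙ oneObj.mapArrow) fun E =>
    ⟨Function.bijective_id, fun _ _ n => (E.property n).1, fun _ n a b ha _ =>
      ((E.property n).2 a b ha).symm⟩

variable (E : CentralExt.{u})

theorem conj_toAbExt {x y : (AbExt.total.obj (toAbExt.obj E)).Obj} {n : SimplexCategoryᵒᵖ}
    (g : ((AbExt.total.obj (toAbExt.obj E)).Hom x y).obj n) (a : (toAbExt.obj E).Ker x n) :
    ((toAbExt.obj E).conj g a).val = a.val := by
  let g' : (total.obj E).obj n := g
  let a' : (total.obj E).obj n := a.val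
  have ha : a' * g' = g' * a' := (E.property n).2 a' g' a.map_val
  change (g' * a') * g'⁻¹ = a'
  rw [← ha, mul_inv_cancel_right]

/-- Conjugation is trivial on a central kernel, and `H` acts on each entry by conjugation with a
lift. -/
theorem wbar_act_toAbExt {x y : (AbExt.total.obj (toAbExt.obj E)).Obj} {n : SimplexCategoryᵒᵖ}
    (h : ((toAbExt.obj E).base'.Hom x y).obj n)
    (b : WbarAbSimplex ((toAbExt.obj E).kerAb x) n.unop) :
    (toAbExt.obj E).ker.wbar.act (x := x) (y := y) h b = b := by
  apply WbarAbSimplex.ext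
  funext j k hjk
  exact AbExt.Ker.ext (conj_toAbExt E _ (b.val j k hjk))

/-- The kernel of a central extension of simplicial groups, as the kernel of an abelian
extension of simplicial groupoids. -/
def kerToAbExt (x : (AbExt.total.obj (toAbExt.obj E)).Obj) :
    (toAbExt.obj E).kerAb x ⟶ ker.obj E where
  app n := AddCommGrpCat.ofHom
    { toFun := fun (a : (toAbExt.obj E).Ker x n) => (⟨a.val, a.map_val⟩ : E.Ker n)
      map_zero' := rfl
      -- `oneObj` composes in the order opposite to multiplication, so the two additions on the
      -- kernel agree only by commutativity.
      map_add' := fun a b => Ker.ext ((E.property n).2 a.val b.val a.map_val).symm }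
  naturality _ _ _ := rfl

/-- The projection `H ⋉ W̄ A ⟶ W̄ A`, for a trivial action of `H` on `A`. -/
def sndHom : (toAbExt.obj E).classifyingObj ⟶ ofAb.obj (wbarAb.obj (ker.obj E)) :=
  SGpd.Mor.mk (G := (toAbExt.obj E).classifyingObj) (H := ofAb.obj (wbarAb.obj (ker.obj E)))
    (fun x => x)
    (fun x y =>
      { app := fun n => TypeCat.ofHom (fun c => (wbarAb.map (E.kerToAbExt y)).app n c.2)
        naturality := fun n m θ => by
          apply ConcreteCategory.hom_ext; intro c
          exact ConcreteCategory.congr_hom ((wbarAb.map (E.kerToAbExt y)).naturality θ) c.2 })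
    (fun x n => map_zero ((wbarAb.map (E.kerToAbExt x)).app n).hom)
    (fun {x y z n} c d => by
      refine Eq.trans (map_add ((wbarAb.map (E.kerToAbExt z)).app n).hom _ _) ?_
      exact congrArg (fun t => (wbarAb.map (E.kerToAbExt z)).app n t + _)
        (E.wbar_act_toAbExt d.1 c.2))

/-- The natural transformation `CentralExt.sndHom`. -/
def sndNat : toAbExt.{u} ⋙ AbExt.classifying ⟶ ker ⋙ wbarAb ⋙ ofAb where
  app E := E.sndHom
  naturality _ _ _ := rfl

theorem coconeProj_sndHom_surjective (x y : (AbExt.total.obj (toAbExt.obj E)).Obj)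
    (n : SimplexCategoryᵒᵖ) :
    Function.Surjective ((((toAbExt.obj E).coconeProj ≫ E.sndHom).map x y).app n) := by
  intro (b : WbarAbSimplex (ker.obj E) n.unop)
  let b' : WbarAbSimplex ((toAbExt.obj E).kerAb y) n.unop :=
    ⟨fun j k h => ⟨(b.val j k h : E.Ker _).val, (b.val j k h : E.Ker _).map_val⟩,
      fun i j k hij hjk => AbExt.Ker.ext ((congrArg Ker.val (b.cocycle i j k hij hjk)).trans
        ((E.property _).2 _ _ (Ker.map_val _)))⟩
  exact ⟨((1 : (total.obj E).obj n), b'), rfl⟩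

/-- The map `φ : Y' ⟶ W̄² A`. -/
def toWbarWbar : toAbExt.{u} ⋙ AbExt.coconeFunctor ⋙ SGpd.Wbar ⟶
    ker ⋙ wbarAb ⋙ wbarAb ⋙ underlying :=
  Functor.whiskerLeft toAbExt (Functor.whiskerRight AbExt.coconeProjNat SGpd.Wbar) ≫
    Functor.whiskerRight sndNat SGpd.Wbar ≫ Functor.whiskerLeft (ker ⋙ wbarAb) WbarOfAbNat.hom

/-- Up to the isomorphism `WbarOfAb`, the map is `W̄` of a single levelwise surjection onto `W̄ A`,
so the criterion for abelian extensions applies again. -/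
theorem isKanFibration_toWbarWbar : IsKanFibration (toWbarWbar.app E) := by
  have h : IsKanFibration (SGpd.Wbar.map ((toAbExt.obj E).coconeProj ≫ E.sndHom)) :=
    SGpd.isKanFibration_Wbar Function.bijective_id
      (fun x y => E.coconeProj_sndHom_surjective x y _)
      (SGpd.liftsFaces_map_compl _ E.coconeProj_sndHom_surjective)
  exact SSet.modelCategoryQuillen.J.rlp.comp_mem _ (WbarOfAb _).hom h
    (MorphismProperty.of_isIso _ _)

theorem isPullback_toWbarWbar :
    IsPullback (SGpd.Wbar.map (toAbExt.obj E).coconeIncl) (terminal.from _) (toWbarWbar.app E)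
      (basePoint (wbarAb.obj (wbarAb.obj (ker.obj E)))) := by
  have hb : ∀ n (t : (⊤_ SSet.{u}).obj n),
      (basePoint (wbarAb.obj (wbarAb.obj (ker.obj E)))).app n t =
        (0 : WbarAbSimplex (wbarAb.obj (ker.obj E)) n.unop) :=
    fun n t => map_zero ((wbarAb.obj (wbarAb.obj (ker.obj E))).map _).hom
  refine IsPullback.of_forall_isPullback_app fun n => (Types.isPullback_iff _ _ _ _).2
    ⟨?_, fun s t hst => (toAbExt.obj E).Wbar_coconeIncl_injective hst.1, ?_⟩
  · apply ConcreteCategory.hom_ext; intro s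
    refine Eq.trans ?_ (hb n
      ((terminal.from (SGpd.Wbar.obj (AbExt.total.obj (toAbExt.obj E)))).app n s)).symm
    apply WbarAbSimplex.ext
    funext j k hjk
    rfl
  · intro (s : (toAbExt.obj E).cocone.WSimplex n.unop) t hst
    have hs := hst.trans (hb n t)
    -- Lying over the base point means that every entry of the `W̄ A`-components is trivial, so the
    -- simplex comes from `W̄ G`.
    obtain ⟨r, hr⟩ := (toAbExt.obj E).exists_Wbar_coconeIncl s (fun j k hjk => by
      have h := congrFun (congrFun (congrFun (congrArg WbarAbSimplex.val hs) j) k) hjk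
      apply WbarAbSimplex.ext
      funext j' k' hjk'
      have h' := congrFun (congrFun (congrFun (congrArg WbarAbSimplex.val h) j') k') hjk'
      exact AbExt.Ker.ext (congrArg Ker.val h'))
    exact ⟨r, hr, ConcreteCategory.congr_hom
      (((terminalIsTerminal (C := SSet.{u})).isTerminalObj ((evaluation _ _).obj n)).hom_ext
        ((terminal.from (SGpd.Wbar.obj (AbExt.total.obj (toAbExt.obj E)))).app n)
        (TypeCat.ofHom fun _ => t)) r⟩

theorem exists_classifyingMap :
    ∃ (Y : CentralExt.{u} ⥤ SSet.{u})
      (f : Y ⟶ CentralExt.ker ⋙ wbarAb ⋙ wbarAb ⋙ underlying)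
      (w : Y ⟶ CentralExt.base ⋙ oneObj ⋙ SGpd.Wbar)
      (i : CentralExt.total ⋙ oneObj ⋙ SGpd.Wbar ⟶ Y),
      ∀ E : CentralExt.{u},
        IsKanFibration (f.app E) ∧
        IsWeakEquivalence (w.app E) ∧
        i.app E ≫ w.app E = SGpd.Wbar.map (oneObj.map E.hom) ∧
        IsPullback (i.app E) (terminal.from _) (f.app E) (basePoint _) ∧
        IsHomotopyPullback (i.app E) (terminal.from _) (f.app E) (basePoint _) := by
  refine ⟨toAbExt ⋙ AbExt.coconeFunctor ⋙ SGpd.Wbar, toWbarWbar,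
    Functor.whiskerLeft toAbExt
      (Functor.whiskerRight (AbExt.coconeProjNat ≫ AbExt.projNat) SGpd.Wbar),
    Functor.whiskerLeft toAbExt (Functor.whiskerRight AbExt.coconeInclNat SGpd.Wbar),
    fun E => ⟨E.isKanFibration_toWbarWbar,
      (toAbExt.obj E).isWeakEquivalence_Wbar_coconeProj_proj, ?_, E.isPullback_toWbarWbar,
      IsHomotopyPullback.of_isPullback E.isPullback_toWbarWbar E.isKanFibration_toWbarWbar⟩⟩
  have h : (toAbExt.obj E).coconeIncl ≫ (toAbExt.obj E).coconeProj ≫ (toAbExt.obj E).proj =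
      (toAbExt.obj E).hom := by
    rw [← Category.assoc, AbExt.coconeIncl_coconeProj, Category.assoc, AbExt.zero_proj,
      Category.comp_id]
  exact (SGpd.Wbar.map_comp _ _).symm.trans (congrArg SGpd.Wbar.map h)

end CentralExt

end

theorem mainTheorem3 :
    (∃ (Y : AbExt.{u} ⥤ SSet.{u})
      (p : Y ⟶ AbExt.classifying ⋙ SGpd.Wbar)
      (w : Y ⟶ AbExt.base ⋙ SGpd.Wbar)
      (i : AbExt.total ⋙ SGpd.Wbar ⟶ Y),
      ∀ E : AbExt.{u},
        IsKanFibration (p.app E) ∧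
        w.app E = p.app E ≫ SGpd.Wbar.map E.proj ∧
        IsWeakEquivalence (w.app E) ∧
        IsPullback (i.app E) (SGpd.Wbar.map E.hom) (p.app E) (SGpd.Wbar.map E.zero) ∧
        IsHomotopyPullback (i.app E) (SGpd.Wbar.map E.hom) (p.app E) (SGpd.Wbar.map E.zero)) ∧
    (∃ (Y : CentralExt.{u} ⥤ SSet.{u})
      (f : Y ⟶ CentralExt.ker ⋙ wbarAb ⋙ wbarAb ⋙ underlying)
      (w : Y ⟶ CentralExt.base ⋙ oneObj ⋙ SGpd.Wbar)
      (i : CentralExt.total ⋙ oneObj ⋙ SGpd.Wbar ⟶ Y),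
      ∀ E : CentralExt.{u},
        IsKanFibration (f.app E) ∧
        IsWeakEquivalence (w.app E) ∧
        i.app E ≫ w.app E = SGpd.Wbar.map (oneObj.map E.hom) ∧
        IsPullback (i.app E) (terminal.from _) (f.app E) (basePoint _) ∧
        IsHomotopyPullback (i.app E) (terminal.from _) (f.app E) (basePoint _)) := by
  exact ⟨AbExt.exists_classifyingMap, CentralExt.exists_classifyingMap⟩
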